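/- Let $k$ be a field with $\operatorname{char}(k)\neq 2,3$, and let $R$ be a commutative ring of characteristic $0$ with a ring homomorphism $R\to k$ (for example $R=\mathbb Z$, or $R=k$ if $\operatorname{char}(k)=0$). Let $\Omega=\{1,\dots,r\}$, $\tau\subseteq\Omega$, and let $A=(a_{ij})_{i,j\in\Omega}$ be a generalized Cartan matrix with entries in $R$: (i) each $a_{ii}$ is $2$ or $0$, and $a_{ii}=0$ implies $i\in\tau$; (ii) if $a_{ii}\neq0$ then $a_{ij}\in\mathbb Z_{\le0}$ for $j\ne i$; (iii) $a_{ij}=0$ implies $a_{ji}=0$; (iv) if $a_{ii}=2$ and $i\in\tau$ then $a_{ij}\in2\mathbb Z$ for all $j$. For $i\neq j$ let $n_{ij}=a_{ij}$ if $a_{ii}=2$ or $a_{ij}=0$, and $n_{ij}=-1$ otherwise. The Kac–Moody superalgebra $\mathcal G=\mathcal G(A,\tau)$ is the Lie superalgebra over $k$ with generators $e_i,h_i,f_i$ $(i\in\Omega)$, where $h_i$ is even and $e_i,f_i$ are odd if $i\in\tau$ and even otherwise, and with defining relations $$[h_i,h_j]=0\ (i>j),\quad [e_i,f_j]=\delta_{ij}h_i,\quad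 [e_j,h_i]=-a_{ij}e_j,\quad [h_i,f_j]=-a_{ij}f_j,$$ and, for $x=e$ and for $x=f$, $$(\operatorname{ad}x_i)^{1-n_{ij}}x_j=0\ \text{ and }\ x_i(\widetilde{\operatorname{ad}}\,x_j)^{1-n_{ji}}=0\ (i>j),\qquad [[x_{m+1},x_m],[x_m,x_{m-1}]]=0\ (m\in\eta).$$ Here $u(\widetilde{\operatorname{ad}}\,v)=[u,v]$ is the right adjoint action, and $\eta$ is the set of $m\in\tau$ with $m\pm1\in\Omega\setminus\tau$, $a_{mm}=0$, $a_{m+1,m-1}=0$ and $a_{m,m+1}+a_{m,m-1}=0$. The free Lie superalgebra on a $\mathbb Z_2$-graded set $X$ is taken as the sub-superalgebra generated by $X$ of the free associative algebra on $X$ with the superbracket. Let $\mathcal G_+,\mathcal G_0,\mathcal G_-$ be the subalgebras of $\mathcal G$ generated by the $e_i$, by the $h_i$ and by the $f_i$, respectively, and let $U(\cdot)$ denote the universal enveloping algebra of a Lie superalgebra. Then, as $k$-vector spaces, $$\mathcal G_+\oplus\mathcal G_0\oplus\mathcal G_-\;\cong\;\mathcal G\quad\text{via } (x,y,z)\mapsto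 x+y+z,$$ and $$U(\mathcal G_+)\otimes_kU(\mathcal G_0)\otimes_kU(\mathcal G_-)\;\cong\;U(\mathcal G)\quad\text{via } u\otimes v\otimes w\mapsto uvw,$$ where the product is formed in $U(\mathcal G)$ after applying the homomorphisms induced by the inclusions. -/

import Mathlib

open scoped TensorProduct

/-- The sign `(-1) ^ (a * b)` for parities `a, b`. -/
def koszulSign (k : Type*) [Field k] (a b : ZMod 2) : k := if a = 1 ∧ b = 1 then -1 else 1

/-- A Lie superalgebra structure on the vector space `L` over `k` (the characteristic of `k` is
meant to be different from `2` and `3`). -/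
structure LieSuperalgebra (k L : Type*) [Field k] [AddCommGroup L] [Module k L] where
  /-- the homogeneous components -/
  grade : ZMod 2 → Submodule k L
  /-- the superbracket -/
  br : L →ₗ[k] L →ₗ[k] L
  isCompl : IsCompl (grade 0) (grade 1)
  br_mem : ∀ {a b : ZMod 2} {x y : L}, x ∈ grade a → y ∈ grade b → br x y ∈ grade (a + b)
  skew : ∀ {a b : ZMod 2} {x y : L}, x ∈ grade a → y ∈ grade b →
    br x y = -(koszulSign k a b • br y x)
  jacobi : ∀ {a b c : ZMod 2} {x y z : L}, x ∈ grade a → y ∈ grade b → z ∈ grade c →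
    br x (br y z) = br (br x y) z + koszulSign k a b • br y (br x z)

namespace LieSuperalgebra

section General

variable {k L : Type*} [Field k] [AddCommGroup L] [Module k L]

/-- A submodule is graded if it contains the homogeneous components of each of its elements. -/
def IsGraded (G : LieSuperalgebra k L) (N : Submodule k L) : Prop :=
  ∀ y ∈ G.grade 0, ∀ z ∈ G.grade 1, y + z ∈ N → y ∈ N ∧ z ∈ N

/-- Sub-superalgebras of a Lie superalgebra. -/
structure Sub (G : LieSuperalgebra k L) where
  carrier : Submodule k L
  graded : G.IsGraded carrier
  br_mem : ∀ x ∈ carrier, ∀ y ∈ carrier, G.br x y ∈ carrier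

/-- (Graded, two-sided) ideals of a Lie superalgebra. -/
structure GradedIdeal (G : LieSuperalgebra k L) where
  carrier : Submodule k L
  graded : G.IsGraded carrier
  br_mem_left : ∀ x, ∀ y ∈ carrier, G.br x y ∈ carrier
  br_mem_right : ∀ x ∈ carrier, ∀ y, G.br x y ∈ carrier

/-- The sub-superalgebra generated by a set: the smallest one that contains it. -/
def subGen (G : LieSuperalgebra k L) (S : Set L) : G.Sub where
  carrier := sInf {N | ∃ M : G.Sub, M.carrier = N ∧ S ⊆ N}
  graded := by
    intro y hy z hz h
    simp only [Submodule.mem_sInf, Set.mem_ofPred_eq] at h ⊢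
    refine ⟨?_, ?_⟩
    · rintro N ⟨M, rfl, hS⟩
      exact (M.graded y hy z hz (h _ ⟨M, rfl, hS⟩)).1
    · rintro N ⟨M, rfl, hS⟩
      exact (M.graded y hy z hz (h _ ⟨M, rfl, hS⟩)).2
  br_mem := by
    intro x hx y hy
    simp only [Submodule.mem_sInf, Set.mem_ofPred_eq] at hx hy ⊢
    rintro N ⟨M, rfl, hS⟩
    exact M.br_mem x (hx _ ⟨M, rfl, hS⟩) y (hy _ ⟨M, rfl, hS⟩)

/-- The ideal generated by a set: the smallest one that contains it. -/
def idealGen (G : LieSuperalgebra k L) (S : Set L) : G.GradedIdeal where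
  carrier := sInf {N | ∃ M : G.GradedIdeal, M.carrier = N ∧ S ⊆ N}
  graded := by
    intro y hy z hz h
    simp only [Submodule.mem_sInf, Set.mem_ofPred_eq] at h ⊢
    refine ⟨?_, ?_⟩
    · rintro N ⟨M, rfl, hS⟩
      exact (M.graded y hy z hz (h _ ⟨M, rfl, hS⟩)).1
    · rintro N ⟨M, rfl, hS⟩
      exact (M.graded y hy z hz (h _ ⟨M, rfl, hS⟩)).2
  br_mem_left := by
    intro x y hy
    simp only [Submodule.mem_sInf, Set.mem_ofPred_eq] at hy ⊢
    rintro N ⟨M, rfl, hS⟩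
    exact M.br_mem_left x y (hy _ ⟨M, rfl, hS⟩)
  br_mem_right := by
    intro x hx y
    simp only [Submodule.mem_sInf, Set.mem_ofPred_eq] at hx ⊢
    rintro N ⟨M, rfl, hS⟩
    exact M.br_mem_right x (hx _ ⟨M, rfl, hS⟩) y

theorem subset_subGen (G : LieSuperalgebra k L) (S : Set L) : S ⊆ (G.subGen S).carrier := by
  intro x hx
  simp only [subGen, SetLike.mem_coe, Submodule.mem_sInf, Set.mem_ofPred_eq]
  rintro N ⟨M, rfl, hS⟩
  exact hS hx

theorem exists_components (G : LieSuperalgebra k L) (x : L) :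
    ∃ y ∈ G.grade 0, ∃ z ∈ G.grade 1, y + z = x :=
  Submodule.mem_sup.1 (G.isCompl.sup_eq_top.ge (Submodule.mem_top (x := x)))

/-- A sub-superalgebra is itself a Lie superalgebra. -/
def Sub.toLie {G : LieSuperalgebra k L} (N : G.Sub) : LieSuperalgebra k N.carrier where
  grade a := (G.grade a).comap N.carrier.subtype
  br := LinearMap.mk₂ k (fun x y => ⟨G.br x y, N.br_mem x x.2 y y.2⟩)
    (fun x y z => Subtype.ext (by simp)) (fun c x y => Subtype.ext (by simp))
    (fun x y z => Subtype.ext (by simp)) (fun c x y => Subtype.ext (by simp))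
  isCompl := by
    constructor
    · rw [Submodule.disjoint_def]
      intro x h0 h1
      exact Subtype.ext ((Submodule.disjoint_def.1 G.isCompl.disjoint) _ h0 h1)
    · rw [codisjoint_iff, eq_top_iff]
      rintro ⟨x, hx⟩ -
      obtain ⟨y, hy, z, hz, rfl⟩ := G.exists_components x
      obtain ⟨h0, h1⟩ := N.graded y hy z hz hx
      exact Submodule.mem_sup.2 ⟨⟨y, h0⟩, hy, ⟨z, h1⟩, hz, rfl⟩
  br_mem hx hy := G.br_mem hx hy
  skew hx hy := Subtype.ext (by simpa using G.skew hx hy)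
  jacobi hx hy hz := Subtype.ext (by simpa using G.jacobi hx hy hz)

/-- The quotient of a Lie superalgebra by an ideal. -/
def GradedIdeal.quotient {G : LieSuperalgebra k L} (I : G.GradedIdeal) :
    LieSuperalgebra k (L ⧸ I.carrier) where
  grade a := (G.grade a).map I.carrier.mkQ
  br := I.carrier.liftQ
    (LinearMap.flip (I.carrier.liftQ (LinearMap.flip (G.br.compr₂ I.carrier.mkQ))
      (fun y hy => by
        ext x
        simpa using I.br_mem_left x y hy)))
    (fun x hx => by
      ext y
      exact (Submodule.Quotient.mk_eq_zero _).2 (I.br_mem_right x hx y))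
  isCompl := by
    constructor
    · rw [Submodule.disjoint_def]
      rintro _ ⟨y, hy, rfl⟩ ⟨z, hz, hzy⟩
      have h : y + -z ∈ I.carrier := by
        rw [← sub_eq_add_neg, ← Submodule.Quotient.mk_eq_zero, Submodule.Quotient.mk_sub, sub_eq_zero]
        exact hzy.symm
      exact (Submodule.Quotient.mk_eq_zero _).2
        (I.graded y hy (-z) ((G.grade 1).neg_mem hz) h).1
    · rw [codisjoint_iff, ← Submodule.map_sup, G.isCompl.sup_eq_top, Submodule.map_top,
        Submodule.range_mkQ]
  br_mem := by
    rintro a b _ _ ⟨x, hx, rfl⟩ ⟨y, hy, rfl⟩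
    exact ⟨G.br x y, G.br_mem hx hy, rfl⟩
  skew := by
    rintro a b _ _ ⟨x, hx, rfl⟩ ⟨y, hy, rfl⟩
    exact congrArg I.carrier.mkQ (G.skew hx hy)
  jacobi := by
    rintro a b c _ _ _ ⟨x, hx, rfl⟩ ⟨y, hy, rfl⟩ ⟨z, hz, rfl⟩
    exact congrArg I.carrier.mkQ (G.jacobi hx hy hz)

/-- The relations `x y - (-1) ^ (|x| |y|) y x = [x, y]`, for homogeneous `x, y ∈ L`, in the
tensor algebra of `L`. -/
inductive EnvRel (G : LieSuperalgebra k L) : TensorAlgebra k L → TensorAlgebra k L → Prop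
  | intro {a b : ZMod 2} {x y : L} (hx : x ∈ G.grade a) (hy : y ∈ G.grade b) :
      EnvRel G
        (TensorAlgebra.ι k x * TensorAlgebra.ι k y
          - koszulSign k a b • (TensorAlgebra.ι k y * TensorAlgebra.ι k x))
        (TensorAlgebra.ι k (G.br x y))

/-- The universal enveloping algebra of a Lie superalgebra. -/
abbrev Env (G : LieSuperalgebra k L) : Type _ := RingQuot G.EnvRel

/-- The canonical map from a Lie superalgebra to its universal enveloping algebra. -/
noncomputable def toEnv (G : LieSuperalgebra k L) : L →ₗ[k] G.Env :=
  (RingQuot.mkAlgHom k G.EnvRel).toLinearMap ∘ₗ TensorAlgebra.ι k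

theorem toEnv_br (G : LieSuperalgebra k L) {a b : ZMod 2} {x y : L} (hx : x ∈ G.grade a)
    (hy : y ∈ G.grade b) :
    G.toEnv x * G.toEnv y - koszulSign k a b • (G.toEnv y * G.toEnv x) = G.toEnv (G.br x y) := by
  simpa [toEnv] using RingQuot.mkAlgHom_rel k (EnvRel.intro (G := G) hx hy)

/-- The homomorphism `U(N) → U(G)` induced by the inclusion of a sub-superalgebra `N` of `G`. -/
noncomputable def Sub.envMap {G : LieSuperalgebra k L} (N : G.Sub) : N.toLie.Env →ₐ[k] G.Env :=
  RingQuot.liftAlgHom k ⟨TensorAlgebra.lift k (G.toEnv ∘ₗ N.carrier.subtype), by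
    rintro _ _ ⟨hx, hy⟩
    simpa using! G.toEnv_br hx hy⟩

end General

section Associative

variable {k B : Type*} [Field k] [Ring B] [Algebra k B]

/-- The superbracket `[x, y] = x y - (-1) ^ (|x| |y|) y x` on an associative superalgebra,
extended bilinearly from homogeneous elements. -/
noncomputable def superBracket (g : ZMod 2 → Submodule k B) (h : IsCompl (g 0) (g 1)) :
    B →ₗ[k] B →ₗ[k] B :=
  let p₀ := (g 0).projection (g 1) h
  let p₁ := (g 1).projection (g 0) h.symm
  LinearMap.mk₂ k (fun x y => x * y - y * p₀ x - p₀ y * p₁ x + p₁ y * p₁ x)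
    (fun x y z => by simp only [map_add, mul_add, add_mul]; abel)
    (fun c x y => by simp [smul_sub, smul_add])
    (fun x y z => by simp only [map_add, mul_add, add_mul]; abel)
    (fun c x y => by simp [smul_sub, smul_add])

theorem superBracket_apply (g : ZMod 2 → Submodule k B) (h : IsCompl (g 0) (g 1))
    {a b : ZMod 2} {x y : B} (hx : x ∈ g a) (hy : y ∈ g b) :
    superBracket g h x y = x * y - koszulSign k a b • (y * x) := by
  have e0 : ∀ {u : B}, u ∈ g 0 → (g 0).projection (g 1) h u = u ∧
      (g 1).projection (g 0) h.symm u = 0 := fun {u} hu =>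
    ⟨Submodule.projection_apply_left h ⟨u, hu⟩, (Submodule.projection_apply_eq_zero_iff _).2 hu⟩
  have e1 : ∀ {u : B}, u ∈ g 1 → (g 0).projection (g 1) h u = 0 ∧
      (g 1).projection (g 0) h.symm u = u := fun {u} hu =>
    ⟨(Submodule.projection_apply_eq_zero_iff _).2 hu,
      Submodule.projection_apply_left h.symm ⟨u, hu⟩⟩
  have hab : (a = 0 ∨ a = 1) ∧ (b = 0 ∨ b = 1) := by
    clear hx hy; revert a b; decide
  obtain ⟨rfl | rfl, rfl | rfl⟩ := hab
  · simp [superBracket, koszulSign, e0 hx, e0 hy]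
  · simp [superBracket, koszulSign, e0 hx, e1 hy]
  · simp [superBracket, koszulSign, e1 hx, e0 hy]
  · simp [superBracket, koszulSign, e1 hx, e1 hy]

/-- An associative superalgebra as a Lie superalgebra. -/
noncomputable def ofAssoc (g : ZMod 2 → Submodule k B) (h : IsCompl (g 0) (g 1))
    (hmul : ∀ {a b : ZMod 2} {x y : B}, x ∈ g a → y ∈ g b → x * y ∈ g (a + b)) :
    LieSuperalgebra k B where
  grade := g
  br := superBracket g h
  isCompl := h
  br_mem {a b x y} hx hy := by
    rw [superBracket_apply g h hx hy]
    exact sub_mem (hmul hx hy) (Submodule.smul_mem _ _ (add_comm b a ▸ hmul hy hx))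
  skew {a b x y} hx hy := by
    rw [superBracket_apply g h hx hy, superBracket_apply g h hy hx]
    have hab : (a = 0 ∨ a = 1) ∧ (b = 0 ∨ b = 1) := by clear hx hy; revert a b; decide
    obtain ⟨rfl | rfl, rfl | rfl⟩ := hab <;> simp [koszulSign, add_comm]
  jacobi {a b c x y z} hx hy hz := by
    have m : ∀ {a b : ZMod 2} {x y : B}, x ∈ g a → y ∈ g b →
        x * y - koszulSign k a b • (y * x) ∈ g (a + b) := fun {a b x y} hx hy =>
      sub_mem (hmul hx hy) (Submodule.smul_mem _ _ (add_comm b a ▸ hmul hy hx))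
    rw [superBracket_apply g h hy hz, superBracket_apply g h hx hy, superBracket_apply g h hx hz,
      superBracket_apply g h hx (m hy hz), superBracket_apply g h (m hx hy) hz,
      superBracket_apply g h hy (m hx hz)]
    have habc : (a = 0 ∨ a = 1) ∧ (b = 0 ∨ b = 1) ∧ (c = 0 ∨ c = 1) := by
      clear hx hy hz; revert a b c; decide
    have h11 : (1 + 1 : ZMod 2) = 0 := by decide
    obtain ⟨rfl | rfl, rfl | rfl, rfl | rfl⟩ := habc <;> simp [koszulSign, h11] <;> noncomm_ring

end Associative

section Free

variable (k : Type*) [Field k] {X : Type*} (deg : X → ZMod 2)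

/-- The component of parity `a` of the free associative algebra on the `ZMod 2`-graded set `X`:
the span of the words of parity `a`. -/
def wordGrade (a : ZMod 2) : Submodule k (FreeAlgebra k X) :=
  Submodule.span k {w | ∃ l : List X, (l.map deg).sum = a ∧ w = (l.map (FreeAlgebra.ι k)).prod}

theorem wordGrade_mul {a b : ZMod 2} {x y : FreeAlgebra k X} (hx : x ∈ wordGrade k deg a)
    (hy : y ∈ wordGrade k deg b) : x * y ∈ wordGrade k deg (a + b) := by
  have h := Submodule.mul_mem_mul hx hy
  rw [wordGrade, wordGrade, Submodule.span_mul_span] at h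
  refine Submodule.span_mono ?_ h
  rintro _ ⟨_, ⟨l, rfl, rfl⟩, _, ⟨m, rfl, rfl⟩, rfl⟩
  exact ⟨l ++ m, by simp, by simp⟩

theorem wordGrade_isCompl : IsCompl (wordGrade k deg 0) (wordGrade k deg 1) := by
  constructor
  · let δ : FreeAlgebra k X →ₐ[k] AddMonoidAlgebra (FreeAlgebra k X) (ZMod 2) :=
      FreeAlgebra.lift k (fun x => AddMonoidAlgebra.single (deg x) (FreeAlgebra.ι k x))
    have hδ : ∀ a, ∀ w ∈ wordGrade k deg a, δ w = AddMonoidAlgebra.single a w := by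
      intro a w hw
      induction hw using Submodule.span_induction with
      | mem w hw =>
        obtain ⟨l, rfl, rfl⟩ := hw
        induction l with
        | nil => simp [AddMonoidAlgebra.one_def]
        | cons x l ih =>
          rw [List.map_cons, List.prod_cons, map_mul, ih]
          simp [δ, AddMonoidAlgebra.single_mul_single]
      | zero => simp
      | add x y _ _ hx hy => simp [hx, hy]
      | smul c x _ hx => simp [hx]
    rw [Submodule.disjoint_def]
    intro w h0 h1
    have h := (hδ 0 w h0).symm.trans (hδ 1 w h1)
    have h' := congrArg (fun f => f.coeff 0) h
    simpa using h'
  · rw [codisjoint_iff, eq_top_iff]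
    have key : ∀ w : FreeAlgebra k X, w ∈ Submodule.span k
        {w | ∃ l : List X, w = (l.map (FreeAlgebra.ι k)).prod} := by
      intro w
      induction w using FreeAlgebra.induction with
      | grade0 r =>
        rw [Algebra.algebraMap_eq_smul_one]
        exact Submodule.smul_mem _ _ (Submodule.subset_span ⟨[], by simp⟩)
      | grade1 x => exact Submodule.subset_span ⟨[x], by simp⟩
      | mul a b ha hb =>
        have h := Submodule.mul_mem_mul ha hb
        rw [Submodule.span_mul_span] at h
        refine Submodule.span_mono ?_ h
        rintro _ ⟨_, ⟨l, rfl⟩, _, ⟨m, rfl⟩, rfl⟩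
        exact ⟨l ++ m, by simp⟩
      | add a b ha hb => exact add_mem ha hb
    intro w _
    refine Submodule.span_le.2 ?_ (key w)
    rintro _ ⟨l, rfl⟩
    have hl : ∀ a : ZMod 2, a = 0 ∨ a = 1 := by decide
    rcases hl (l.map deg).sum with h | h
    · exact Submodule.mem_sup_left (Submodule.subset_span ⟨l, h, rfl⟩)
    · exact Submodule.mem_sup_right (Submodule.subset_span ⟨l, h, rfl⟩)

/-- The free associative algebra on the `ZMod 2`-graded set `X`, as a Lie superalgebra. -/
noncomputable def freeAssoc : LieSuperalgebra k (FreeAlgebra k X) :=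
  ofAssoc (wordGrade k deg) (wordGrade_isCompl k deg) (wordGrade_mul k deg)

/-- The free Lie superalgebra on `X`, as the sub-superalgebra of the free associative algebra
that is generated by `X`. -/
noncomputable def freeLie : (freeAssoc k deg).Sub :=
  (freeAssoc k deg).subGen (Set.range (FreeAlgebra.ι k))

/-- The generators of the free Lie superalgebra. -/
noncomputable def freeLie.of (x : X) : (freeLie k deg).carrier :=
  ⟨FreeAlgebra.ι k x, subset_subGen _ _ ⟨x, rfl⟩⟩

end Free

end LieSuperalgebra

open LieSuperalgebra

/-- Generalized Cartan matrices of Kac-Moody superalgebras, with entries in a commutative ring of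
characteristic zero; `τ` is the set of odd indices. -/
structure IsSuperGCM {R : Type*} [CommRing R] {r : ℕ} (A : Matrix (Fin r) (Fin r) R)
    (τ : Finset (Fin r)) : Prop where
  diag : ∀ i, A i i = 2 ∨ A i i = 0
  mem_of_diag_eq_zero : ∀ i, A i i = 0 → i ∈ τ
  nonpos : ∀ i j, A i i ≠ 0 → i ≠ j → ∃ n : ℕ, A i j = -(n : R)
  zero_symm : ∀ i j, A i j = 0 → A j i = 0
  even : ∀ i j, A i i = 2 → i ∈ τ → ∃ m : ℤ, A i j = ((2 * m : ℤ) : R)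

/-- The Chevalley generators. -/
inductive ChevalleyGen (r : ℕ) : Type
  | e : Fin r → ChevalleyGen r
  | h : Fin r → ChevalleyGen r
  | f : Fin r → ChevalleyGen r

/-- The parity of the generators: `e_i` and `f_i` are odd if and only if `i ∈ τ`. -/
def ChevalleyGen.deg {r : ℕ} (τ : Finset (Fin r)) : ChevalleyGen r → ZMod 2
  | .e i => if i ∈ τ then 1 else 0
  | .h _ => 0
  | .f i => if i ∈ τ then 1 else 0

section KacMoody

variable {R : Type*} [CommRing R] {r : ℕ}

open Classical in
/-- The integers `n_ij`, for `i ≠ j`: `n_ij` is (the integer with image) `a_ij` if `a_ii = 2` or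
`a_ij = 0`, and `-1` otherwise. -/
noncomputable def serreInt (A : Matrix (Fin r) (Fin r) R) (i j : Fin r) : ℤ :=
  if A i i = 2 ∨ A i j = 0 then Function.invFun (fun m : ℤ => (m : R)) (A i j) else -1

/-- The exponent `1 - n_ij`, a positive integer for a generalized Cartan matrix. -/
noncomputable def serreExp (A : Matrix (Fin r) (Fin r) R) (i j : Fin r) : ℕ :=
  (1 - serreInt A i j).toNat

variable (k : Type*) [Field k] [Algebra R k] {L : Type*} [AddCommGroup L] [Module k L]

/-- The relations `W`, for elements `e_i, h_i, f_i` of a Lie superalgebra. -/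
inductive IsCartanRel (A : Matrix (Fin r) (Fin r) R) (G : LieSuperalgebra k L)
    (e h f : Fin r → L) : L → Prop
  | hh (i j : Fin r) : j < i → IsCartanRel A G e h f (G.br (h i) (h j))
  | ef (i j : Fin r) : IsCartanRel A G e h f (G.br (e i) (f j) - if i = j then h i else 0)
  | eh (i j : Fin r) : IsCartanRel A G e h f (G.br (e j) (h i) + algebraMap R k (A i j) • e j)
  | hf (i j : Fin r) : IsCartanRel A G e h f (G.br (h i) (f j) + algebraMap R k (A i j) • f j)

/-- The Serre relations `S_±`, for elements `x_i` (either all the `e_i` or all the `f_i`). In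
`quartic`, the indices `l, m, n` are `m - 1, m, m + 1`. -/
inductive IsSerreRel (A : Matrix (Fin r) (Fin r) R) (τ : Finset (Fin r))
    (G : LieSuperalgebra k L) (x : Fin r → L) : L → Prop
  | left (i j : Fin r) : j < i →
      IsSerreRel A τ G x ((fun u => G.br (x i) u)^[serreExp A i j] (x j))
  | right (i j : Fin r) : j < i →
      IsSerreRel A τ G x ((fun u => G.br u (x j))^[serreExp A j i] (x i))
  | quartic (l m n : Fin r) : l.val + 1 = m.val → m.val + 1 = n.val →
      m ∈ τ → l ∉ τ → n ∉ τ → A m m = 0 → A n l = 0 → A m n + A m l = 0 →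
      IsSerreRel A τ G x (G.br (G.br (x n) (x m)) (G.br (x m) (x l)))

/-- The ideal of the free Lie superalgebra on the Chevalley generators that is generated by the
defining relations `S_+`, `W` and `S_-`. -/
noncomputable def kacMoodyIdeal (A : Matrix (Fin r) (Fin r) R) (τ : Finset (Fin r)) :
    (freeLie k (ChevalleyGen.deg τ)).toLie.GradedIdeal :=
  let F := (freeLie k (ChevalleyGen.deg τ)).toLie
  let e := fun i => freeLie.of k (ChevalleyGen.deg τ) (.e i)
  let h := fun i => freeLie.of k (ChevalleyGen.deg τ) (.h i)
  let f := fun i => freeLie.of k (ChevalleyGen.deg τ) (.f i)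
  F.idealGen {u | IsSerreRel k A τ F e u ∨ IsCartanRel k A F e h f u ∨ IsSerreRel k A τ F f u}

/-- The underlying vector space of the Kac-Moody superalgebra of `(A, τ)` over `k`. -/
abbrev KacMoodySpace (A : Matrix (Fin r) (Fin r) R) (τ : Finset (Fin r)) : Type _ :=
  (freeLie k (ChevalleyGen.deg τ)).carrier ⧸ (kacMoodyIdeal k A τ).carrier

/-- The Kac-Moody superalgebra of `(A, τ)` over `k`. -/
noncomputable def kacMoody (A : Matrix (Fin r) (Fin r) R) (τ : Finset (Fin r)) :
    LieSuperalgebra k (KacMoodySpace k A τ) :=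
  (kacMoodyIdeal k A τ).quotient

/-- The Chevalley generators of the Kac-Moody superalgebra. -/
noncomputable def kacMoodyGen (A : Matrix (Fin r) (Fin r) R) (τ : Finset (Fin r))
    (x : ChevalleyGen r) : KacMoodySpace k A τ :=
  (kacMoodyIdeal k A τ).carrier.mkQ (freeLie.of k (ChevalleyGen.deg τ) x)

/-- The subalgebra `G_+`, generated by the `e_i`. -/
noncomputable def kacMoodyPos (A : Matrix (Fin r) (Fin r) R) (τ : Finset (Fin r)) :
    (kacMoody k A τ).Sub :=
  (kacMoody k A τ).subGen (Set.range fun i => kacMoodyGen k A τ (.e i))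

/-- The subalgebra `G_0`, generated by the `h_i`. -/
noncomputable def kacMoodyZero (A : Matrix (Fin r) (Fin r) R) (τ : Finset (Fin r)) :
    (kacMoody k A τ).Sub :=
  (kacMoody k A τ).subGen (Set.range fun i => kacMoodyGen k A τ (.h i))

/-- The subalgebra `G_-`, generated by the `f_i`. -/
noncomputable def kacMoodyNeg (A : Matrix (Fin r) (Fin r) R) (τ : Finset (Fin r)) :
    (kacMoody k A τ).Sub :=
  (kacMoody k A τ).subGen (Set.range fun i => kacMoodyGen k A τ (.f i))

end KacMoody

/-! The two decompositions are proved independently of each other.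

For $\mathcal G$ itself, give $e_i,h_i,f_i$ the heights $1,0,-1$. All defining relations are
homogeneous, so $\mathcal G$ inherits the grading, and $\mathcal G_+,\mathcal G_0,\mathcal G_-$ live
in positive, zero and negative height; their sum is therefore direct
(`eq_zero_of_triangular_sum_eq_zero`). It is everything because $\mathcal G_++\sum kh_i+\mathcal
G_-$ is stable under bracketing with the generators (`kacMoody_triangular_span`).

For $U(\mathcal G)$, surjectivity is straightening (`span_triangular`). Injectivity does not use a
PBW theorem. Let $F$ be the free associative algebra on $r$ letters and $I$ its ideal generated by
the Serre relations. One constructs a representation on $F/I\otimes k[X_1,\dots,X_r]\otimes F/I$ in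
which a triangular product $x(e)\,p(h)\,y(f)$ sends $1\otimes1\otimes1$ to $x\otimes p\otimes y$
(`exists_triangular_rep`). Since $U(\mathcal G_\pm)$ are quotients of $F/I$ and $U(\mathcal G_0)$ is
a quotient of the polynomial ring, evaluation at $1\otimes1\otimes1$ followed by these quotient maps
is a left inverse of multiplication (`tripleMul_injective`).

The representation comes from a Verma-type module $F\otimes Y$, where $Y=k[X]\otimes F/I$ carries
the action of the $h_i$ and $f_i$. To divide by $I\otimes Y$ one needs $f_pI\subseteq If_p+h_pI+I$
(`f_mul_mem`). The mirrored inclusion $If_p\subseteq f_pI+h_pI+I$ (`mul_f_mem`), used after the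
Chevalley involution, shows that the $f_i$ satisfy the Serre relations on all of $F\otimes Y$.

Both inclusions reduce to the generators $\theta$ of $I$, for which $f_p\theta=c\,\theta f_p+v$ with
$c\ne0$ and $v\in I$ (`comm_serreGen`). This is the computational core: the exponents $1-n_{ij}$ are
such that the rank one coefficients vanish, the remaining corrections are again in $I$. One
correction is a multiple of $[e_i,e_i]$ for isotropic $i$; it is not among the defining relations
but follows from them when its coefficient is nonzero (`br_self_eq_zero`), and so is added to the
generators of $I$. -/

namespace LieSuperalgebra

/-! ### Signs, homogeneous components, generated subalgebras and ideals -/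

section General

theorem zmod_two_eq (a : ZMod 2) : a = 0 ∨ a = 1 := by
  revert a; decide

theorem koszulSign_comm (k : Type*) [Field k] (a b : ZMod 2) :
    koszulSign k a b = koszulSign k b a := by
  simp [koszulSign, and_comm]

theorem koszulSign_mul_self (k : Type*) [Field k] (a b : ZMod 2) :
    koszulSign k a b * koszulSign k a b = 1 := by
  unfold koszulSign; split_ifs <;> simp

theorem koszulSign_ne_zero (k : Type*) [Field k] (a b : ZMod 2) : koszulSign k a b ≠ 0 := by
  unfold koszulSign; split_ifs <;> simp

theorem koszulSign_zero_right (k : Type*) [Field k] (a : ZMod 2) : koszulSign k a 0 = 1 := by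
  simp [koszulSign]

theorem koszulSign_zero_left (k : Type*) [Field k] (a : ZMod 2) : koszulSign k 0 a = 1 := by
  simp [koszulSign]

theorem koszulSign_add_right (k : Type*) [Field k] (a b c : ZMod 2) :
    koszulSign k a (b + c) = koszulSign k a b * koszulSign k a c := by
  have h11 : (1 + 1 : ZMod 2) = 0 := by decide
  rcases zmod_two_eq a with rfl | rfl <;> rcases zmod_two_eq b with rfl | rfl <;>
    rcases zmod_two_eq c with rfl | rfl <;> simp [koszulSign, h11]

variable {k L : Type*} [Field k] [AddCommGroup L] [Module k L] (G : LieSuperalgebra k L)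

/-- The span of the homogeneous elements of a submodule. -/
def homogeneousPart (N : Submodule k L) : Submodule k L := N ⊓ G.grade 0 ⊔ N ⊓ G.grade 1

theorem homogeneousPart_le (N : Submodule k L) : G.homogeneousPart N ≤ N :=
  sup_le inf_le_left inf_le_left

theorem mem_homogeneousPart {N : Submodule k L} {a : ZMod 2} {x : L} (hx : x ∈ N)
    (ha : x ∈ G.grade a) : x ∈ G.homogeneousPart N := by
  rcases zmod_two_eq a with rfl | rfl
  · exact Submodule.mem_sup_left ⟨hx, ha⟩
  · exact Submodule.mem_sup_right ⟨hx, ha⟩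

theorem components_unique {y y' z z' : L} (hy : y ∈ G.grade 0) (hy' : y' ∈ G.grade 0)
    (hz : z ∈ G.grade 1) (hz' : z' ∈ G.grade 1) (h : y + z = y' + z') : y = y' ∧ z = z' := by
  have e : y - y' = z' - z := by
    rw [sub_eq_sub_iff_add_eq_add, h, add_comm]
  have h0 := Submodule.disjoint_def.1 G.isCompl.disjoint (y - y') (sub_mem hy hy')
    (e ▸ sub_mem hz' hz)
  have h1 : y = y' := sub_eq_zero.1 h0
  refine ⟨h1, ?_⟩
  rw [h0] at e
  exact (sub_eq_zero.1 e.symm).symm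

theorem isGraded_homogeneousPart (N : Submodule k L) : G.IsGraded (G.homogeneousPart N) := by
  intro y hy z hz h
  obtain ⟨y', hy', z', hz', e⟩ := Submodule.mem_sup.1 h
  obtain ⟨rfl, rfl⟩ := G.components_unique hy'.2 hy hz'.2 hz e
  exact ⟨Submodule.mem_sup_left hy', Submodule.mem_sup_right hz'⟩

theorem subGen_le_sub {S : Set L} (M : G.Sub) (hS : S ⊆ M.carrier) :
    (G.subGen S).carrier ≤ M.carrier :=
  sInf_le ⟨M, rfl, hS⟩

theorem subset_idealGen (S : Set L) : S ⊆ (G.idealGen S).carrier := by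
  intro x hx
  simp only [idealGen, SetLike.mem_coe, Submodule.mem_sInf, Set.mem_ofPred_eq]
  rintro N ⟨M, rfl, hS⟩
  exact hS hx

/-- A submodule contains the sub-superalgebra generated by a set of homogeneous elements as soon
as it contains the set and is closed under brackets of homogeneous elements. -/
theorem subGen_le {S : Set L} {N : Submodule k L} (hS : ∀ s ∈ S, s ∈ N ∧ ∃ a, s ∈ G.grade a)
    (hN : ∀ {a b : ZMod 2} {x y : L}, x ∈ G.grade a → y ∈ G.grade b → x ∈ N → y ∈ N →
      G.br x y ∈ N) : (G.subGen S).carrier ≤ N := by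
  -- `N` need not be graded, so the comparison is with its graded core `homogeneousPart N`, which
  -- already contains the homogeneous generators.
  refine le_trans (G.subGen_le_sub ⟨G.homogeneousPart N, G.isGraded_homogeneousPart N, ?_⟩ ?_)
    (G.homogeneousPart_le N)
  · intro x hx y hy
    obtain ⟨x0, hx0, x1, hx1, rfl⟩ := Submodule.mem_sup.1 hx
    obtain ⟨y0, hy0, y1, hy1, rfl⟩ := Submodule.mem_sup.1 hy
    simp only [map_add, LinearMap.add_apply]
    exact add_mem
      (add_mem (G.mem_homogeneousPart (hN hx0.2 hy0.2 hx0.1 hy0.1) (G.br_mem hx0.2 hy0.2))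
        (G.mem_homogeneousPart (hN hx1.2 hy0.2 hx1.1 hy0.1) (G.br_mem hx1.2 hy0.2)))
      (add_mem (G.mem_homogeneousPart (hN hx0.2 hy1.2 hx0.1 hy1.1) (G.br_mem hx0.2 hy1.2))
        (G.mem_homogeneousPart (hN hx1.2 hy1.2 hx1.1 hy1.1) (G.br_mem hx1.2 hy1.2)))
  · intro s hs
    obtain ⟨h, a, ha⟩ := hS s hs
    exact G.mem_homogeneousPart h ha

/-- A submodule contains the ideal generated by a set of homogeneous elements as soon as it
contains the set and is closed under brackets with homogeneous elements. -/
theorem idealGen_le {S : Set L} {N : Submodule k L} (hS : ∀ s ∈ S, s ∈ N ∧ ∃ a, s ∈ G.grade a)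
    (hN : ∀ {a b : ZMod 2} {x y : L}, x ∈ G.grade a → y ∈ G.grade b → y ∈ N → G.br x y ∈ N) :
    (G.idealGen S).carrier ≤ N := by
  have hN' : ∀ {a b : ZMod 2} {x y : L}, x ∈ G.grade a → y ∈ G.grade b → y ∈ N →
      G.br x y ∈ G.homogeneousPart N ∧ G.br y x ∈ G.homogeneousPart N := by
    intro a b x y hx hy h
    have h1 := G.mem_homogeneousPart (hN hx hy h) (G.br_mem hx hy)
    refine ⟨h1, ?_⟩
    rw [G.skew hy hx]
    exact neg_mem (Submodule.smul_mem _ _ h1)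
  have key : ∀ x, ∀ y ∈ G.homogeneousPart N,
      G.br x y ∈ G.homogeneousPart N ∧ G.br y x ∈ G.homogeneousPart N := by
    intro x y hy
    obtain ⟨x0, hx0, x1, hx1, rfl⟩ := G.exists_components x
    obtain ⟨y0, hy0, y1, hy1, rfl⟩ := Submodule.mem_sup.1 hy
    simp only [map_add, LinearMap.add_apply]
    have h00 := hN' hx0 hy0.2 hy0.1
    have h01 := hN' hx0 hy1.2 hy1.1
    have h10 := hN' hx1 hy0.2 hy0.1
    have h11 := hN' hx1 hy1.2 hy1.1
    exact ⟨add_mem (add_mem h00.1 h10.1) (add_mem h01.1 h11.1),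
      add_mem (add_mem h00.2 h01.2) (add_mem h10.2 h11.2)⟩
  refine le_trans (sInf_le ⟨⟨G.homogeneousPart N, G.isGraded_homogeneousPart N,
    fun x y hy => (key x y hy).1, fun x hx y => (key y x hx).2⟩, rfl, ?_⟩)
    (G.homogeneousPart_le N)
  intro s hs
  obtain ⟨h, a, ha⟩ := hS s hs
  exact G.mem_homogeneousPart h ha

end General

/-! ### Weight spaces of the free associative algebra -/

section Words

variable (k : Type*) [Field k] {X M : Type*} [AddCommMonoid M] (d : X → M)

/-- The span of the words of a given weight in the free associative algebra. -/
def wordSpan (m : M) : Submodule k (FreeAlgebra k X) :=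
  Submodule.span k {w | ∃ l : List X, (l.map d).sum = m ∧ w = (l.map (FreeAlgebra.ι k)).prod}

theorem ι_mem_wordSpan (x : X) : FreeAlgebra.ι k x ∈ wordSpan k d (d x) :=
  Submodule.subset_span ⟨[x], by simp⟩

theorem ι_mem_wordGrade (deg : X → ZMod 2) (x : X) :
    FreeAlgebra.ι k x ∈ wordGrade k deg (deg x) :=
  Submodule.subset_span ⟨[x], by simp⟩

variable {k d}

theorem mul_mem_wordSpan {m n : M} {x y : FreeAlgebra k X} (hx : x ∈ wordSpan k d m)
    (hy : y ∈ wordSpan k d n) : x * y ∈ wordSpan k d (m + n) := by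
  have h := Submodule.mul_mem_mul hx hy
  rw [wordSpan, wordSpan, Submodule.span_mul_span] at h
  refine Submodule.span_mono ?_ h
  rintro _ ⟨_, ⟨l, rfl, rfl⟩, _, ⟨m, rfl, rfl⟩, rfl⟩
  exact ⟨l ++ m, by simp, by simp⟩

theorem freeAssoc_br (deg : X → ZMod 2) {a b : ZMod 2} {x y : FreeAlgebra k X}
    (hx : x ∈ wordGrade k deg a) (hy : y ∈ wordGrade k deg b) :
    (freeAssoc k deg).br x y = x * y - koszulSign k a b • (y * x) :=
  superBracket_apply _ _ hx hy

theorem br_mem_wordSpan (deg : X → ZMod 2) {a b : ZMod 2} {x y : FreeAlgebra k X} {m n : M}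
    (hx : x ∈ wordGrade k deg a) (hy : y ∈ wordGrade k deg b)
    (hm : x ∈ wordSpan k d m) (hn : y ∈ wordSpan k d n) :
    (freeAssoc k deg).br x y ∈ wordSpan k d (m + n) := by
  rw [freeAssoc_br deg hx hy]
  exact sub_mem (mul_mem_wordSpan hm hn)
    (Submodule.smul_mem _ _ (add_comm n m ▸ mul_mem_wordSpan hn hm))

/-- Every set of weights comes with a linear projection of the free associative algebra onto the
sum of the corresponding weight spaces. -/
theorem exists_weight_projection (d : X → M) (p : M → Prop) [DecidablePred p] :
    ∃ q : FreeAlgebra k X →ₗ[k] FreeAlgebra k X,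
      ∀ m, ∀ w ∈ wordSpan k d m, q w = if p m then w else 0 := by
  -- The coaction $x\mapsto x\,T^{d(x)}$ is an algebra homomorphism that separates the weights.
  -- Summing the coefficients at the weights that satisfy `p` gives the projection.
  let δ : FreeAlgebra k X →ₐ[k] AddMonoidAlgebra (FreeAlgebra k X) M :=
    FreeAlgebra.lift k (fun x => AddMonoidAlgebra.single (d x) (FreeAlgebra.ι k x))
  have hδ : ∀ a, ∀ w ∈ wordSpan k d a, δ w = AddMonoidAlgebra.single a w := by
    intro a w hw
    induction hw using Submodule.span_induction with
    | mem w hw =>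
      obtain ⟨l, rfl, rfl⟩ := hw
      induction l with
      | nil => simp [AddMonoidAlgebra.one_def]
      | cons x l ih =>
        rw [List.map_cons, List.prod_cons, map_mul, ih]
        simp [δ, AddMonoidAlgebra.single_mul_single]
    | zero => simp
    | add x y _ _ hx hy => simp [hx, hy]
    | smul c x _ hx => simp [hx]
  let s : (M →₀ FreeAlgebra k X) →ₗ[k] FreeAlgebra k X :=
    Finsupp.lsum k (fun m => if p m then LinearMap.id else 0)
  let c : AddMonoidAlgebra (FreeAlgebra k X) M →ₗ[k] (M →₀ FreeAlgebra k X) :=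
    { toFun := fun x => x.coeff
      map_add' := fun x y => rfl
      map_smul' := fun x y => rfl }
  refine ⟨s ∘ₗ c ∘ₗ δ.toLinearMap, fun m w hw => ?_⟩
  have : c (AddMonoidAlgebra.single m w) = Finsupp.single m w := rfl
  simp only [LinearMap.comp_apply, AlgHom.toLinearMap_apply, hδ m w hw, this]
  simp only [s, Finsupp.lsum_single]
  split_ifs <;> simp

end Words

end LieSuperalgebra

/-! ### The exponents of the Serre relations -/

section SerreExp

variable {R : Type*} [CommRing R] [CharZero R] {r : ℕ} {A : Matrix (Fin r) (Fin r) R}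
  {i j : Fin r}

theorem invFun_intCast (m : ℤ) : Function.invFun (fun m : ℤ => (m : R)) (m : R) = m :=
  Function.leftInverse_invFun (f := fun m : ℤ => (m : R)) Int.cast_injective m

theorem serreExp_of_eq_zero (h : A i j = 0) : serreExp A i j = 1 := by
  have h0 := invFun_intCast (R := R) 0
  rw [Int.cast_zero] at h0
  simp [serreExp, serreInt, h, h0]

theorem serreExp_of_diag_eq_zero (hi : A i i = 0) (h : A i j ≠ 0) : serreExp A i j = 2 := by
  have : ¬ (A i i = 2 ∨ A i j = 0) := by
    rw [hi]
    rintro (h' | h')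
    · exact two_ne_zero h'.symm
    · exact h h'
  simp [serreExp, serreInt, this]

theorem serreExp_of_diag_eq_two {n : ℕ} (hi : A i i = 2) (h : A i j = -(n : R)) :
    serreExp A i j = n + 1 := by
  have h0 := invFun_intCast (R := R) (-n)
  push_cast at h0
  simp only [serreExp, serreInt, hi, h, true_or, if_true, h0]
  omega

end SerreExp

/-! ### Reduction of the Serre relations to left adjoint form -/

section Serre

variable {R : Type*} [CommRing R] {r : ℕ} (k : Type*) [Field k]
  {L : Type*} [AddCommGroup L] [Module k L]

/-- The parity of the index `i`. -/
def indexParity (τ : Finset (Fin r)) (i : Fin r) : ZMod 2 := if i ∈ τ then 1 else 0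

/-- The Serre relations in a form that is stable under the adjoint action of the opposite
nilpotent subalgebra modulo the ideal they generate: only left adjoint actions, and the squares of
isotropic generators that follow from the defining relations. -/
inductive IsSerreGen [Algebra R k] (A : Matrix (Fin r) (Fin r) R) (τ : Finset (Fin r))
    (G : LieSuperalgebra k L) (x : Fin r → L) : L → Prop
  | ad (i j : Fin r) : i ≠ j →
      IsSerreGen A τ G x ((fun u => G.br (x i) u)^[serreExp A i j] (x j))
  | sq (i j : Fin r) : i ≠ j → i ∈ τ → A i i = 0 → A i j ≠ 0 → algebraMap R k (A j i) ≠ 0 →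
      IsSerreGen A τ G x (G.br (x i) (x i))
  | quartic (l m n : Fin r) : l.val + 1 = m.val → m.val + 1 = n.val →
      m ∈ τ → l ∉ τ → n ∉ τ → A m m = 0 → A n l = 0 → A m n + A m l = 0 →
      IsSerreGen A τ G x (G.br (G.br (x n) (x m)) (G.br (x m) (x l)))

variable {k} {A : Matrix (Fin r) (Fin r) R} {τ : Finset (Fin r)} {G : LieSuperalgebra k L}
  {x : Fin r → L}

section Transport

variable {L' M : Type*} [AddCommGroup L'] [Module k L'] [Add M] {G' : LieSuperalgebra k L'}
  {x' : Fin r → L'} {Q : M → L → L' → Prop} {d : Fin r → M}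

/-- `Q m u u'` stands for "`u` and `u'` correspond, and have weight `m`". With suitable choices of
`Q`, this one induction serves both to prove homogeneity of the relations and to carry them from one
superalgebra to another. -/
theorem iterate_br_left_transport
    (hQ : ∀ m n u u' v v', Q m u u' → Q n v v' → Q (m + n) (G.br u v) (G'.br u' v'))
    {m n : M} {u u'} {v v'} (hu : Q m u u') (hv : Q n v v') (N : ℕ) :
    ∃ p, Q p ((fun w => G.br u w)^[N] v) ((fun w => G'.br u' w)^[N] v') := by
  induction N with
  | zero => exact ⟨n, hv⟩
  | succ N ih =>
    obtain ⟨p, hp⟩ := ih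
    rw [Function.iterate_succ_apply', Function.iterate_succ_apply']
    exact ⟨m + p, hQ _ _ _ _ _ _ hu hp⟩

theorem iterate_br_right_transport
    (hQ : ∀ m n u u' v v', Q m u u' → Q n v v' → Q (m + n) (G.br u v) (G'.br u' v'))
    {m n : M} {u u'} {v v'} (hu : Q m u u') (hv : Q n v v') (N : ℕ) :
    ∃ p, Q p ((fun w => G.br w u)^[N] v) ((fun w => G'.br w u')^[N] v') := by
  induction N with
  | zero => exact ⟨n, hv⟩
  | succ N ih =>
    obtain ⟨p, hp⟩ := ih
    rw [Function.iterate_succ_apply', Function.iterate_succ_apply']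
    exact ⟨p + m, hQ _ _ _ _ _ _ hp hu⟩

/-- Serre relations are transported along relations that are compatible with brackets. -/
theorem IsSerreRel.transport (hx : ∀ i, Q (d i) (x i) (x' i))
    (hQ : ∀ m n u u' v v', Q m u u' → Q n v v' → Q (m + n) (G.br u v) (G'.br u' v'))
    {u : L} (hu : IsSerreRel k A τ G x u) : ∃ m u', IsSerreRel k A τ G' x' u' ∧ Q m u u' := by
  cases hu with
  | left i j hij =>
    obtain ⟨p, hp⟩ := iterate_br_left_transport hQ (hx i) (hx j) (serreExp A i j)
    exact ⟨p, _, .left i j hij, hp⟩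
  | right i j hij =>
    obtain ⟨p, hp⟩ := iterate_br_right_transport hQ (hx j) (hx i) (serreExp A j i)
    exact ⟨p, _, .right i j hij, hp⟩
  | quartic l m n h1 h2 h3 h4 h5 h6 h7 h8 =>
    exact ⟨_, _, .quartic l m n h1 h2 h3 h4 h5 h6 h7 h8,
      hQ _ _ _ _ _ _ (hQ _ _ _ _ _ _ (hx n) (hx m)) (hQ _ _ _ _ _ _ (hx m) (hx l))⟩

theorem IsSerreGen.transport [Algebra R k] (hx : ∀ i, Q (d i) (x i) (x' i))
    (hQ : ∀ m n u u' v v', Q m u u' → Q n v v' → Q (m + n) (G.br u v) (G'.br u' v'))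
    {u : L} (hu : IsSerreGen k A τ G x u) : ∃ m u', IsSerreGen k A τ G' x' u' ∧ Q m u u' := by
  cases hu with
  | ad i j hij =>
    obtain ⟨p, hp⟩ := iterate_br_left_transport hQ (hx i) (hx j) (serreExp A i j)
    exact ⟨p, _, .ad i j hij, hp⟩
  | sq i j h1 h2 h3 h4 h5 => exact ⟨_, _, .sq i j h1 h2 h3 h4 h5, hQ _ _ _ _ _ _ (hx i) (hx i)⟩
  | quartic l m n h1 h2 h3 h4 h5 h6 h7 h8 =>
    exact ⟨_, _, .quartic l m n h1 h2 h3 h4 h5 h6 h7 h8,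
      hQ _ _ _ _ _ _ (hQ _ _ _ _ _ _ (hx n) (hx m)) (hQ _ _ _ _ _ _ (hx m) (hx l))⟩

end Transport

theorem iterate_br_mem_grade {a b : ZMod 2} {u v : L} (hu : u ∈ G.grade a) (hv : v ∈ G.grade b)
    (N : ℕ) : ∃ c, (fun w => G.br u w)^[N] v ∈ G.grade c :=
  iterate_br_left_transport (G := G) (G' := G) (Q := fun c w _ => w ∈ G.grade c)
    (fun _ _ _ _ _ _ h h' => G.br_mem h h') (u' := u) (v' := v) hu hv N

/-- Each passage from right to left bracket costs only a sign. Hence the left and right relations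
for $i>j$ together amount to the left relations for all ordered pairs $i\ne j$. -/
theorem iterate_br_right {a b : ZMod 2} {u v : L} (hu : u ∈ G.grade a) (hv : v ∈ G.grade b)
    (N : ℕ) : ∃ c : k, c ≠ 0 ∧
      (fun w => G.br w u)^[N] v = c • (fun w => G.br u w)^[N] v := by
  induction N with
  | zero => exact ⟨1, one_ne_zero, by simp⟩
  | succ N ih =>
    obtain ⟨c, hc, ih⟩ := ih
    obtain ⟨d, hd⟩ := iterate_br_mem_grade hu hv N
    rw [Function.iterate_succ_apply', Function.iterate_succ_apply', ih]
    refine ⟨-(c * koszulSign k d a), neg_ne_zero.2 (mul_ne_zero hc (koszulSign_ne_zero k d a)), ?_⟩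
    simp only [map_smul, LinearMap.smul_apply]
    rw [G.skew hd hu]
    module

theorem IsSerreRel.exists_gen [Algebra R k] (hx : ∀ i, x i ∈ G.grade (indexParity τ i)) {u : L}
    (hu : IsSerreRel k A τ G x u) : ∃ (c : k) (v : L), IsSerreGen k A τ G x v ∧ u = c • v := by
  cases hu with
  | left i j hij => exact ⟨1, _, .ad i j hij.ne', (one_smul _ _).symm⟩
  | right i j hij =>
    obtain ⟨c, -, h⟩ := iterate_br_right (hx j) (hx i) (serreExp A j i)
    exact ⟨c, _, .ad j i hij.ne, h⟩
  | quartic l m n h1 h2 h3 h4 h5 h6 h7 h8 =>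
    exact ⟨1, _, .quartic l m n h1 h2 h3 h4 h5 h6 h7 h8, (one_smul _ _).symm⟩

theorem iterate_eq_zero_of_rel (hx : ∀ i, x i ∈ G.grade (indexParity τ i))
    (h : ∀ u, IsSerreRel k A τ G x u → u = 0) {i j : Fin r} (hij : i ≠ j) :
    (fun u => G.br (x i) u)^[serreExp A i j] (x j) = 0 := by
  rcases lt_or_gt_of_ne hij with hlt | hlt
  · obtain ⟨c, hc, e⟩ := iterate_br_right (hx i) (hx j) (serreExp A i j)
    rw [h _ (.right j i hlt)] at e
    exact (smul_eq_zero.1 e.symm).resolve_left hc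
  · exact h _ (.left i j hlt)

/-- Apply $\operatorname{ad}y$ to $[u,[u,v]]=0$. As $[y,u]=0$, only $\pm[u,[y,[u,v]]]$ survives, and
$[y,[u,v]]=\pm[u,[y,v]]=\pm c\,u$. This yields $[x_i,x_i]=0$ for isotropic $x_i$, with $v=x_j$ and
$y$ the opposite generator of index $j$. -/
theorem br_self_eq_zero {b : ZMod 2} {u v y : L} (hu : u ∈ G.grade 1) (hy : y ∈ G.grade b)
    (hv : v ∈ G.grade b) (hyu : G.br y u = 0) (huuv : G.br u (G.br u v) = 0) {c : k} (hc : c ≠ 0)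
    (h : G.br u (G.br y v) = c • u) : G.br u u = 0 := by
  have e1 := G.jacobi hy hu (G.br_mem hu hv)
  have e2 := G.jacobi hy hu hv
  simp only [huuv, hyu, map_zero, LinearMap.zero_apply, zero_add, h] at e1 e2
  rw [e2] at e1
  simp only [map_smul, smul_smul] at e1
  have hs := koszulSign_ne_zero k b 1
  exact (smul_eq_zero.1 e1.symm).resolve_left (mul_ne_zero hs (mul_ne_zero hs hc))

theorem IsSerreGen.eq_zero [CharZero R] [Algebra R k]
    (hx : ∀ i, x i ∈ G.grade (indexParity τ i))
    (h : ∀ u, IsSerreRel k A τ G x u → u = 0) {y : Fin r → L}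
    (hy : ∀ i, y i ∈ G.grade (indexParity τ i)) (hyx : ∀ i j, i ≠ j → G.br (y j) (x i) = 0)
    (hc : ∀ i j, i ≠ j → ∃ c : k, c ≠ 0 ∧
      G.br (x i) (G.br (y j) (x j)) = (c * algebraMap R k (A j i)) • x i)
    {u : L} (hu : IsSerreGen k A τ G x u) : u = 0 := by
  cases hu with
  | ad i j hij => exact iterate_eq_zero_of_rel hx h hij
  | sq i j hij hi h1 h2 h3 =>
    obtain ⟨c, h4, h5⟩ := hc i j hij
    have h6 := iterate_eq_zero_of_rel hx h hij
    rw [serreExp_of_diag_eq_zero h1 h2] at h6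
    have hxi := hx i
    rw [indexParity, if_pos hi] at hxi
    exact br_self_eq_zero hxi (hy j) (hx j) (hyx i j hij) h6 (mul_ne_zero h4 h3) h5
  | quartic l m n h1 h2 h3 h4 h5 h6 h7 h8 => exact h _ (.quartic l m n h1 h2 h3 h4 h5 h6 h7 h8)

end Serre

/-! ### The Serre ideal of the free associative algebra -/

section SerreSpan

variable {R : Type*} [CommRing R] {r : ℕ} (k : Type*) [Field k] [Algebra R k]

/-- The two-sided ideal of the free associative algebra on `r` generators that is generated by the
Serre relations. -/
def serreSpan (A : Matrix (Fin r) (Fin r) R) (τ : Finset (Fin r)) :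
    Submodule k (FreeAlgebra k (Fin r)) :=
  Submodule.span k {w | ∃ a θ b,
    IsSerreGen k A τ (freeAssoc k (indexParity τ)) (FreeAlgebra.ι k) θ ∧ w = a * θ * b}

variable {k} {A : Matrix (Fin r) (Fin r) R} {τ : Finset (Fin r)}

theorem IsSerreGen.mem_serreSpan {θ : FreeAlgebra k (Fin r)}
    (h : IsSerreGen k A τ (freeAssoc k (indexParity τ)) (FreeAlgebra.ι k) θ) :
    θ ∈ serreSpan k A τ :=
  Submodule.subset_span ⟨1, θ, 1, h, by simp⟩

theorem mul_mem_serreSpan_left (a : FreeAlgebra k (Fin r)) {x : FreeAlgebra k (Fin r)}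
    (hx : x ∈ serreSpan k A τ) : a * x ∈ serreSpan k A τ := by
  induction hx using Submodule.span_induction with
  | mem x hx =>
    obtain ⟨b, θ, c, h, rfl⟩ := hx
    exact Submodule.subset_span ⟨a * b, θ, c, h, by simp only [mul_assoc]⟩
  | zero => simp
  | add x y _ _ hx hy => rw [mul_add]; exact add_mem hx hy
  | smul c x _ hx => rw [mul_smul_comm]; exact Submodule.smul_mem _ _ hx

theorem mul_mem_serreSpan_right (a : FreeAlgebra k (Fin r)) {x : FreeAlgebra k (Fin r)}
    (hx : x ∈ serreSpan k A τ) : x * a ∈ serreSpan k A τ := by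
  induction hx using Submodule.span_induction with
  | mem x hx =>
    obtain ⟨b, θ, c, h, rfl⟩ := hx
    exact Submodule.subset_span ⟨b, θ, c * a, h, by simp only [mul_assoc]⟩
  | zero => simp
  | add x y _ _ hx hy => rw [add_mul]; exact add_mem hx hy
  | smul c x _ hx => rw [smul_mul_assoc]; exact Submodule.smul_mem _ _ hx

/-- A submodule that is stable under left multiplication by the generators is stable under left
multiplication. -/
theorem freeAlgebra_mul_mem_left {N : Submodule k (FreeAlgebra k (Fin r))}
    (hN : ∀ i, ∀ x ∈ N, FreeAlgebra.ι k i * x ∈ N) (a : FreeAlgebra k (Fin r)) :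
    ∀ x ∈ N, a * x ∈ N := by
  induction a using FreeAlgebra.induction with
  | grade0 c => intro x hx; rw [← Algebra.smul_def]; exact N.smul_mem _ hx
  | grade1 i => exact hN i
  | mul a b ha hb => intro x hx; rw [mul_assoc]; exact ha _ (hb _ hx)
  | add a b ha hb => intro x hx; rw [add_mul]; exact add_mem (ha _ hx) (hb _ hx)

theorem freeAlgebra_mul_mem_right {N : Submodule k (FreeAlgebra k (Fin r))}
    (hN : ∀ i, ∀ x ∈ N, x * FreeAlgebra.ι k i ∈ N) (a : FreeAlgebra k (Fin r)) :
    ∀ x ∈ N, x * a ∈ N := by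
  induction a using FreeAlgebra.induction with
  | grade0 c =>
    intro x hx
    rw [← Algebra.commutes, ← Algebra.smul_def]
    exact N.smul_mem _ hx
  | grade1 i => exact hN i
  | mul a b ha hb => intro x hx; rw [← mul_assoc]; exact hb _ (ha _ hx)
  | add a b ha hb => intro x hx; rw [mul_add]; exact add_mem (ha _ hx) (hb _ hx)

theorem serreSpan_le {N : Submodule k (FreeAlgebra k (Fin r))}
    (hS : ∀ θ, IsSerreGen k A τ (freeAssoc k (indexParity τ)) (FreeAlgebra.ι k) θ → θ ∈ N)
    (hl : ∀ i, ∀ x ∈ N, FreeAlgebra.ι k i * x ∈ N)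
    (hr : ∀ i, ∀ x ∈ N, x * FreeAlgebra.ι k i ∈ N) : serreSpan k A τ ≤ N := by
  refine Submodule.span_le.2 ?_
  rintro _ ⟨a, θ, b, h, rfl⟩
  exact freeAlgebra_mul_mem_right hr b _ (freeAlgebra_mul_mem_left hl a _ (hS θ h))

theorem br_mem_serreSpan {a b : ZMod 2} {x y : FreeAlgebra k (Fin r)}
    (hx : x ∈ wordGrade k (indexParity τ) a) (hy : y ∈ wordGrade k (indexParity τ) b)
    (h : y ∈ serreSpan k A τ) :
    (freeAssoc k (indexParity τ)).br x y ∈ serreSpan k A τ ∧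
      (freeAssoc k (indexParity τ)).br y x ∈ serreSpan k A τ := by
  rw [freeAssoc_br _ hx hy, freeAssoc_br _ hy hx]
  exact ⟨sub_mem (mul_mem_serreSpan_left _ h) (Submodule.smul_mem _ _ (mul_mem_serreSpan_right _ h)),
    sub_mem (mul_mem_serreSpan_right _ h) (Submodule.smul_mem _ _ (mul_mem_serreSpan_left _ h))⟩

/-- The parity is carried along with the weight `d`, since the bracket is given by the
supercommutator formula only on elements of definite parity. -/
theorem IsSerreGen.homogeneous {M : Type*} [AddCommMonoid M] (d : Fin r → M)
    {θ : FreeAlgebra k (Fin r)}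
    (h : IsSerreGen k A τ (freeAssoc k (indexParity τ)) (FreeAlgebra.ι k) θ) :
    ∃ m, θ ∈ wordSpan k d m := by
  obtain ⟨m, -, -, h⟩ := h.transport (M := ZMod 2 × M) (G' := freeAssoc k (indexParity τ))
    (x' := FreeAlgebra.ι k) (d := fun i => (indexParity τ i, d i))
    (Q := fun m u _ => u ∈ wordGrade k (indexParity τ) m.1 ∧ u ∈ wordSpan k d m.2)
    (fun i => ⟨ι_mem_wordGrade k _ i, ι_mem_wordSpan k d i⟩)
    (fun m n u u' v v' hu hv => ⟨(freeAssoc k (indexParity τ)).br_mem hu.1 hv.1,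
      br_mem_wordSpan _ hu.1 hv.1 hu.2 hv.2⟩)
  exact ⟨m.2, h.2⟩

end SerreSpan

/-! ### Cartan relations in associative algebras -/

/-- Elements of an associative algebra that satisfy the Cartan relations. -/
structure IsCartanTriple {k B : Type*} [Field k] [Ring B] [Algebra k B] {r : ℕ}
    (a : Fin r → Fin r → k) (τ : Finset (Fin r)) (e h f : Fin r → B) : Prop where
  hh : ∀ i j, h i * h j = h j * h i
  ef : ∀ i j, e i * f j - koszulSign k (indexParity τ i) (indexParity τ j) • (f j * e i) =
    if i = j then h i else 0
  eh : ∀ i j, h i * e j = e j * h i + a i j • e j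
  hf : ∀ i j, h i * f j = f j * h i - a i j • f j

namespace IsCartanTriple

variable {R : Type*} [CommRing R] {r : ℕ} {k B : Type*} [Field k] [Algebra R k] [Ring B]
  [Algebra k B] {a : Fin r → Fin r → k} {τ : Finset (Fin r)} {e h f : Fin r → B}

/-- The Chevalley involution. -/
theorem swap (t : IsCartanTriple a τ e h f) :
    IsCartanTriple a τ f (fun i => -h i)
      (fun i => koszulSign k (indexParity τ i) (indexParity τ i) • e i) where
  hh i j := by simpa using t.hh i j
  -- The sign attached to `e i` makes the supercommutator of `f i` with it equal to $-h_i$ for odd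
  -- indices as well.
  ef i j := by
    have h1 := t.ef j i
    have h2 := koszulSign_mul_self k (indexParity τ i) (indexParity τ j)
    have h3 := koszulSign_mul_self k (indexParity τ i) (indexParity τ i)
    rw [koszulSign_comm k (indexParity τ j) (indexParity τ i)] at h1
    by_cases hij : i = j
    · subst hij
      rw [if_pos rfl] at h1 ⊢
      rw [← h1, mul_smul_comm, smul_mul_assoc, smul_smul, h3, one_smul]
      abel
    · rw [if_neg (Ne.symm hij)] at h1
      rw [if_neg hij, mul_smul_comm, smul_mul_assoc, smul_comm, ← smul_sub,
        sub_eq_zero.1 h1, smul_smul, h2, one_smul, sub_self, smul_zero]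
  eh i j := by
    have := t.hf i j
    simp only [neg_mul, mul_neg, this]
    abel
  hf i j := by
    have := t.eh i j
    simp only [neg_mul, mul_neg, mul_smul_comm, smul_mul_assoc, this]
    module

theorem fe_ne (t : IsCartanTriple a τ e h f) {i j : Fin r} (hij : i ≠ j) :
    f j * e i = koszulSign k (indexParity τ j) (indexParity τ i) • (e i * f j) := by
  have h1 := t.ef i j
  rw [if_neg hij, sub_eq_zero] at h1
  rw [h1, smul_smul, koszulSign_comm, koszulSign_mul_self, one_smul]

theorem fe_self (t : IsCartanTriple a τ e h f) (i : Fin r) :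
    f i * e i = koszulSign k (indexParity τ i) (indexParity τ i) • (e i * f i) -
      koszulSign k (indexParity τ i) (indexParity τ i) • h i := by
  have h1 := t.ef i i
  rw [if_pos rfl] at h1
  rw [← h1, smul_sub, smul_smul, koszulSign_mul_self, one_smul]
  abel

end IsCartanTriple

/-! ### Moving a lowering operator past iterated brackets -/

section Computation

variable {k B : Type*} [Field k] [Ring B] [Algebra k B]

/-- The inductive step for moving `f` past nested twisted commutators $eu-\kappa ue$: the factor is
multiplied by `s`, and the correction `d` undergoes a twisted commutator of its own. -/
theorem lower_step {e f u d : B} {s q κ : k} (he : f * e = s • (e * f))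
    (hu : f * u = q • (u * f) + d) :
    f * (e * u - κ • (u * e)) = (s * q) • ((e * u - κ • (u * e)) * f) +
      (s • (e * d) - κ • (d * e)) := by
  have h1 : f * (e * u) = s • (e * (f * u)) := by
    rw [← mul_assoc, he, smul_mul_assoc, mul_assoc]
  have h2 : f * (u * e) = q • (u * (f * e)) + d * e := by
    rw [← mul_assoc, hu, add_mul, smul_mul_assoc, mul_assoc]
  rw [mul_sub, mul_smul_comm, h1, h2, hu, he]
  simp only [mul_add, sub_mul, smul_mul_assoc, mul_smul_comm, mul_assoc]
  module

/-- The coefficients in the action of `f` on the powers of `ad e` in rank one. -/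
def serreCoeff (s b a : k) : ℕ → k
  | 0 => 0
  | m + 1 => s * serreCoeff s b a m - s * (m * b + a)

/-- Doubling clears the denominator of $\binom m2$. For $b=2$ and $a=-n$ the right side vanishes at
$m=n+1$. -/
theorem serreCoeff_one (b a : k) (m : ℕ) :
    2 * serreCoeff 1 b a m = -(2 * m * a + m * (m - 1) * b) := by
  induction m with
  | zero => simp [serreCoeff]
  | succ m ih =>
    simp only [serreCoeff]
    push_cast
    linear_combination ih

/-- For odd $e$ the coefficient at an odd index $2m+1$ is $2m+a$, which can vanish only for even
$a=-2m$. This is the role of the evenness condition on the rows of odd non-isotropic indices. -/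
theorem serreCoeff_neg_one (a : k) (m : ℕ) :
    serreCoeff (-1) 2 a (2 * m) = 2 * m ∧ serreCoeff (-1) 2 a (2 * m + 1) = 2 * m + a := by
  induction m with
  | zero => simp [serreCoeff]
  | succ m ih =>
    have h : serreCoeff (-1) 2 a (2 * (m + 1)) = 2 * (m + 1) := by
      rw [show 2 * (m + 1) = 2 * m + 1 + 1 from rfl, serreCoeff, ih.2]
      push_cast
      ring
    refine ⟨by rw [h]; push_cast; ring, ?_⟩
    rw [serreCoeff, h]
    push_cast
    ring

/-- Here $u_m$ is to be $(\operatorname{ad}e_i)^me_j$, with $f=f_i$, $h=h_i$, $b=a_{ii}$ and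
$a=a_{ij}$; the signs $s,t$ are those of $e_i$ with itself and with $e_j$. The $h$ created by $fe$
sees the weight $mb+a$ of $u_m$, which gives the second term in the recursion of `serreCoeff`; the
first comes from the correction of the previous step. -/
theorem lower_own {e f h : B} {s t b a : k} (hs : s * s = 1) (ht : t * t = 1)
    (hfe : f * e = s • (e * f) - s • h) (heh : h * e = e * h + b • e) {u : ℕ → B}
    (h0 : f * u 0 = t • (u 0 * f)) (hu0 : h * u 0 = u 0 * h + a • u 0)
    (hu : ∀ m, u (m + 1) = e * u m - (s ^ m * t) • (u m * e)) (m : ℕ) :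
    f * u (m + 1) = (s ^ (m + 1) * t) • (u (m + 1) * f) + serreCoeff s b a (m + 1) • u m := by
  have hw : ∀ m, h * u m = u m * h + (m * b + a) • u m := by
    intro m
    induction m with
    | zero => simpa using hu0
    | succ m ih =>
      have h1 : h * (e * u m) = e * (h * u m) + b • (e * u m) := by
        rw [← mul_assoc, heh, add_mul, smul_mul_assoc, mul_assoc]
      have h2 : h * (u m * e) = u m * (h * e) + (m * b + a) • (u m * e) := by
        rw [← mul_assoc, ih, add_mul, smul_mul_assoc, mul_assoc]
      rw [hu, mul_sub, mul_smul_comm, h1, h2, ih, heh]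
      simp only [mul_add, sub_mul, smul_mul_assoc, mul_smul_comm, mul_assoc]
      push_cast
      module
  have hsm : ∀ m : ℕ, (s ^ m * t) * (s ^ m * t) = 1 := by
    intro m
    rw [mul_mul_mul_comm, ht, ← mul_pow, hs, one_pow, one_mul]
  have h1 : ∀ m, f * (e * u m) = s • (e * (f * u m)) - s • (h * u m) := by
    intro m
    rw [← mul_assoc, hfe, sub_mul, smul_mul_assoc, smul_mul_assoc, mul_assoc]
  induction m with
  | zero =>
    have h2 : f * (u 0 * e) = t • (u 0 * (f * e)) := by
      rw [← mul_assoc, h0, smul_mul_assoc, mul_assoc]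
    have h3 := h1 0
    rw [hu 0, mul_sub, mul_smul_comm, h3, h2, h0, hfe, hu0]
    simp only [mul_add, sub_mul, mul_sub, smul_mul_assoc, mul_smul_comm, mul_assoc, serreCoeff]
    match_scalars <;> simp only [pow_zero, zero_add, pow_one, mul_zero, zero_mul] <;>
      first | ring1 | linear_combination s * ht
  | succ m ih =>
    have h2 : f * (u (m + 1) * e) = (s ^ (m + 1) * t) • (u (m + 1) * (f * e)) +
        serreCoeff s b a (m + 1) • (u m * e) := by
      rw [← mul_assoc, ih, add_mul, smul_mul_assoc, smul_mul_assoc, mul_assoc]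
    have h3 := h1 (m + 1)
    have h4 : e * u m = u (m + 1) + (s ^ m * t) • (u m * e) := by rw [hu m]; abel
    rw [hu (m + 1), mul_sub, mul_smul_comm, h3, h2, ih, hfe, hw (m + 1)]
    rw [serreCoeff.eq_2 s b a (m + 1)]
    simp only [mul_add, sub_mul, mul_sub, smul_mul_assoc, mul_smul_comm, mul_assoc, h4]
    have h5 := hsm (m + 1)
    match_scalars <;>
      first | ring1 | linear_combination s * h5

/-- Now $f=f_j$, the index of the innermost $e'=e_j$. The single $h_j$ produced there turns into a
multiple of $e$, then into a multiple of $(1-s)e^2$. The next twisted commutator multiplies this by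
$1-s^2=0$, so nothing is left from the third step on. -/
theorem lower_other_self {e f h e' : B} {s t s' a : k} (ht : t * t = 1) (hs : s * s = 1)
    (hfe : f * e = t • (e * f)) (heh : h * e = e * h + a • e) {u : ℕ → B}
    (h0 : u 0 = e') (hfe' : f * e' = s' • (e' * f) - s' • h)
    (hu : ∀ m, u (m + 1) = e * u m - (s ^ m * t) • (u m * e)) :
    (f * u 1 = (t * s') • (u 1 * f) + (s' * t * a) • e) ∧
    (f * u 2 = s' • (u 2 * f) + (s' * a * (1 - s)) • (e * e)) ∧
    ∀ m, f * u (m + 3) = (t ^ (m + 3) * s') • (u (m + 3) * f) := by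
  have h1 : f * u 1 = (t * s') • (u 1 * f) + (s' * t * a) • e := by
    have := lower_step (κ := s ^ 0 * t) (u := u 0) (d := -(s' • h)) hfe
      (by rw [h0, hfe']; exact sub_eq_add_neg _ _)
    rw [hu 0, this]
    simp only [mul_neg, neg_mul, mul_smul_comm, smul_mul_assoc, heh]
    match_scalars <;> ring
  have h2 : f * u 2 = s' • (u 2 * f) + (s' * a * (1 - s)) • (e * e) := by
    have := lower_step (κ := s ^ 1 * t) (u := u 1) hfe h1
    rw [hu 1, this]
    simp only [mul_smul_comm, smul_mul_assoc]
    match_scalars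
    · linear_combination s' * ht
    · linear_combination s' * a * (1 - s) * ht
  refine ⟨h1, h2, fun m => ?_⟩
  induction m with
  | zero =>
    have := lower_step (κ := s ^ 2 * t) (u := u 2) hfe h2
    rw [hu 2, this]
    simp only [mul_smul_comm, smul_mul_assoc, mul_assoc]
    match_scalars
    · linear_combination (-(t * s')) * ht
    · linear_combination (-(s' * a * (1 - s)) * t) * hs
  | succ m ih =>
    have := lower_step (κ := s ^ (m + 3) * t) (u := u (m + 3)) (d := 0) hfe (by rw [ih, add_zero])
    rw [hu (m + 3), this]
    simp only [mul_zero, zero_mul, smul_zero, sub_zero, add_zero, pow_succ' t (m + 3), mul_assoc]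

end Computation

/-! ### Iterated brackets of free generators -/

section SerreWords

variable {r : ℕ} (k : Type*) [Field k] (τ : Finset (Fin r))

theorem koszulSign_nsmul_add (a b : ZMod 2) (m : ℕ) :
    koszulSign k a (m • a + b) = koszulSign k a a ^ m * koszulSign k a b := by
  induction m with
  | zero => simp
  | succ m ih =>
    rw [add_smul, one_smul, add_right_comm, koszulSign_add_right, ih, pow_succ]
    ring

theorem iterate_br_ι_mem (i j : Fin r) (m : ℕ) :
    (fun u => (freeAssoc k (indexParity τ)).br (FreeAlgebra.ι k i) u)^[m] (FreeAlgebra.ι k j) ∈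
      wordGrade k (indexParity τ) (m • indexParity τ i + indexParity τ j) := by
  induction m with
  | zero => simpa using ι_mem_wordGrade k (indexParity τ) j
  | succ m ih =>
    rw [Function.iterate_succ_apply', add_smul, one_smul, add_comm _ (indexParity τ i), add_assoc]
    exact (freeAssoc k (indexParity τ)).br_mem (ι_mem_wordGrade k _ i) ih

theorem iterate_br_ι_succ (i j : Fin r) (m : ℕ) :
    (fun u => (freeAssoc k (indexParity τ)).br (FreeAlgebra.ι k i) u)^[m + 1] (FreeAlgebra.ι k j) =
      FreeAlgebra.ι k i *
        (fun u => (freeAssoc k (indexParity τ)).br (FreeAlgebra.ι k i) u)^[m] (FreeAlgebra.ι k j) -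
      (koszulSign k (indexParity τ i) (indexParity τ i) ^ m *
        koszulSign k (indexParity τ i) (indexParity τ j)) •
        ((fun u => (freeAssoc k (indexParity τ)).br (FreeAlgebra.ι k i) u)^[m]
          (FreeAlgebra.ι k j) * FreeAlgebra.ι k i) := by
  rw [Function.iterate_succ_apply', freeAssoc_br _ (ι_mem_wordGrade k _ i)
    (iterate_br_ι_mem k τ i j m), koszulSign_nsmul_add]

end SerreWords

/-! ### Moving a lowering operator past the Serre relations -/

namespace IsCartanTriple

variable {R : Type*} [CommRing R] {r : ℕ} {k B : Type*} [Field k] [Algebra R k]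
  [Ring B] [Algebra k B] {A : Matrix (Fin r) (Fin r) R} {τ : Finset (Fin r)} {e h f : Fin r → B}

/-- The Serre exponents are zeros of the rank one coefficient: $n+1$ for $a_{ii}=2$, $a_{ij}=-n$
(with $n$ even if $i$ is odd), and for isotropic $i$ either $1$ or $2$ according to whether $a_{ij}$
vanishes. -/
theorem serreCoeff_eq_zero [CharZero R] (h2 : (2 : k) ≠ 0) (hA : IsSuperGCM A τ) {i j : Fin r} (hij : i ≠ j) :
    ∃ N, serreExp A i j = N + 1 ∧
      serreCoeff (koszulSign k (indexParity τ i) (indexParity τ i)) (algebraMap R k (A i i))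
        (algebraMap R k (A i j)) (N + 1) = 0 := by
  rcases hA.diag i with hd | hd
  · obtain ⟨n, hn⟩ := hA.nonpos i j (by rw [hd]; exact two_ne_zero) hij
    refine ⟨n, serreExp_of_diag_eq_two hd hn, ?_⟩
    rw [hd, hn]
    by_cases hi : i ∈ τ
    · obtain ⟨m, hm⟩ := hA.even i j hd hi
      have hnm : -(n : ℤ) = 2 * m := by
        have : ((-(n : ℤ) : ℤ) : R) = ((2 * m : ℤ) : R) := by rw [← hm, hn]; push_cast; rfl
        exact Int.cast_injective this
      obtain ⟨q, rfl⟩ : ∃ q : ℕ, n = 2 * q := ⟨n / 2, by omega⟩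
      simp only [indexParity, hi, if_true, koszulSign, and_self, map_ofNat]
      rw [(serreCoeff_neg_one _ q).2]
      simp [map_ofNat (algebraMap R k) 2]
    · simp only [indexParity, hi, if_false, koszulSign, zero_ne_one, and_self, map_ofNat]
      have h := serreCoeff_one (2 : k) (algebraMap R k (-(n : R))) (n + 1)
      have h' : (2 : k) * serreCoeff 1 2 (algebraMap R k (-(n : R))) (n + 1) = 0 := by
        rw [h]
        push_cast
        ring
      exact (mul_eq_zero.1 h').resolve_left h2
  · by_cases ha : A i j = 0
    · exact ⟨0, serreExp_of_eq_zero ha, by simp [serreCoeff, ha]⟩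
    · refine ⟨1, serreExp_of_diag_eq_zero hd ha, ?_⟩
      simp [serreCoeff, hd, koszulSign, indexParity, hA.mem_of_diag_eq_zero i hd]

/-- For $l=i$ the rank one coefficient vanishes; for $l\ne i,j$ the operator $f_l$ commutes with
everything up to sign. Only $l=j$ can leave a correction, and only if $i$ is isotropic with
$a_{ij}\ne0$. -/
theorem comm_ad [CharZero R]
    (t : IsCartanTriple (fun i j => algebraMap R k (A i j)) τ e h f)
    (h2 : (2 : k) ≠ 0) (hA : IsSuperGCM A τ) {i j : Fin r} (hij : i ≠ j)
    (l : Fin r) {θ : FreeAlgebra k (Fin r)}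
    (hθ : θ = (fun u => (freeAssoc k (indexParity τ)).br (FreeAlgebra.ι k i) u)^[serreExp A i j]
      (FreeAlgebra.ι k j)) :
    ∃ c : k, c ≠ 0 ∧ ∃ v ∈ serreSpan k A τ,
      f l * FreeAlgebra.lift k e θ =
        c • (FreeAlgebra.lift k e θ * f l) + FreeAlgebra.lift k e v := by
  set u : ℕ → B := fun m => FreeAlgebra.lift k e
    ((fun u => (freeAssoc k (indexParity τ)).br (FreeAlgebra.ι k i) u)^[m] (FreeAlgebra.ι k j))
    with hu_def
  have hθu : FreeAlgebra.lift k e θ = u (serreExp A i j) := by rw [hθ]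
  have hu0 : u 0 = e j := by simp [hu_def]
  set s := koszulSign k (indexParity τ i) (indexParity τ i) with hs_def
  set κ := koszulSign k (indexParity τ i) (indexParity τ j) with hκ_def
  have hs : s * s = 1 := koszulSign_mul_self k _ _
  have hκ : κ * κ = 1 := koszulSign_mul_self k _ _
  have hs0 : s ≠ 0 := koszulSign_ne_zero k _ _
  have hκ0 : κ ≠ 0 := koszulSign_ne_zero k _ _
  have hu : ∀ m, u (m + 1) = e i * u m - (s ^ m * κ) • (u m * e i) := by
    intro m
    simp only [hu_def, iterate_br_ι_succ, map_sub, map_mul, map_smul, FreeAlgebra.lift_ι_apply]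
    rfl
  rw [hθu]
  by_cases hli : l = i
  · subst hli
    obtain ⟨N, hN, hc⟩ := serreCoeff_eq_zero (k := k) h2 hA hij
    have h3 := lower_own (a := algebraMap R k (A l j)) hs hκ (t.fe_self l) (t.eh l l)
      (by rw [hu0]; exact t.fe_ne hij.symm) (by rw [hu0]; exact t.eh l j) hu N
    refine ⟨s ^ (N + 1) * κ, mul_ne_zero (pow_ne_zero _ hs0) hκ0, 0, zero_mem _, ?_⟩
    rw [hN, h3, hc, zero_smul, map_zero]
  · by_cases hlj : l = j
    · subst hlj
      have hs' : koszulSign k (indexParity τ l) (indexParity τ l) ≠ 0 := koszulSign_ne_zero k _ _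
      obtain ⟨h3, h4, h5⟩ := lower_other_self hκ hs
        (by rw [t.fe_ne hij, koszulSign_comm]) (t.eh l i) hu0 (t.fe_self l) hu
      have big : ∀ m, serreExp A i l = m + 3 → ∃ c : k, c ≠ 0 ∧ ∃ v ∈ serreSpan k A τ,
          f l * u (serreExp A i l) =
            c • (u (serreExp A i l) * f l) + FreeAlgebra.lift k e v := by
        intro m hm
        exact ⟨_, mul_ne_zero (pow_ne_zero (m + 3) hκ0) hs', 0, zero_mem _,
          by rw [hm, h5 m, map_zero, add_zero]⟩
      by_cases ha : A i l = 0
      · rw [serreExp_of_eq_zero ha]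
        refine ⟨_, mul_ne_zero hκ0 hs', 0, zero_mem _, ?_⟩
        rw [h3, hA.zero_symm i l ha]
        simp
      · rcases hA.diag i with hd | hd
        · obtain ⟨n, hn⟩ := hA.nonpos i l (by rw [hd]; exact two_ne_zero) hij
          have hexp := serreExp_of_diag_eq_two hd hn
          -- The exponent is one more than the natural number with $a_{il}=-n$. The value $0$ is
          -- excluded. For $1$ the exponent is $2$ and the factor $1-s$ must vanish; it does, since
          -- an odd index has an even row. For larger values the exponent is at least $3$ and there
          -- is no correction.
          obtain _ | _ | n := n
          · simp [hn] at ha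
          · have hi : i ∉ τ := by
              intro hi
              obtain ⟨m, hm⟩ := hA.even i l hd hi
              rw [hn] at hm
              have : ((-1 : ℤ) : R) = ((2 * m : ℤ) : R) := by rw [← hm]; push_cast; simp
              have := Int.cast_injective this
              omega
            rw [hexp]
            refine ⟨_, hs', 0, zero_mem _, ?_⟩
            have : s = 1 := by simp [hs_def, indexParity, hi, koszulSign]
            rw [h4, this]
            simp
          · exact big n hexp
        · rw [serreExp_of_diag_eq_zero hd ha]
          have hi := hA.mem_of_diag_eq_zero i hd
          have hsn : s = -1 := by simp [hs_def, indexParity, hi, koszulSign]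
          -- Now $1-s=2$, and $2e_i^2=[e_i,e_i]$. The square is a generator of the Serre ideal only
          -- if $a_{li}$ is nonzero in `k`; otherwise the coefficient of the correction is zero.
          refine ⟨_, hs', (koszulSign k (indexParity τ l) (indexParity τ l) *
            algebraMap R k (A l i)) • (freeAssoc k (indexParity τ)).br (FreeAlgebra.ι k i)
              (FreeAlgebra.ι k i), ?_, ?_⟩
          · by_cases hz : algebraMap R k (A l i) = 0
            · simp [hz]
            · exact Submodule.smul_mem _ _ (IsSerreGen.sq i l hij hi hd ha hz).mem_serreSpan
          · rw [h4, freeAssoc_br _ (ι_mem_wordGrade k _ i) (ι_mem_wordGrade k _ i), ← hs_def, hsn]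
            simp only [map_smul, map_sub, map_mul, FreeAlgebra.lift_ι_apply]
            module
    · have key : ∀ m, ∃ c : k, c ≠ 0 ∧ f l * u m = c • (u m * f l) := by
        intro m
        induction m with
        | zero =>
          exact ⟨koszulSign k (indexParity τ l) (indexParity τ j), koszulSign_ne_zero k _ _, by
            rw [hu0]; exact t.fe_ne (Ne.symm hlj)⟩
        | succ m ih =>
          obtain ⟨c, hc, ih⟩ := ih
          have h3 := lower_step (κ := s ^ m * κ) (d := 0) (t.fe_ne (Ne.symm hli))
            (by rw [ih, add_zero])
          refine ⟨koszulSign k (indexParity τ l) (indexParity τ i) * c,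
            mul_ne_zero (koszulSign_ne_zero k _ _) hc, ?_⟩
          rw [hu m, h3]
          simp
      obtain ⟨c, hc, h3⟩ := key (serreExp A i j)
      exact ⟨c, hc, 0, zero_mem _, by rw [h3, map_zero, add_zero]⟩

/-- For $l=i$, moving $f_i$ past $e_i^2$ leaves $h_ie_i-e_ih_i$, which is $0$ because $a_{ii}=0$. -/
theorem comm_sq (t : IsCartanTriple (fun i j => algebraMap R k (A i j)) τ e h f)
    {i : Fin r} (hi : i ∈ τ) (hd : A i i = 0) (l : Fin r) :
    ∃ c : k, c ≠ 0 ∧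
      f l * FreeAlgebra.lift k e
        ((freeAssoc k (indexParity τ)).br (FreeAlgebra.ι k i) (FreeAlgebra.ι k i)) =
      c • (FreeAlgebra.lift k e
        ((freeAssoc k (indexParity τ)).br (FreeAlgebra.ι k i) (FreeAlgebra.ι k i)) * f l) := by
  have hs : koszulSign k (indexParity τ i) (indexParity τ i) = -1 := by
    simp [indexParity, hi, koszulSign]
  rw [freeAssoc_br _ (ι_mem_wordGrade k _ i) (ι_mem_wordGrade k _ i), hs]
  simp only [map_smul, map_sub, map_mul, FreeAlgebra.lift_ι_apply]
  by_cases hli : l = i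
  · subst hli
    have h1 := t.fe_self l
    have h3 := t.eh l l
    simp only [hd, map_zero, zero_smul, add_zero] at h3
    rw [hs] at h1
    have h4 : f l * (e l * e l) = e l * e l * f l := by
      rw [← mul_assoc, h1, sub_mul, smul_mul_assoc, mul_assoc, h1, smul_mul_assoc, h3]
      simp only [mul_sub, mul_smul_comm, mul_assoc]
      module
    exact ⟨1, one_ne_zero, by
      simp only [mul_sub, sub_mul, mul_smul_comm, smul_mul_assoc, h4, one_smul]⟩
  · have h1 := t.fe_ne (Ne.symm hli)
    set c := koszulSign k (indexParity τ l) (indexParity τ i) with hc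
    have h4 : f l * (e i * e i) = (c * c) • (e i * e i * f l) := by
      rw [← mul_assoc, h1, smul_mul_assoc, mul_assoc, h1, mul_smul_comm, smul_smul, mul_assoc]
    refine ⟨c * c, mul_ne_zero (koszulSign_ne_zero k _ _) (koszulSign_ne_zero k _ _), ?_⟩
    simp only [mul_sub, sub_mul, mul_smul_comm, smul_mul_assoc, h4]
    module

end IsCartanTriple

namespace IsCartanTriple

variable {R : Type*} [CommRing R] {r : ℕ} {k B : Type*} [Field k] [Algebra R k]
  [Ring B] [Algebra k B] {A : Matrix (Fin r) (Fin r) R} {τ : Finset (Fin r)} {e h f : Fin r → B}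

theorem anticomm_step {f w w' d d' : B} {s : k} (hs : s * s = 1) (hw : f * w = s • (w * f) + d)
    (hw' : f * w' = s • (w' * f) + d') :
    f * (w * w' + w' * w) = (w * w' + w' * w) * f +
      (s • (w * d') + d * w' + s • (w' * d) + d' * w) := by
  have h1 : f * (w * w') = w * w' * f + (s • (w * d') + d * w') := by
    rw [← mul_assoc, hw, add_mul, smul_mul_assoc, mul_assoc, hw', mul_add, mul_smul_comm, smul_add,
      smul_smul, hs, one_smul, mul_assoc]
    abel
  have h2 : f * (w' * w) = w' * w * f + (s • (w' * d) + d' * w) := by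
    rw [← mul_assoc, hw', add_mul, smul_mul_assoc, mul_assoc, hw, mul_add, mul_smul_comm, smul_add,
      smul_smul, hs, one_smul, mul_assoc]
    abel
  rw [mul_add, h1, h2, add_mul]
  abel

theorem br_br_mem_serreSpan [CharZero R] {m j : Fin r} (hm : m ∈ τ) (hj : j ∉ τ)
    (hd : A m m = 0) :
    (freeAssoc k (indexParity τ)).br (FreeAlgebra.ι k m)
      ((freeAssoc k (indexParity τ)).br (FreeAlgebra.ι k m) (FreeAlgebra.ι k j)) ∈
        serreSpan k A τ := by
  have hmj : m ≠ j := by rintro rfl; exact hj hm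
  by_cases ha : A m j = 0
  · have h1 := (IsSerreGen.ad (k := k) (A := A) (τ := τ) (G := freeAssoc k (indexParity τ))
      (x := FreeAlgebra.ι k) m j hmj).mem_serreSpan
    rw [serreExp_of_eq_zero ha] at h1
    exact (br_mem_serreSpan (ι_mem_wordGrade k _ m)
      ((freeAssoc k (indexParity τ)).br_mem (ι_mem_wordGrade k _ m) (ι_mem_wordGrade k _ j)) h1).1
  · have h1 := (IsSerreGen.ad (k := k) (A := A) (τ := τ) (G := freeAssoc k (indexParity τ))
      (x := FreeAlgebra.ι k) m j hmj).mem_serreSpan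
    rwa [serreExp_of_diag_eq_zero hd ha] at h1

/-- The relation is the anticommutator of the odd elements $w=[e_n,e_m]$ and $w'=[e_m,e_l]$. For
$p=n$ the correction is a multiple of $[e_m,[e_m,e_l]]$, for $p=l$ one of $[e_m,[e_m,e_n]]$. For
$p=m$ the hypothesis $a_{mn}=-a_{ml}$ combines the corrections into a multiple of $[[e_n,e_l],e_m]$,
and $[e_n,e_l]$ is a Serre relation as $a_{nl}=0$. For other $p$ there is none. -/
theorem comm_quartic [CharZero R]
    (t : IsCartanTriple (fun i j => algebraMap R k (A i j)) τ e h f) {l m n : Fin r}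
    (hln : l ≠ n) (hm : m ∈ τ) (hl : l ∉ τ) (hn : n ∉ τ)
    (hd : A m m = 0) (hnl : A n l = 0) (hA : A m n + A m l = 0) (p : Fin r)
    {θ : FreeAlgebra k (Fin r)}
    (hθ : θ = (freeAssoc k (indexParity τ)).br
      ((freeAssoc k (indexParity τ)).br (FreeAlgebra.ι k n) (FreeAlgebra.ι k m))
      ((freeAssoc k (indexParity τ)).br (FreeAlgebra.ι k m) (FreeAlgebra.ι k l))) :
    ∃ c : k, c ≠ 0 ∧ ∃ v ∈ serreSpan k A τ,
      f p * FreeAlgebra.lift k e θ =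
        c • (FreeAlgebra.lift k e θ * f p) + FreeAlgebra.lift k e v := by
  have hml : m ≠ l := by rintro rfl; exact hl hm
  have hmn : m ≠ n := by rintro rfl; exact hn hm
  have pm : indexParity τ m = 1 := by simp [indexParity, hm]
  have pl : indexParity τ l = 0 := by simp [indexParity, hl]
  have pn : indexParity τ n = 0 := by simp [indexParity, hn]
  have gm : FreeAlgebra.ι k m ∈ wordGrade k (indexParity τ) 1 := pm ▸ ι_mem_wordGrade k _ m
  have gl : FreeAlgebra.ι k l ∈ wordGrade k (indexParity τ) 0 := pl ▸ ι_mem_wordGrade k _ l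
  have gn : FreeAlgebra.ι k n ∈ wordGrade k (indexParity τ) 0 := pn ▸ ι_mem_wordGrade k _ n
  have s01 : koszulSign k 0 1 = 1 := koszulSign_zero_left k 1
  have s10 : koszulSign k 1 0 = 1 := koszulSign_zero_right k 1
  have s00 : koszulSign k 0 0 = 1 := koszulSign_zero_right k 0
  have s11 : koszulSign k 1 1 = -1 := by simp [koszulSign]
  have b1 : (freeAssoc k (indexParity τ)).br (FreeAlgebra.ι k n) (FreeAlgebra.ι k m) =
      FreeAlgebra.ι k n * FreeAlgebra.ι k m - FreeAlgebra.ι k m * FreeAlgebra.ι k n := by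
    rw [freeAssoc_br _ gn gm, s01, one_smul]
  have b2 : (freeAssoc k (indexParity τ)).br (FreeAlgebra.ι k m) (FreeAlgebra.ι k l) =
      FreeAlgebra.ι k m * FreeAlgebra.ι k l - FreeAlgebra.ι k l * FreeAlgebra.ι k m := by
    rw [freeAssoc_br _ gm gl, s10, one_smul]
  have b3 : (freeAssoc k (indexParity τ)).br (FreeAlgebra.ι k m) (FreeAlgebra.ι k n) =
      FreeAlgebra.ι k m * FreeAlgebra.ι k n - FreeAlgebra.ι k n * FreeAlgebra.ι k m := by
    rw [freeAssoc_br _ gm gn, s10, one_smul]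
  have g1 : (freeAssoc k (indexParity τ)).br (FreeAlgebra.ι k n) (FreeAlgebra.ι k m) ∈
      wordGrade k (indexParity τ) 1 := zero_add (1 : ZMod 2) ▸
        (freeAssoc k (indexParity τ)).br_mem gn gm
  have g2 : (freeAssoc k (indexParity τ)).br (FreeAlgebra.ι k m) (FreeAlgebra.ι k l) ∈
      wordGrade k (indexParity τ) 1 := add_zero (1 : ZMod 2) ▸
        (freeAssoc k (indexParity τ)).br_mem gm gl
  have g3 : (freeAssoc k (indexParity τ)).br (FreeAlgebra.ι k m) (FreeAlgebra.ι k n) ∈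
      wordGrade k (indexParity τ) 1 := add_zero (1 : ZMod 2) ▸
        (freeAssoc k (indexParity τ)).br_mem gm gn
  have v1 := br_br_mem_serreSpan (k := k) (A := A) hm hl hd
  have v2 := br_br_mem_serreSpan (k := k) (A := A) hm hn hd
  rw [freeAssoc_br _ gm g2, b2, s11] at v1
  rw [freeAssoc_br _ gm g3, b3, s11] at v2
  have v3 := (IsSerreGen.ad (k := k) (A := A) (τ := τ) (G := freeAssoc k (indexParity τ))
      (x := FreeAlgebra.ι k) n l hln.symm).mem_serreSpan
  rw [serreExp_of_eq_zero hnl, Function.iterate_one, freeAssoc_br _ gn gl, s00, one_smul] at v3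
  rw [freeAssoc_br _ g1 g2, b1, b2, s11] at hθ
  have hθ' : FreeAlgebra.lift k e θ = (e n * e m - e m * e n) * (e m * e l - e l * e m) +
      (e m * e l - e l * e m) * (e n * e m - e m * e n) := by
    rw [hθ]
    simp
  have eh := t.eh
  rw [hθ']
  have fne : ∀ {i j : Fin r}, i ≠ j →
      f j * e i = koszulSign k (indexParity τ j) (indexParity τ i) • (e i * f j) := t.fe_ne
  have prod : ∀ {u w d d' : B} {s s' : k}, f p * u = s • (u * f p) + d →
      f p * w = s' • (w * f p) + d' →
      f p * (u * w) = (s * s') • (u * w * f p) + (s • (u * d') + d * w) := by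
    intro u w d d' s s' hu hw
    rw [← mul_assoc, hu, add_mul, smul_mul_assoc, mul_assoc, hw, mul_add, mul_smul_comm, smul_add,
      smul_smul, mul_assoc]
    abel
  have other : ∀ {i : Fin r}, i ≠ p →
      f p * e i = koszulSign k (indexParity τ p) (indexParity τ i) • (e i * f p) + 0 := by
    intro i hi
    rw [t.fe_ne hi, add_zero]
  have own : f p * e p = koszulSign k (indexParity τ p) (indexParity τ p) • (e p * f p) +
      -(koszulSign k (indexParity τ p) (indexParity τ p) • h p) := by
    rw [t.fe_self p, sub_eq_add_neg]
  have sl : koszulSign k (indexParity τ p) (indexParity τ l) = 1 := by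
    rw [pl, koszulSign_zero_right]
  have sn : koszulSign k (indexParity τ p) (indexParity τ n) = 1 := by
    rw [pn, koszulSign_zero_right]
  set s := koszulSign k (indexParity τ p) (indexParity τ m) with hs
  have hss : s * s = 1 := koszulSign_mul_self k _ _
  by_cases hpn : n = p
  · subst hpn
    have hsm : s = 1 := by rw [hs, pn, koszulSign_zero_left]
    have om := other hmn
    have ol := other hln
    rw [← hs, hsm] at om
    rw [sl] at ol
    rw [sn] at own
    have w1 : f n * (e n * e m - e m * e n) = (1 : k) • ((e n * e m - e m * e n) * f n) +
        -(algebraMap R k (A n m) • e m) := by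
      rw [mul_sub, prod own om, prod om own]
      simp only [mul_zero, zero_mul, neg_mul, mul_neg, mul_smul_comm, smul_mul_assoc, eh, sub_mul,
        mul_assoc]
      module
    have w2 : f n * (e m * e l - e l * e m) = (1 : k) • ((e m * e l - e l * e m) * f n) + 0 := by
      rw [mul_sub, prod om ol, prod ol om]
      simp only [mul_zero, zero_mul, sub_mul, mul_assoc]
      module
    refine ⟨1, one_ne_zero, _, Submodule.smul_mem _ (-algebraMap R k (A n m)) v1, ?_⟩
    rw [anticomm_step (one_mul (1 : k)) w1 w2]
    simp only [map_smul, map_sub, map_mul, FreeAlgebra.lift_ι_apply, mul_zero, zero_mul,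
      neg_mul, mul_neg, smul_mul_assoc, mul_smul_comm]
    module
  by_cases hpl : l = p
  · subst hpl
    have hsm : s = 1 := by rw [hs, pl, koszulSign_zero_left]
    have om := other hml
    have on := other hln.symm
    rw [← hs, hsm] at om
    rw [sn] at on
    rw [sl] at own
    have w1 : f l * (e n * e m - e m * e n) = (1 : k) • ((e n * e m - e m * e n) * f l) + 0 := by
      rw [mul_sub, prod on om, prod om on]
      simp only [mul_zero, zero_mul, sub_mul, mul_assoc]
      module
    have w2 : f l * (e m * e l - e l * e m) = (1 : k) • ((e m * e l - e l * e m) * f l) +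
        algebraMap R k (A l m) • e m := by
      rw [mul_sub, prod own om, prod om own]
      simp only [mul_zero, zero_mul, neg_mul, mul_neg, mul_smul_comm, smul_mul_assoc, eh, sub_mul,
        mul_assoc]
      module
    refine ⟨1, one_ne_zero, _, Submodule.smul_mem _ (-algebraMap R k (A l m)) v2, ?_⟩
    rw [anticomm_step (one_mul (1 : k)) w1 w2]
    simp only [map_smul, map_sub, map_mul, FreeAlgebra.lift_ι_apply, mul_zero, zero_mul,
      smul_mul_assoc, mul_smul_comm, mul_sub, sub_mul, mul_assoc]
    module
  have ol := other hpl
  have on := other hpn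
  rw [sl] at ol
  rw [sn] at on
  by_cases hpm : m = p
  · subst hpm
    have hsm : s = -1 := by rw [hs, pm, s11]
    rw [← hs, hsm] at own
    have w1 : f m * (e n * e m - e m * e n) = (-1 : k) • ((e n * e m - e m * e n) * f m) +
        -(algebraMap R k (A m n) • e n) := by
      rw [mul_sub, prod on own, prod own on]
      simp only [mul_zero, zero_mul, neg_mul, mul_neg, mul_smul_comm, smul_mul_assoc, eh, sub_mul,
        mul_assoc]
      module
    have w2 : f m * (e m * e l - e l * e m) = (-1 : k) • ((e m * e l - e l * e m) * f m) +
        algebraMap R k (A m l) • e l := by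
      rw [mul_sub, prod ol own, prod own ol]
      simp only [mul_zero, zero_mul, neg_mul, mul_neg, mul_smul_comm, smul_mul_assoc, eh, sub_mul,
        mul_assoc]
      module
    have ha : algebraMap R k (A m n) = -algebraMap R k (A m l) := by
      rw [← map_neg, eq_neg_of_add_eq_zero_left hA]
    refine ⟨1, one_ne_zero, _, Submodule.smul_mem _ (-algebraMap R k (A m l))
      (sub_mem (mul_mem_serreSpan_right (FreeAlgebra.ι k m) v3)
        (mul_mem_serreSpan_left (FreeAlgebra.ι k m) v3)), ?_⟩
    rw [anticomm_step (by ring : (-1 : k) * -1 = 1) w1 w2, ha]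
    simp only [map_smul, map_sub, map_mul, FreeAlgebra.lift_ι_apply, neg_mul, mul_neg,
      smul_mul_assoc, mul_smul_comm, mul_sub, sub_mul, mul_assoc]
    module
  have om := other hpm
  rw [← hs] at om
  have w1 : f p * (e n * e m - e m * e n) = s • ((e n * e m - e m * e n) * f p) + 0 := by
    rw [mul_sub, prod on om, prod om on]
    simp only [mul_zero, zero_mul, sub_mul]
    module
  have w2 : f p * (e m * e l - e l * e m) = s • ((e m * e l - e l * e m) * f p) + 0 := by
    rw [mul_sub, prod ol om, prod om ol]
    simp only [mul_zero, zero_mul, sub_mul]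
    module
  refine ⟨1, one_ne_zero, 0, zero_mem _, ?_⟩
  rw [anticomm_step hss w1 w2]
  simp

theorem comm_serreGen [CharZero R] (h2 : (2 : k) ≠ 0) (hA : IsSuperGCM A τ)
    (t : IsCartanTriple (fun i j => algebraMap R k (A i j)) τ e h f) (p : Fin r)
    {θ : FreeAlgebra k (Fin r)}
    (hθ : IsSerreGen k A τ (freeAssoc k (indexParity τ)) (FreeAlgebra.ι k) θ) :
    ∃ c : k, c ≠ 0 ∧ ∃ v ∈ serreSpan k A τ,
      f p * FreeAlgebra.lift k e θ =
        c • (FreeAlgebra.lift k e θ * f p) + FreeAlgebra.lift k e v := by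
  cases hθ with
  | ad i j hij => exact t.comm_ad h2 hA hij p rfl
  | sq i j hij hi hd h1 h3 =>
    obtain ⟨c, hc, h4⟩ := t.comm_sq hi hd p
    exact ⟨c, hc, 0, zero_mem _, by rw [h4, map_zero, add_zero]⟩
  | quartic l m n h1 h3 h4 h5 h6 h7 h8 h9 =>
    exact t.comm_quartic (Fin.ne_of_val_ne (by omega)) h4 h5 h6 h7 h8 h9 p rfl

/-! ### Commutation of the Serre ideal with the Cartan and lowering operators -/

theorem lift_mul_h (t : IsCartanTriple (fun i j => algebraMap R k (A i j)) τ e h f) (p : Fin r)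
    {m : k} {x : FreeAlgebra k (Fin r)}
    (hx : x ∈ wordSpan k (fun j => algebraMap R k (A p j)) m) :
    h p * FreeAlgebra.lift k e x = FreeAlgebra.lift k e x * h p + m • FreeAlgebra.lift k e x := by
  induction hx using Submodule.span_induction with
  | mem w hw =>
    obtain ⟨l, rfl, rfl⟩ := hw
    induction l with
    | nil => simp
    | cons i l ih =>
      have h1 := t.eh p i
      simp only [List.map_cons, List.prod_cons, List.sum_cons, map_mul,
        FreeAlgebra.lift_ι_apply] at ih ⊢
      rw [← mul_assoc, h1, add_mul, mul_assoc, ih]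
      simp only [mul_add, smul_mul_assoc, mul_smul_comm, mul_assoc]
      module
  | zero => simp
  | add x y _ _ hx hy =>
    rw [map_add, mul_add, hx, hy, add_mul, smul_add]
    abel
  | smul c x _ hx =>
    rw [map_smul, mul_smul_comm, hx, smul_mul_assoc, smul_comm m c, smul_add]

/-- The image of the Serre ideal in an algebra. -/
abbrev serreImage (k : Type*) [Field k] [Algebra R k] [Algebra k B]
    (A : Matrix (Fin r) (Fin r) R) (τ : Finset (Fin r)) (e : Fin r → B) : Submodule k B :=
  (serreSpan k A τ).map (FreeAlgebra.lift k e).toLinearMap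

theorem mul_mem_serreImage {x : B} (hx : x ∈ serreImage k A τ e) (j : Fin r) :
    e j * x ∈ serreImage k A τ e ∧ x * e j ∈ serreImage k A τ e := by
  obtain ⟨y, hy, rfl⟩ := hx
  exact ⟨⟨_, mul_mem_serreSpan_left (FreeAlgebra.ι k j) hy, by simp⟩,
    ⟨_, mul_mem_serreSpan_right (FreeAlgebra.ι k j) hy, by simp⟩⟩

theorem serreImage_comm_h (t : IsCartanTriple (fun i j => algebraMap R k (A i j)) τ e h f)
    (p : Fin r) {x : B} (hx : x ∈ serreImage k A τ e) :
    h p * x - x * h p ∈ serreImage k A τ e := by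
  obtain ⟨y, hy, rfl⟩ := hx
  -- The intersection with the Serre ideal is needed because, on multiplying `x` by a generator, the
  -- Leibniz rule produces a multiple of `x` itself beside $[h_p,x]$.
  let N : Submodule k (FreeAlgebra k (Fin r)) := serreSpan k A τ ⊓ (serreImage k A τ e).comap
    ((LinearMap.mulLeft k (h p) - LinearMap.mulRight k (h p)) ∘ₗ
      (FreeAlgebra.lift k e).toLinearMap)
  refine (serreSpan_le (N := N) ?_ ?_ ?_ hy).2
  · intro θ hθ
    obtain ⟨m, hm⟩ := hθ.homogeneous (fun j => algebraMap R k (A p j))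
    refine ⟨hθ.mem_serreSpan, ?_⟩
    have h1 := t.lift_mul_h p hm
    simp only [SetLike.mem_coe, Submodule.mem_comap, LinearMap.comp_apply, AlgHom.toLinearMap_apply,
      LinearMap.sub_apply, LinearMap.mulLeft_apply, LinearMap.mulRight_apply, h1,
      add_sub_cancel_left]
    exact Submodule.smul_mem _ _ ⟨θ, hθ.mem_serreSpan, rfl⟩
  · rintro j x ⟨hx, hx'⟩
    refine ⟨mul_mem_serreSpan_left _ hx, ?_⟩
    simp only [SetLike.mem_coe, Submodule.mem_comap, LinearMap.comp_apply, AlgHom.toLinearMap_apply,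
      LinearMap.sub_apply, LinearMap.mulLeft_apply, LinearMap.mulRight_apply, map_mul,
      FreeAlgebra.lift_ι_apply] at hx' ⊢
    have h1 := (mul_mem_serreImage hx' j).1
    have h3 := (mul_mem_serreImage (x := FreeAlgebra.lift k e x) ⟨x, hx, rfl⟩ j).1
    convert add_mem h1 (Submodule.smul_mem _ (algebraMap R k (A p j)) h3) using 1
    rw [← mul_assoc, t.eh p j, add_mul, smul_mul_assoc, mul_sub]
    simp only [mul_assoc]
    abel
  · rintro j x ⟨hx, hx'⟩
    refine ⟨mul_mem_serreSpan_right _ hx, ?_⟩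
    simp only [SetLike.mem_coe, Submodule.mem_comap, LinearMap.comp_apply, AlgHom.toLinearMap_apply,
      LinearMap.sub_apply, LinearMap.mulLeft_apply, LinearMap.mulRight_apply, map_mul,
      FreeAlgebra.lift_ι_apply] at hx' ⊢
    have h1 := (mul_mem_serreImage hx' j).2
    have h3 := (mul_mem_serreImage (x := FreeAlgebra.lift k e x) ⟨x, hx, rfl⟩ j).2
    convert add_mem h1 (Submodule.smul_mem _ (algebraMap R k (A p j)) h3) using 1
    have h4 : FreeAlgebra.lift k e x * e j * h p = FreeAlgebra.lift k e x * (h p * e j) -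
        algebraMap R k (A p j) • (FreeAlgebra.lift k e x * e j) := by
      rw [t.eh p j, mul_add, mul_smul_comm, mul_assoc]
      abel
    rw [h4, sub_mul]
    simp only [mul_assoc]
    abel

theorem fe (t : IsCartanTriple (fun i j => algebraMap R k (A i j)) τ e h f) (p j : Fin r) :
    ∃ c d : k, f p * e j = c • (e j * f p) + d • h p ∧ ∃ c' d' : k,
      e j * f p = c' • (f p * e j) + d' • h p := by
  by_cases hjp : j = p
  · subst hjp
    refine ⟨koszulSign k (indexParity τ j) (indexParity τ j),
      -koszulSign k (indexParity τ j) (indexParity τ j), by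
      rw [t.fe_self, neg_smul, sub_eq_add_neg],
      koszulSign k (indexParity τ j) (indexParity τ j), 1, ?_⟩
    have h1 := t.ef j j
    rw [if_pos rfl] at h1
    rw [one_smul, ← h1]
    abel
  · refine ⟨koszulSign k (indexParity τ p) (indexParity τ j), 0, by
      rw [t.fe_ne hjp, zero_smul, add_zero],
      koszulSign k (indexParity τ j) (indexParity τ p), 0, ?_⟩
    have h1 := t.ef j p
    rw [if_neg hjp] at h1
    rw [zero_smul, add_zero, sub_eq_zero.1 h1]

theorem mul_h_mem (t : IsCartanTriple (fun i j => algebraMap R k (A i j)) τ e h f)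
    (p : Fin r) {x : B} (hx : x ∈ serreImage k A τ e) :
    x * h p ∈ (serreImage k A τ e).map (LinearMap.mulLeft k (h p)) ⊔ serreImage k A τ e := by
  have h1 := t.serreImage_comm_h p hx
  have h3 : x * h p = h p * x - (h p * x - x * h p) := by abel
  rw [h3]
  exact sub_mem (Submodule.mem_sup_left ⟨x, hx, rfl⟩) (Submodule.mem_sup_right h1)

theorem e_h_mem (t : IsCartanTriple (fun i j => algebraMap R k (A i j)) τ e h f)
    (p j : Fin r) {x : B} (hx : x ∈ serreImage k A τ e) :
    e j * (h p * x) ∈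
      (serreImage k A τ e).map (LinearMap.mulLeft k (h p)) ⊔ serreImage k A τ e := by
  have h1 := (mul_mem_serreImage hx j).1
  have h3 : e j * (h p * x) = h p * (e j * x) - algebraMap R k (A p j) • (e j * x) := by
    rw [← mul_assoc, ← mul_assoc, t.eh p j, add_mul, smul_mul_assoc]
    abel
  rw [h3]
  exact sub_mem (Submodule.mem_sup_left ⟨_, h1, rfl⟩)
    (Submodule.mem_sup_right (Submodule.smul_mem _ _ h1))

/-- The inclusion $f_pI\subseteq If_p+h_pI+I$. It holds on generators by `comm_serreGen` and
survives multiplication by the $e_j$ on either side: moving $f_p$ past $e_j$ costs a sign and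
possibly $h_p$, which normalizes $I$. -/
theorem f_mul_mem [CharZero R] (h2 : (2 : k) ≠ 0) (hA : IsSuperGCM A τ)
    (t : IsCartanTriple (fun i j => algebraMap R k (A i j)) τ e h f)
    (p : Fin r) {x : FreeAlgebra k (Fin r)} (hx : x ∈ serreSpan k A τ) :
    f p * FreeAlgebra.lift k e x ∈ (serreImage k A τ e).map (LinearMap.mulRight k (f p)) ⊔
      ((serreImage k A τ e).map (LinearMap.mulLeft k (h p)) ⊔ serreImage k A τ e) := by
  let W : Submodule k B := (serreImage k A τ e).map (LinearMap.mulRight k (f p)) ⊔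
      ((serreImage k A τ e).map (LinearMap.mulLeft k (h p)) ⊔ serreImage k A τ e)
  let N : Submodule k (FreeAlgebra k (Fin r)) := serreSpan k A τ ⊓ W.comap
    (LinearMap.mulLeft k (f p) ∘ₗ (FreeAlgebra.lift k e).toLinearMap)
  refine (serreSpan_le (N := N) ?_ ?_ ?_ hx).2
  · intro θ hθ
    obtain ⟨c, -, v, hv, h1⟩ := t.comm_serreGen h2 hA p hθ
    refine ⟨hθ.mem_serreSpan, ?_⟩
    simp only [SetLike.mem_coe, Submodule.mem_comap, LinearMap.comp_apply, AlgHom.toLinearMap_apply,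
      LinearMap.mulLeft_apply, h1]
    exact add_mem (Submodule.smul_mem _ _ (Submodule.mem_sup_left
      ⟨_, ⟨θ, hθ.mem_serreSpan, rfl⟩, rfl⟩))
      (Submodule.mem_sup_right (Submodule.mem_sup_right ⟨v, hv, rfl⟩))
  · rintro j x ⟨hx, hx'⟩
    refine ⟨mul_mem_serreSpan_left _ hx, ?_⟩
    simp only [SetLike.mem_coe, Submodule.mem_comap, LinearMap.comp_apply, AlgHom.toLinearMap_apply,
      LinearMap.mulLeft_apply, map_mul, FreeAlgebra.lift_ι_apply] at hx' ⊢
    obtain ⟨c, d, h1, -⟩ := t.fe p j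
    rw [← mul_assoc, h1, add_mul, smul_mul_assoc, smul_mul_assoc, mul_assoc]
    refine add_mem (Submodule.smul_mem _ _ ?_) (Submodule.smul_mem _ _
      (Submodule.mem_sup_right (Submodule.mem_sup_left ⟨_, ⟨x, hx, rfl⟩, rfl⟩)))
    obtain ⟨_, ⟨u, hu, rfl⟩, y, hy, h3⟩ := Submodule.mem_sup.1 hx'
    obtain ⟨_, ⟨v, hv, rfl⟩, w, hw, rfl⟩ := Submodule.mem_sup.1 hy
    rw [← h3, mul_add, mul_add]
    refine add_mem (Submodule.mem_sup_left ⟨_, (mul_mem_serreImage hu j).1, ?_⟩)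
      (Submodule.mem_sup_right (add_mem (t.e_h_mem p j hv)
        (Submodule.mem_sup_right (mul_mem_serreImage hw j).1)))
    simp [mul_assoc]
  · rintro j x ⟨hx, hx'⟩
    refine ⟨mul_mem_serreSpan_right _ hx, ?_⟩
    simp only [SetLike.mem_coe, Submodule.mem_comap, LinearMap.comp_apply, AlgHom.toLinearMap_apply,
      LinearMap.mulLeft_apply, map_mul, FreeAlgebra.lift_ι_apply] at hx' ⊢
    obtain ⟨c, d, h1, -⟩ := t.fe p j
    obtain ⟨_, ⟨u, hu, rfl⟩, y, hy, h3⟩ := Submodule.mem_sup.1 hx'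
    obtain ⟨_, ⟨v, hv, rfl⟩, w, hw, rfl⟩ := Submodule.mem_sup.1 hy
    rw [← mul_assoc, ← h3, add_mul, add_mul]
    refine add_mem ?_ (Submodule.mem_sup_right (add_mem
      (Submodule.mem_sup_left ⟨_, (mul_mem_serreImage hv j).2, ?_⟩)
      (Submodule.mem_sup_right (mul_mem_serreImage hw j).2)))
    · rw [LinearMap.mulRight_apply, mul_assoc, h1, mul_add, mul_smul_comm, mul_smul_comm,
        ← mul_assoc]
      exact add_mem (Submodule.smul_mem _ _ (Submodule.mem_sup_left
        ⟨_, (mul_mem_serreImage hu j).2, rfl⟩))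
        (Submodule.smul_mem _ _ (Submodule.mem_sup_right (t.mul_h_mem p hu)))
    · simp [mul_assoc]

/-- The mirror image of `f_mul_mem`; the relation on generators is solved for $\theta f_p$, which
uses $c\ne0$. -/
theorem mul_f_mem [CharZero R] (h2 : (2 : k) ≠ 0) (hA : IsSuperGCM A τ)
    (t : IsCartanTriple (fun i j => algebraMap R k (A i j)) τ e h f)
    (p : Fin r) {x : FreeAlgebra k (Fin r)} (hx : x ∈ serreSpan k A τ) :
    FreeAlgebra.lift k e x * f p ∈ (serreImage k A τ e).map (LinearMap.mulLeft k (f p)) ⊔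
      ((serreImage k A τ e).map (LinearMap.mulLeft k (h p)) ⊔ serreImage k A τ e) := by
  let W : Submodule k B := (serreImage k A τ e).map (LinearMap.mulLeft k (f p)) ⊔
      ((serreImage k A τ e).map (LinearMap.mulLeft k (h p)) ⊔ serreImage k A τ e)
  let N : Submodule k (FreeAlgebra k (Fin r)) := serreSpan k A τ ⊓ W.comap
    (LinearMap.mulRight k (f p) ∘ₗ (FreeAlgebra.lift k e).toLinearMap)
  refine (serreSpan_le (N := N) ?_ ?_ ?_ hx).2
  · intro θ hθ
    obtain ⟨c, hc, v, hv, h1⟩ := t.comm_serreGen h2 hA p hθ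
    refine ⟨hθ.mem_serreSpan, ?_⟩
    have h3 : FreeAlgebra.lift k e θ * f p =
        c⁻¹ • (f p * FreeAlgebra.lift k e θ - FreeAlgebra.lift k e v) := by
      rw [h1, add_sub_cancel_right, smul_smul, inv_mul_cancel₀ hc, one_smul]
    simp only [SetLike.mem_coe, Submodule.mem_comap, LinearMap.comp_apply, AlgHom.toLinearMap_apply,
      LinearMap.mulRight_apply, h3]
    exact Submodule.smul_mem _ _ (sub_mem (Submodule.mem_sup_left
      ⟨_, ⟨θ, hθ.mem_serreSpan, rfl⟩, rfl⟩)
      (Submodule.mem_sup_right (Submodule.mem_sup_right ⟨v, hv, rfl⟩)))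
  · rintro j x ⟨hx, hx'⟩
    refine ⟨mul_mem_serreSpan_left _ hx, ?_⟩
    simp only [SetLike.mem_coe, Submodule.mem_comap, LinearMap.comp_apply, AlgHom.toLinearMap_apply,
      LinearMap.mulRight_apply, map_mul, FreeAlgebra.lift_ι_apply] at hx' ⊢
    obtain ⟨-, -, -, c, d, h1⟩ := t.fe p j
    obtain ⟨_, ⟨u, hu, rfl⟩, y, hy, h3⟩ := Submodule.mem_sup.1 hx'
    obtain ⟨_, ⟨v, hv, rfl⟩, w, hw, rfl⟩ := Submodule.mem_sup.1 hy
    rw [mul_assoc, ← h3, mul_add, mul_add]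
    refine add_mem ?_ (Submodule.mem_sup_right (add_mem (t.e_h_mem p j hv)
      (Submodule.mem_sup_right (mul_mem_serreImage hw j).1)))
    rw [LinearMap.mulLeft_apply, ← mul_assoc, h1, add_mul, smul_mul_assoc, smul_mul_assoc,
      mul_assoc]
    exact add_mem (Submodule.smul_mem _ _ (Submodule.mem_sup_left
      ⟨_, (mul_mem_serreImage hu j).1, rfl⟩))
      (Submodule.smul_mem _ _ (Submodule.mem_sup_right (Submodule.mem_sup_left ⟨_, hu, rfl⟩)))
  · rintro j x ⟨hx, hx'⟩
    refine ⟨mul_mem_serreSpan_right _ hx, ?_⟩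
    simp only [SetLike.mem_coe, Submodule.mem_comap, LinearMap.comp_apply, AlgHom.toLinearMap_apply,
      LinearMap.mulRight_apply, map_mul, FreeAlgebra.lift_ι_apply] at hx' ⊢
    obtain ⟨-, -, -, c, d, h1⟩ := t.fe p j
    rw [mul_assoc, h1, mul_add, mul_smul_comm, mul_smul_comm, ← mul_assoc]
    refine add_mem (Submodule.smul_mem _ _ ?_) (Submodule.smul_mem _ _
      (Submodule.mem_sup_right (t.mul_h_mem p ⟨x, hx, rfl⟩)))
    obtain ⟨_, ⟨u, hu, rfl⟩, y, hy, h3⟩ := Submodule.mem_sup.1 hx'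
    obtain ⟨_, ⟨v, hv, rfl⟩, w, hw, rfl⟩ := Submodule.mem_sup.1 hy
    rw [← h3, add_mul, add_mul, LinearMap.mulLeft_apply, LinearMap.mulLeft_apply, mul_assoc,
      mul_assoc]
    exact add_mem (Submodule.mem_sup_left ⟨_, (mul_mem_serreImage hu j).2, rfl⟩)
      (Submodule.mem_sup_right (add_mem
        (Submodule.mem_sup_left ⟨_, (mul_mem_serreImage hv j).2, rfl⟩)
        (Submodule.mem_sup_right (mul_mem_serreImage hw j).2)))

end IsCartanTriple

/-! ### Induced modules over the free associative algebra -/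

section Induced

variable {k : Type*} [Field k] {r : ℕ} {Y : Type*} [AddCommGroup Y] [Module k Y]

/-- Left multiplication by a generator on the free module `k⟨x_1, …, x_r⟩ ⊗ Y`. -/
noncomputable def genMul (k : Type*) [Field k] {r : ℕ} (Y : Type*) [AddCommGroup Y] [Module k Y]
    (i : Fin r) : Module.End k (FreeAlgebra k (Fin r) ⊗[k] Y) :=
  (LinearMap.mulLeft k (FreeAlgebra.ι k i)).rTensor Y

theorem genMul_tmul (i : Fin r) (a : FreeAlgebra k (Fin r)) (y : Y) :
    genMul k Y i (a ⊗ₜ[k] y) = (FreeAlgebra.ι k i * a) ⊗ₜ[k] y := rfl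

theorem lift_genMul (a b : FreeAlgebra k (Fin r)) (y : Y) :
    FreeAlgebra.lift k (genMul k Y) a (b ⊗ₜ[k] y) = (a * b) ⊗ₜ[k] y := by
  induction a using FreeAlgebra.induction generalizing b with
  | grade0 c =>
    rw [AlgHom.commutes, Module.algebraMap_end_apply, ← Algebra.smul_def, TensorProduct.smul_tmul']
  | grade1 i => rw [FreeAlgebra.lift_ι_apply, genMul_tmul]
  | mul a a' h h' => rw [map_mul, Module.End.mul_apply, h', h, mul_assoc]
  | add a a' h h' => rw [map_add, LinearMap.add_apply, h, h', add_mul, TensorProduct.add_tmul]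

theorem genMul_induction {N : Submodule k (FreeAlgebra k (Fin r) ⊗[k] Y)}
    (h1 : ∀ y, (1 : FreeAlgebra k (Fin r)) ⊗ₜ[k] y ∈ N)
    (hN : ∀ i, ∀ v ∈ N, genMul k Y i v ∈ N) (v : FreeAlgebra k (Fin r) ⊗[k] Y) : v ∈ N := by
  induction v using TensorProduct.induction_on with
  | zero => exact zero_mem _
  | add x y hx hy => exact add_mem hx hy
  | tmul a y =>
    have h := freeAlgebra_mul_mem_left
      (N := N.comap ((TensorProduct.mk k (FreeAlgebra k (Fin r)) Y).flip y))
      (fun i x hx => hN i _ hx) a 1 (h1 y)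
    simpa using h

/-- Recursive definition of an operator on a free module over the free associative algebra. -/
theorem exists_recursive_end (g : Y →ₗ[k] FreeAlgebra k (Fin r) ⊗[k] Y)
    (C D : Fin r → Module.End k (FreeAlgebra k (Fin r) ⊗[k] Y)) :
    ∃ F : Module.End k (FreeAlgebra k (Fin r) ⊗[k] Y), (∀ y, F (1 ⊗ₜ y) = g y) ∧
      ∀ j v, F (genMul k Y j v) = C j (F v) + D j v := by
  let V := FreeAlgebra k (Fin r) ⊗[k] Y
  -- The letters act on pairs by the block triangular matrices with rows $(C_j,D_j)$ and $(0,x_j)$.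
  -- Starting from $(g(y),1\otimes y)$, the second entry records the vector and the first is the
  -- value of the recursion on it.
  let ρ : FreeAlgebra k (Fin r) →ₐ[k] Module.End k (V × V) := FreeAlgebra.lift k fun j =>
    LinearMap.prod (C j ∘ₗ LinearMap.fst k V V + D j ∘ₗ LinearMap.snd k V V)
      (genMul k Y j ∘ₗ LinearMap.snd k V V)
  have hρ : ∀ j z, ρ (FreeAlgebra.ι k j) z = (C j z.1 + D j z.2, genMul k Y j z.2) := by
    intro j z
    simp [ρ]
  have h2 : ∀ a z, (ρ a z).2 = FreeAlgebra.lift k (genMul k Y) a z.2 := by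
    intro a
    induction a using FreeAlgebra.induction with
    | grade0 c => intro z; simp
    | grade1 i => intro z; rw [hρ, FreeAlgebra.lift_ι_apply]
    | mul a a' h h' => intro z; rw [map_mul, map_mul, Module.End.mul_apply, Module.End.mul_apply,
        h, h']
    | add a a' h h' => intro z; rw [map_add, map_add, LinearMap.add_apply, LinearMap.add_apply,
        Prod.snd_add, h, h']
  let F : V →ₗ[k] V := TensorProduct.lift (LinearMap.mk₂ k
    (fun a y => (ρ a (g y, (1 : FreeAlgebra k (Fin r)) ⊗ₜ[k] y)).1)
    (fun a b y => by simp) (fun c a y => by simp)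
    (fun a y z => by
      rw [← Prod.fst_add, ← map_add, Prod.mk_add_mk, map_add, TensorProduct.tmul_add])
    (fun c a y => by
      rw [← Prod.smul_fst, ← map_smul, Prod.smul_mk, map_smul, TensorProduct.tmul_smul]))
  have hF : ∀ a y, F (a ⊗ₜ[k] y) = (ρ a (g y, (1 : FreeAlgebra k (Fin r)) ⊗ₜ[k] y)).1 :=
    fun a y => rfl
  refine ⟨F, fun y => by rw [hF, map_one, Module.End.one_apply], fun j v => ?_⟩
  induction v using TensorProduct.induction_on with
  | zero => simp
  | add x y hx hy => simp only [map_add, hx, hy]; abel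
  | tmul a y =>
    rw [genMul_tmul, hF, hF, map_mul, Module.End.mul_apply, hρ, h2, lift_genMul, mul_one]

/-- The module induced from a module over the subalgebra generated by the `h_i` and the `f_i`. -/
theorem exists_induced_triple (a : Fin r → Fin r → k) (τ : Finset (Fin r))
    (h' f' : Fin r → Module.End k Y) (hh : ∀ i j, h' i * h' j = h' j * h' i)
    (hf : ∀ i j, h' i * f' j = f' j * h' i - a i j • f' j) :
    ∃ h f : Fin r → Module.End k (FreeAlgebra k (Fin r) ⊗[k] Y),
      IsCartanTriple a τ (genMul k Y) h f ∧ (∀ i y, h i (1 ⊗ₜ y) = 1 ⊗ₜ h' i y) ∧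
        (∀ i y, f i (1 ⊗ₜ y) = 1 ⊗ₜ f' i y) := by
  let one : Y →ₗ[k] FreeAlgebra k (Fin r) ⊗[k] Y := TensorProduct.mk k _ Y 1
  -- The recursion is dictated by the relations between $e_j$ and $h_i,f_i$, which therefore hold by
  -- construction. The relations among the $h_i$ and $f_i$ are given on $1\otimes Y$ and propagate
  -- by induction over left multiplication.
  choose h h1 h2 using fun i => exists_recursive_end (one ∘ₗ h' i) (genMul k Y)
    (fun j => a i j • genMul k Y j)
  let κ : Fin r → Fin r → k := fun j i => koszulSign k (indexParity τ j) (indexParity τ i)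
  choose f f1 f2 using fun i => exists_recursive_end (one ∘ₗ f' i)
    (fun j => κ j i • genMul k Y j) (fun j => if j = i then -κ j i • h i else 0)
  have hκ : ∀ i j, κ i j * κ i j = 1 := fun i j => koszulSign_mul_self k _ _
  have e1 : ∀ i j v, h i (h j v) = h j (h i v) := by
    intro i j v
    have := genMul_induction (N := LinearMap.ker (h i * h j - h j * h i)) (fun y => ?_)
      (fun l v hv => ?_) v
    · simpa [sub_eq_zero] using this
    · have := LinearMap.congr_fun (hh i j) y
      simp only [Module.End.mul_apply] at this
      simp [h1, one, this]
    · simp only [LinearMap.mem_ker, LinearMap.sub_apply, Module.End.mul_apply, h2, map_add,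
        LinearMap.smul_apply, map_smul] at hv ⊢
      rw [sub_eq_zero.1 hv]
      module
  refine ⟨h, f, ⟨fun i j => LinearMap.ext (e1 i j), fun i j => ?_, fun i j => ?_, fun i j => ?_⟩,
    h1, f1⟩
  · refine LinearMap.ext fun v => ?_
    have h3 := f2 j i v
    by_cases hij : i = j
    · subst hij
      have hk := hκ i i
      simp only [if_true, LinearMap.smul_apply] at h3 ⊢
      simp only [LinearMap.sub_apply, LinearMap.smul_apply, Module.End.mul_apply, h3]
      match_scalars
      · linear_combination -hk
      · linear_combination hk
    · have hk := hκ i j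
      simp only [if_neg hij, LinearMap.smul_apply, LinearMap.zero_apply, add_zero] at h3 ⊢
      simp only [LinearMap.sub_apply, LinearMap.smul_apply, Module.End.mul_apply, h3]
      match_scalars
      linear_combination -hk
  · refine LinearMap.ext fun v => ?_
    simp [h2]
  · refine LinearMap.ext fun v => ?_
    have := genMul_induction (N := LinearMap.ker (h i * f j - (f j * h i - a i j • f j)))
      (fun y => ?_) (fun l v hv => ?_) v
    · simpa [sub_eq_zero] using this
    · have := LinearMap.congr_fun (hf i j) y
      simp only [Module.End.mul_apply, LinearMap.sub_apply, LinearMap.smul_apply] at this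
      simp [h1, f1, one, this, TensorProduct.tmul_sub]
    · simp only [LinearMap.mem_ker, LinearMap.sub_apply, Module.End.mul_apply, h2, f2, map_add,
        LinearMap.smul_apply, map_smul] at hv ⊢
      have hv' := sub_eq_zero.1 hv
      by_cases hlj : l = j
      · subst hlj
        simp only [if_true, LinearMap.smul_apply, map_smul, hv', e1 i l v, map_sub]
        module
      · simp only [if_neg hlj, LinearMap.zero_apply, map_zero, hv', map_sub, map_smul]
        module

end Induced

/-! ### The module for the Cartan and lowering operators -/

section Lower

variable {R : Type*} [CommRing R] {r : ℕ} (k : Type*) [Field k] [Algebra R k]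
  (A : Matrix (Fin r) (Fin r) R) (τ : Finset (Fin r))

/-- The quotient of the free associative algebra by the Serre ideal. -/
abbrev SerreQuot : Type _ := FreeAlgebra k (Fin r) ⧸ serreSpan k A τ

/-- Left multiplication by a generator on `SerreQuot k A τ`. -/
noncomputable def serreQuotMul (j : Fin r) : Module.End k (SerreQuot k A τ) :=
  (serreSpan k A τ).mapQ (serreSpan k A τ) (LinearMap.mulLeft k (FreeAlgebra.ι k j))
    (fun _ hx => mul_mem_serreSpan_left _ hx)

theorem lift_serreQuotMul (x b : FreeAlgebra k (Fin r)) :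
    FreeAlgebra.lift k (serreQuotMul k A τ) x ((serreSpan k A τ).mkQ b) =
      (serreSpan k A τ).mkQ (x * b) := by
  induction x using FreeAlgebra.induction generalizing b with
  | grade0 c => rw [AlgHom.commutes, Module.algebraMap_end_apply, ← Algebra.smul_def, map_smul]
  | grade1 i => rw [FreeAlgebra.lift_ι_apply]; rfl
  | mul a a' h h' => rw [map_mul, Module.End.mul_apply, h', h, mul_assoc]
  | add a a' h h' => rw [map_add, LinearMap.add_apply, h, h', add_mul, map_add]


/-- The translation of the variables by a vector. -/
noncomputable def polyShift (w : Fin r → k) :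
    MvPolynomial (Fin r) k →ₐ[k] MvPolynomial (Fin r) k :=
  MvPolynomial.aeval (fun i => MvPolynomial.X i + MvPolynomial.C (w i))

theorem polyShift_zero : polyShift k (0 : Fin r → k) = AlgHom.id k _ := by
  ext i; simp [polyShift]

theorem polyShift_add (v w : Fin r → k) :
    polyShift k (v + w) = (polyShift k v).comp (polyShift k w) := by
  ext1 i
  simp [polyShift, add_assoc]

/-- The action of `h_i` on the lower half. -/
noncomputable def lowerH (i : Fin r) :
    Module.End k (MvPolynomial (Fin r) k ⊗[k] SerreQuot k A τ) :=
  (LinearMap.mulLeft k (MvPolynomial.X i)).rTensor _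

/-- The action of `f_j` on the lower half. -/
noncomputable def lowerF (j : Fin r) :
    Module.End k (MvPolynomial (Fin r) k ⊗[k] SerreQuot k A τ) :=
  TensorProduct.map (polyShift k (fun i => algebraMap R k (A i j))).toLinearMap
    (serreQuotMul k A τ j)

theorem lowerH_comm (i j : Fin r) :
    lowerH k A τ i * lowerH k A τ j = lowerH k A τ j * lowerH k A τ i := by
  refine TensorProduct.ext' fun p q => ?_
  simp [lowerH, mul_left_comm]

/-- The relation reads $f_jh_i=(h_i+a_{ij})f_j$, that is, $f_j\,p(h)=p(h+a_{\cdot j})f_j$. Hence the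
shift of variables in `lowerF`. -/
theorem lowerH_lowerF (i j : Fin r) :
    lowerH k A τ i * lowerF k A τ j =
      lowerF k A τ j * lowerH k A τ i - algebraMap R k (A i j) • lowerF k A τ j := by
  refine TensorProduct.ext' fun p q => ?_
  have : MvPolynomial.C (algebraMap R k (A i j)) *
      polyShift k (fun i => algebraMap R k (A i j)) p =
      algebraMap R k (A i j) • polyShift k (fun i => algebraMap R k (A i j)) p := by
    rw [MvPolynomial.smul_eq_C_mul]
  have h2 : polyShift k (fun i => algebraMap R k (A i j)) (MvPolynomial.X i) =
      MvPolynomial.X i + MvPolynomial.C (algebraMap R k (A i j)) := by simp [polyShift]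
  simp only [lowerH, lowerF, Module.End.mul_apply, LinearMap.sub_apply, LinearMap.smul_apply,
    TensorProduct.map_tmul, LinearMap.rTensor_tmul, LinearMap.mulLeft_apply,
    AlgHom.toLinearMap_apply, map_mul, h2, add_mul, this, TensorProduct.add_tmul,
    ← TensorProduct.smul_tmul', add_sub_cancel_right]

variable {k A τ}

/-- The shifts of the letters of a word add up to its weight, so a homogeneous element acts by one
shift tensored with left multiplication. The Serre relations are homogeneous and act by zero on
$F/I$, so they act by zero here too. -/
theorem lift_lowerF_of_mem_wordSpan {m : Fin r → k} {x : FreeAlgebra k (Fin r)}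
    (hx : x ∈ wordSpan k (fun j i => algebraMap R k (A i j)) m) :
    FreeAlgebra.lift k (lowerF k A τ) x = TensorProduct.map (polyShift k m).toLinearMap
      (FreeAlgebra.lift k (serreQuotMul k A τ) x) := by
  induction hx using Submodule.span_induction with
  | mem w hw =>
    obtain ⟨l, rfl, rfl⟩ := hw
    induction l with
    | nil =>
      simp only [List.map_nil, List.prod_nil, List.sum_nil, map_one, polyShift_zero]
      exact TensorProduct.map_id.symm
    | cons i l ih =>
      simp only [List.map_cons, List.prod_cons, List.sum_cons, map_mul, FreeAlgebra.lift_ι_apply,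
        ih, polyShift_add]
      exact (TensorProduct.map_comp _ _ _ _).symm
  | zero => rw [map_zero, map_zero, TensorProduct.map_zero_right]
  | add x y _ _ hx hy => rw [map_add, map_add, hx, hy, TensorProduct.map_add_right]
  | smul c x _ hx => rw [map_smul, map_smul, hx, TensorProduct.map_smul_right]

theorem lift_lowerF_eq_zero {x : FreeAlgebra k (Fin r)} (hx : x ∈ serreSpan k A τ) :
    FreeAlgebra.lift k (lowerF k A τ) x = 0 := by
  refine serreSpan_le (N := LinearMap.ker (FreeAlgebra.lift k (lowerF k A τ)).toLinearMap)
    (fun θ hθ => ?_) (fun i x hx => ?_) (fun i x hx => ?_) hx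
  · obtain ⟨m, hm⟩ := hθ.homogeneous (fun j i => algebraMap R k (A i j))
    have h : FreeAlgebra.lift k (serreQuotMul k A τ) θ = 0 := by
      refine LinearMap.ext fun q => ?_
      obtain ⟨b, rfl⟩ := (serreSpan k A τ).mkQ_surjective q
      rw [lift_serreQuotMul, LinearMap.zero_apply, Submodule.mkQ_apply,
        Submodule.Quotient.mk_eq_zero]
      exact mul_mem_serreSpan_right _ hθ.mem_serreSpan
    rw [LinearMap.mem_ker, AlgHom.toLinearMap_apply, lift_lowerF_of_mem_wordSpan hm, h,
      TensorProduct.map_zero_right]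
  · rw [LinearMap.mem_ker, AlgHom.toLinearMap_apply] at hx ⊢
    rw [map_mul, hx, mul_zero]
  · rw [LinearMap.mem_ker, AlgHom.toLinearMap_apply] at hx ⊢
    rw [map_mul, hx, zero_mul]

end Lower

theorem exists_descended_end {k V W : Type*} [Field k] [AddCommGroup V] [Module k V]
    [AddCommGroup W] [Module k W] {π : V →ₗ[k] W} (hπ : Function.Surjective π)
    (F : Module.End k V) (hF : ∀ v, π v = 0 → π (F v) = 0) :
    ∃ F' : Module.End k W, ∀ v, F' (π v) = π (F v) := by
  let s := Function.surjInv hπ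
  have hs : ∀ w, π (s w) = w := Function.surjInv_eq hπ
  have key : ∀ u v, π u = π v → π (F u) = π (F v) := by
    intro u v h
    have := hF (u - v) (by rw [map_sub, h, sub_self])
    rwa [map_sub, map_sub, sub_eq_zero] at this
  refine ⟨{ toFun := fun w => π (F (s w)), map_add' := fun u v => ?_, map_smul' := fun c v => ?_ },
    fun v => key _ _ (hs _)⟩
  · rw [← map_add, ← map_add]
    exact key _ _ (by rw [map_add, hs, hs, hs])
  · rw [RingHom.id_apply, ← map_smul, ← map_smul]
    exact key _ _ (by rw [map_smul, hs, hs])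

/-! ### The triangular representation -/

section Representation

variable {R : Type*} [CommRing R] {r : ℕ} {k : Type*} [Field k] [Algebra R k]
  {A : Matrix (Fin r) (Fin r) R} {τ : Finset (Fin r)} {Y : Type*} [AddCommGroup Y] [Module k Y]
  {h f : Fin r → Module.End k (FreeAlgebra k (Fin r) ⊗[k] Y)}

/-- The vectors killed by the Serre ideal in the $f_i$ contain $1\otimes Y$. They are stable under
$e_l$: by `mul_f_mem` for the swapped triple, $x(f)\,e_l$ is a sum of products whose right factors
are again in that ideal. So every vector is killed. -/
theorem lift_f_eq_zero [CharZero R] (h2 : (2 : k) ≠ 0) (hA : IsSuperGCM A τ)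
    (t : IsCartanTriple (fun i j => algebraMap R k (A i j)) τ (genMul k Y) h f)
    {f' : Fin r → Module.End k Y} (hf : ∀ i y, f i (1 ⊗ₜ y) = 1 ⊗ₜ f' i y)
    (hf' : ∀ x ∈ serreSpan k A τ, FreeAlgebra.lift k f' x = 0) {x : FreeAlgebra k (Fin r)}
    (hx : x ∈ serreSpan k A τ) : FreeAlgebra.lift k f x = 0 := by
  have h1 : ∀ x y, FreeAlgebra.lift k f x ((1 : FreeAlgebra k (Fin r)) ⊗ₜ[k] y) =
      1 ⊗ₜ FreeAlgebra.lift k f' x y := by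
    intro x
    induction x using FreeAlgebra.induction with
    | grade0 c => intro y; simp
    | grade1 i => intro y; rw [FreeAlgebra.lift_ι_apply, FreeAlgebra.lift_ι_apply, hf]
    | mul a a' h h' => intro y; rw [map_mul, map_mul, Module.End.mul_apply, h', h,
        Module.End.mul_apply]
    | add a a' h h' => intro y; rw [map_add, map_add, LinearMap.add_apply, h', h,
        LinearMap.add_apply, TensorProduct.tmul_add]
  let N : Submodule k (FreeAlgebra k (Fin r) ⊗[k] Y) :=
    ⨅ x : serreSpan k A τ, LinearMap.ker (FreeAlgebra.lift k f (x : FreeAlgebra k (Fin r)))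
  have hN : ∀ v, v ∈ N ↔ ∀ x ∈ serreSpan k A τ, FreeAlgebra.lift k f x v = 0 := by
    intro v
    simp [N]
  have key : ∀ v, v ∈ N := by
    refine genMul_induction (fun y => (hN _).2 fun x hx => ?_) (fun l v hv => (hN _).2 ?_)
    · rw [h1, hf' x hx, LinearMap.zero_apply, TensorProduct.tmul_zero]
    · intro x hx
      have h3 := t.swap.mul_f_mem h2 hA l hx
      rw [hN] at hv
      obtain ⟨_, ⟨_, ⟨a, ha, rfl⟩, rfl⟩, y, hy, e⟩ := Submodule.mem_sup.1 h3
      obtain ⟨_, ⟨_, ⟨b, hb, rfl⟩, rfl⟩, _, ⟨c, hc, rfl⟩, rfl⟩ := Submodule.mem_sup.1 hy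
      have e' := LinearMap.congr_fun e v
      simp only [LinearMap.add_apply, LinearMap.mulLeft_apply, Module.End.mul_apply,
        AlgHom.toLinearMap_apply, hv a ha, hv b hb, hv c hc, map_zero, add_zero,
        LinearMap.smul_apply, map_smul] at e'
      exact (smul_eq_zero.1 e'.symm).resolve_left (koszulSign_ne_zero k _ _)
  exact LinearMap.ext fun v => (hN v).1 (key v) x hx

/-- The projection from the induced module to its quotient by the Serre ideal. -/
noncomputable abbrev serreProj (A : Matrix (Fin r) (Fin r) R) (τ : Finset (Fin r)) (Y : Type*)
    [AddCommGroup Y] [Module k Y] :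
    FreeAlgebra k (Fin r) ⊗[k] Y →ₗ[k] SerreQuot k A τ ⊗[k] Y :=
  (serreSpan k A τ).mkQ.rTensor Y

/-- By right exactness of the tensor product, the kernel is the image of $I\otimes Y$. -/
theorem mem_ker_serreProj_induction {N : Submodule k (FreeAlgebra k (Fin r) ⊗[k] Y)}
    (hN : ∀ x ∈ serreSpan k A τ, ∀ y, x ⊗ₜ[k] y ∈ N) {v : FreeAlgebra k (Fin r) ⊗[k] Y}
    (hv : serreProj A τ Y v = 0) : v ∈ N := by
  obtain ⟨w, rfl⟩ := (rTensor_exact Y (LinearMap.exact_subtype_mkQ (serreSpan k A τ))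
    (serreSpan k A τ).mkQ_surjective v).1 hv
  induction w using TensorProduct.induction_on with
  | zero => simp
  | add x y hx hy =>
    rw [map_add] at hv ⊢
    refine add_mem (hx ?_) (hy ?_) <;>
    exact (rTensor_exact Y (LinearMap.exact_subtype_mkQ (serreSpan k A τ))
      (serreSpan k A τ).mkQ_surjective _).2 ⟨_, rfl⟩
  | tmul x y => exact hN x x.2 y

theorem serreProj_serreImage {z : Module.End k (FreeAlgebra k (Fin r) ⊗[k] Y)}
    (hz : z ∈ IsCartanTriple.serreImage k A τ (genMul k Y)) (v : FreeAlgebra k (Fin r) ⊗[k] Y) :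
    serreProj A τ Y (z v) = 0 := by
  obtain ⟨x, hx, rfl⟩ := hz
  induction v using TensorProduct.induction_on with
  | zero => simp
  | add x y hx hy => rw [map_add, map_add, hx, hy, add_zero]
  | tmul a y =>
    rw [AlgHom.toLinearMap_apply, lift_genMul, LinearMap.rTensor_tmul, Submodule.mkQ_apply,
      (Submodule.Quotient.mk_eq_zero _).2 (mul_mem_serreSpan_right a hx), TensorProduct.zero_tmul]

theorem tmul_eq_lift_genMul (x : FreeAlgebra k (Fin r)) (y : Y) :
    x ⊗ₜ[k] y = FreeAlgebra.lift k (genMul k Y) x (1 ⊗ₜ y) := by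
  rw [lift_genMul, mul_one]

theorem serreProj_genMul (i : Fin r) (v : FreeAlgebra k (Fin r) ⊗[k] Y)
    (hv : serreProj A τ Y v = 0) : serreProj A τ Y (genMul k Y i v) = 0 := by
  refine mem_ker_serreProj_induction (A := A) (τ := τ)
    (N := LinearMap.ker (serreProj A τ Y ∘ₗ genMul k Y i)) (fun x hx y => ?_) hv
  rw [LinearMap.mem_ker, LinearMap.comp_apply, genMul_tmul, LinearMap.rTensor_tmul,
    Submodule.mkQ_apply, (Submodule.Quotient.mk_eq_zero _).2 (mul_mem_serreSpan_left _ hx),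
    TensorProduct.zero_tmul]

theorem serreProj_h (t : IsCartanTriple (fun i j => algebraMap R k (A i j)) τ (genMul k Y) h f)
    (i : Fin r) (v : FreeAlgebra k (Fin r) ⊗[k] Y)
    (hv : serreProj A τ Y v = 0) : serreProj A τ Y (h i v) = 0 := by
  refine mem_ker_serreProj_induction (A := A) (τ := τ)
    (N := LinearMap.ker (serreProj A τ Y ∘ₗ h i)) (fun x hx y => ?_) hv
  have h1 := t.serreImage_comm_h i (x := FreeAlgebra.lift k (genMul k Y) x) ⟨x, hx, rfl⟩
  have h3 := serreProj_serreImage h1 ((1 : FreeAlgebra k (Fin r)) ⊗ₜ[k] y)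
  rw [LinearMap.sub_apply, map_sub, Module.End.mul_apply, Module.End.mul_apply,
    serreProj_serreImage (z := FreeAlgebra.lift k (genMul k Y) x) ⟨x, hx, rfl⟩, sub_zero,
    ← tmul_eq_lift_genMul] at h3
  exact h3

/-- Regard $x\otimes y$ as the operator $x(e)$ applied to $1\otimes y$ and move $f_i$ past it by
`f_mul_mem`. Each resulting term begins with an element of $I$, or with $h_i$ followed by one. -/
theorem serreProj_f [CharZero R] (h2 : (2 : k) ≠ 0) (hA : IsSuperGCM A τ)
    (t : IsCartanTriple (fun i j => algebraMap R k (A i j)) τ (genMul k Y) h f)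
    (i : Fin r) (v : FreeAlgebra k (Fin r) ⊗[k] Y)
    (hv : serreProj A τ Y v = 0) : serreProj A τ Y (f i v) = 0 := by
  refine mem_ker_serreProj_induction (A := A) (τ := τ)
    (N := LinearMap.ker (serreProj A τ Y ∘ₗ f i)) (fun x hx y => ?_) hv
  obtain ⟨_, ⟨a, ha, rfl⟩, w, hw, e⟩ := Submodule.mem_sup.1 (t.f_mul_mem h2 hA i hx)
  obtain ⟨_, ⟨b, hb, rfl⟩, c, hc, rfl⟩ := Submodule.mem_sup.1 hw
  have e' := LinearMap.congr_fun e ((1 : FreeAlgebra k (Fin r)) ⊗ₜ[k] y)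
  rw [Module.End.mul_apply, ← tmul_eq_lift_genMul] at e'
  rw [LinearMap.mem_ker, LinearMap.comp_apply, ← e', LinearMap.add_apply, LinearMap.add_apply,
    map_add, map_add, serreProj_serreImage hc, LinearMap.mulRight_apply, LinearMap.mulLeft_apply,
    Module.End.mul_apply, Module.End.mul_apply, serreProj_serreImage ha,
    serreProj_h t i _ (serreProj_serreImage hb _)]
  simp

/-- The quotient of an induced module by the Serre ideal. -/
theorem exists_quotient_triple [CharZero R] (h2 : (2 : k) ≠ 0) (hA : IsSuperGCM A τ)
    (t : IsCartanTriple (fun i j => algebraMap R k (A i j)) τ (genMul k Y) h f) :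
    ∃ e' h' f' : Fin r → Module.End k (SerreQuot k A τ ⊗[k] Y),
      IsCartanTriple (fun i j => algebraMap R k (A i j)) τ e' h' f' ∧
      (∀ x v, FreeAlgebra.lift k e' x (serreProj A τ Y v) =
        serreProj A τ Y (FreeAlgebra.lift k (genMul k Y) x v)) ∧
      (∀ i v, h' i (serreProj A τ Y v) = serreProj A τ Y (h i v)) ∧
      (∀ x v, FreeAlgebra.lift k f' x (serreProj A τ Y v) =
        serreProj A τ Y (FreeAlgebra.lift k f x v)) := by
  have hπ : Function.Surjective (serreProj A τ Y) :=
    LinearMap.rTensor_surjective _ (serreSpan k A τ).mkQ_surjective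
  choose e' he' using fun i => exists_descended_end hπ (genMul k Y i) (serreProj_genMul i)
  choose h' hh' using fun i => exists_descended_end hπ (h i) (serreProj_h t i)
  choose f' hf' using fun i => exists_descended_end hπ (f i) (serreProj_f h2 hA t i)
  have lift_desc : ∀ {g : Fin r → Module.End k (FreeAlgebra k (Fin r) ⊗[k] Y)}
      {g' : Fin r → Module.End k (SerreQuot k A τ ⊗[k] Y)},
      (∀ i v, g' i (serreProj A τ Y v) = serreProj A τ Y (g i v)) → ∀ x v,
        FreeAlgebra.lift k g' x (serreProj A τ Y v) =
          serreProj A τ Y (FreeAlgebra.lift k g x v) := by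
    intro g g' hg x
    induction x using FreeAlgebra.induction with
    | grade0 c => intro v; simp
    | grade1 i => intro v; rw [FreeAlgebra.lift_ι_apply, FreeAlgebra.lift_ι_apply, hg]
    | mul a a' h h' => intro v; rw [map_mul, map_mul, Module.End.mul_apply, h', h,
        Module.End.mul_apply]
    | add a a' h h' => intro v; rw [map_add, map_add, LinearMap.add_apply, h', h,
        LinearMap.add_apply, map_add]
  have ext : ∀ {F G : Module.End k (SerreQuot k A τ ⊗[k] Y)},
      (∀ v, F (serreProj A τ Y v) = G (serreProj A τ Y v)) → F = G := by
    intro F G hFG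
    refine LinearMap.ext fun w => ?_
    obtain ⟨v, rfl⟩ := hπ w
    exact hFG v
  refine ⟨e', h', f', ⟨fun i j => ext fun v => ?_, fun i j => ext fun v => ?_,
    fun i j => ext fun v => ?_, fun i j => ext fun v => ?_⟩, lift_desc he', hh', lift_desc hf'⟩
  · have := LinearMap.congr_fun (t.hh i j) v
    simp only [Module.End.mul_apply] at this
    simp only [Module.End.mul_apply, hh', this]
  · have := congrArg (serreProj A τ Y) (LinearMap.congr_fun (t.ef i j) v)
    simp only [Module.End.mul_apply, LinearMap.sub_apply, LinearMap.smul_apply, map_sub,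
      map_smul] at this
    simp only [Module.End.mul_apply, LinearMap.sub_apply, LinearMap.smul_apply, he', hf', this]
    split_ifs
    · rw [hh']
    · simp
  · have := LinearMap.congr_fun (t.eh i j) v
    simp only [Module.End.mul_apply, LinearMap.add_apply, LinearMap.smul_apply] at this
    simp only [Module.End.mul_apply, LinearMap.add_apply, LinearMap.smul_apply, he', hh',
      this, map_add, map_smul]
  · have := LinearMap.congr_fun (t.hf i j) v
    simp only [Module.End.mul_apply, LinearMap.sub_apply, LinearMap.smul_apply] at this
    simp only [Module.End.mul_apply, LinearMap.sub_apply, LinearMap.smul_apply, hf', hh',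
      this, map_sub, map_smul]

/-- The representation on the tensor product of the three factors in which the Chevalley
generators act as they do on the enveloping algebra by left multiplication. -/
theorem exists_triangular_rep [CharZero R] (h2 : (2 : k) ≠ 0) (hA : IsSuperGCM A τ) :
    ∃ e h f : Fin r → Module.End k
        (SerreQuot k A τ ⊗[k] (MvPolynomial (Fin r) k ⊗[k] SerreQuot k A τ)),
      IsCartanTriple (fun i j => algebraMap R k (A i j)) τ e h f ∧
      (∀ x ∈ serreSpan k A τ, FreeAlgebra.lift k e x = 0) ∧
      (∀ x ∈ serreSpan k A τ, FreeAlgebra.lift k f x = 0) ∧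
      (∀ x y, FreeAlgebra.lift k e x ((serreSpan k A τ).mkQ 1 ⊗ₜ y) =
        (serreSpan k A τ).mkQ x ⊗ₜ y) ∧
      (∀ i p q, h i ((serreSpan k A τ).mkQ 1 ⊗ₜ (p ⊗ₜ q)) =
        (serreSpan k A τ).mkQ 1 ⊗ₜ ((MvPolynomial.X i * p) ⊗ₜ q)) ∧
      (∀ x, FreeAlgebra.lift k f x ((serreSpan k A τ).mkQ 1 ⊗ₜ (1 ⊗ₜ (serreSpan k A τ).mkQ 1)) =
        (serreSpan k A τ).mkQ 1 ⊗ₜ (1 ⊗ₜ (serreSpan k A τ).mkQ x)) := by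
  obtain ⟨h, f, t, hh, hf⟩ := exists_induced_triple (fun i j => algebraMap R k (A i j)) τ
    (lowerH k A τ) (lowerF k A τ) (lowerH_comm k A τ) (lowerH_lowerF k A τ)
  obtain ⟨e', h', f', t', he', hh', hf'⟩ := exists_quotient_triple h2 hA t
  have hπ : Function.Surjective
      (serreProj A τ (MvPolynomial (Fin r) k ⊗[k] SerreQuot k A τ)) :=
    LinearMap.rTensor_surjective _ (serreSpan k A τ).mkQ_surjective
  refine ⟨e', h', f', t', fun x hx => LinearMap.ext fun w => ?_,
    fun x hx => LinearMap.ext fun w => ?_, fun x y => ?_, fun i p q => ?_, fun x => ?_⟩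
  · obtain ⟨v, rfl⟩ := hπ w
    rw [he', LinearMap.zero_apply]
    exact serreProj_serreImage ⟨x, hx, rfl⟩ v
  · obtain ⟨v, rfl⟩ := hπ w
    rw [hf', lift_f_eq_zero h2 hA t hf (fun x hx => lift_lowerF_eq_zero hx) hx,
      LinearMap.zero_apply, LinearMap.zero_apply, map_zero]
  · have h3 := he' x (1 ⊗ₜ y)
    rwa [lift_genMul, mul_one] at h3
  · have h3 := hh' i (1 ⊗ₜ (p ⊗ₜ q))
    rwa [hh] at h3
  · have h3 := hf' x (1 ⊗ₜ (1 ⊗ₜ (serreSpan k A τ).mkQ 1))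
    have h4 : ∀ x : FreeAlgebra k (Fin r), ∀ b, FreeAlgebra.lift k f x
        (1 ⊗ₜ (1 ⊗ₜ (serreSpan k A τ).mkQ b)) = 1 ⊗ₜ (1 ⊗ₜ (serreSpan k A τ).mkQ (x * b)) := by
      intro x
      induction x using FreeAlgebra.induction with
      | grade0 c =>
        intro b
        rw [AlgHom.commutes, Module.algebraMap_end_apply, ← Algebra.smul_def, map_smul,
          TensorProduct.tmul_smul, TensorProduct.tmul_smul]
      | grade1 i =>
        intro b
        rw [FreeAlgebra.lift_ι_apply, hf, lowerF, TensorProduct.map_tmul,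
          AlgHom.toLinearMap_apply, map_one]
        rfl
      | mul a a' h h' => intro b; rw [map_mul, Module.End.mul_apply, h', h, mul_assoc]
      | add a a' h h' =>
        intro b
        rw [map_add, LinearMap.add_apply, h, h', add_mul, map_add, TensorProduct.tmul_add,
          TensorProduct.tmul_add]
    rwa [h4, mul_one] at h3

end Representation

/-! ### Generators and universal property of enveloping algebras -/

namespace LieSuperalgebra

variable {k L : Type*} [Field k] [AddCommGroup L] [Module k L] (G : LieSuperalgebra k L)

theorem adjoin_range_toEnv : Algebra.adjoin k (Set.range G.toEnv) = ⊤ := by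
  have h1 : (Algebra.adjoin k (Set.range (TensorAlgebra.ι k (M := L)))).map
      (RingQuot.mkAlgHom k G.EnvRel) = ⊤ := by
    rw [TensorAlgebra.adjoin_range_ι, Algebra.map_top, AlgHom.range_eq_top]
    exact RingQuot.mkAlgHom_surjective k _
  rw [AlgHom.map_adjoin, ← Set.range_comp] at h1
  exact h1

/-- The elements of the subalgebra whose images lie in `B` are closed under brackets, because a
bracket becomes a supercommutator in the enveloping algebra. So $U$ of a generated subalgebra is
generated by the same elements. -/
theorem toEnv_mem_of_subGen {S : Set L} (hS : ∀ s ∈ S, ∃ a, s ∈ G.grade a)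
    {B : Subalgebra k (G.subGen S).toLie.Env}
    (hB : ∀ s (hs : s ∈ S), (G.subGen S).toLie.toEnv ⟨s, subset_subGen G S hs⟩ ∈ B) : B = ⊤ := by
  have key : (G.subGen S).carrier ≤
      ((Subalgebra.toSubmodule B).comap (G.subGen S).toLie.toEnv).map (G.subGen S).carrier.subtype := by
    refine G.subGen_le (fun s hs => ⟨⟨⟨s, subset_subGen G S hs⟩, hB s hs, rfl⟩, hS s hs⟩) ?_
    rintro a b _ _ hx hy ⟨x, hx', rfl⟩ ⟨y, hy', rfl⟩
    refine ⟨(G.subGen S).toLie.br x y, ?_, rfl⟩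
    have h := (G.subGen S).toLie.toEnv_br (x := x) (y := y) hx hy
    simp only [SetLike.mem_coe, Submodule.mem_comap, Subalgebra.mem_toSubmodule] at hx' hy' ⊢
    rw [← h]
    exact sub_mem (mul_mem hx' hy') (Subalgebra.smul_mem _ (mul_mem hy' hx') _)
  rw [eq_top_iff, ← adjoin_range_toEnv, Algebra.adjoin_le_iff]
  rintro _ ⟨x, rfl⟩
  obtain ⟨y, hy, e⟩ := key x.2
  have : y = x := Subtype.ext e
  exact this ▸ hy

theorem Sub.envMap_toEnv {G : LieSuperalgebra k L} (N : G.Sub) (x : N.carrier) :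
    N.envMap (N.toLie.toEnv x) = G.toEnv x := by
  simp [Sub.envMap, LieSuperalgebra.toEnv]

theorem exists_env_lift {C : Type*} [Ring C] [Algebra k C] (Λ : L →ₗ[k] C)
    (hΛ : ∀ {a b : ZMod 2} {x y : L}, x ∈ G.grade a → y ∈ G.grade b →
      Λ x * Λ y - koszulSign k a b • (Λ y * Λ x) = Λ (G.br x y)) :
    ∃ φ : G.Env →ₐ[k] C, ∀ x, φ (G.toEnv x) = Λ x := by
  refine ⟨RingQuot.liftAlgHom k ⟨TensorAlgebra.lift k Λ, ?_⟩, fun x => ?_⟩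
  · rintro _ _ ⟨hx, hy⟩
    simpa using! hΛ hx hy
  · simp [LieSuperalgebra.toEnv]

end LieSuperalgebra

/-! ### Relations in the Kac–Moody superalgebra and maps out of its enveloping algebra -/

section KacMoody

variable {R : Type*} [CommRing R] {r : ℕ} (k : Type*) [Field k] [Algebra R k]
  (A : Matrix (Fin r) (Fin r) R) (τ : Finset (Fin r))

theorem kacMoodyGen_mem (x : ChevalleyGen r) :
    kacMoodyGen k A τ x ∈ (kacMoody k A τ).grade (ChevalleyGen.deg τ x) :=
  ⟨freeLie.of k (ChevalleyGen.deg τ) x, ι_mem_wordGrade k (ChevalleyGen.deg τ) x, rfl⟩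

theorem kacMoodyGen_e_mem (i : Fin r) :
    kacMoodyGen k A τ (.e i) ∈ (kacMoody k A τ).grade (indexParity τ i) :=
  kacMoodyGen_mem k A τ (.e i)

theorem kacMoodyGen_f_mem (i : Fin r) :
    kacMoodyGen k A τ (.f i) ∈ (kacMoody k A τ).grade (indexParity τ i) :=
  kacMoodyGen_mem k A τ (.f i)

theorem kacMoodyGen_h_mem (i : Fin r) :
    kacMoodyGen k A τ (.h i) ∈ (kacMoody k A τ).grade 0 :=
  kacMoodyGen_mem k A τ (.h i)

variable {k A τ}

theorem mkQ_eq_zero_of_cartanRel {u}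
    (h : IsCartanRel k A (freeLie k (ChevalleyGen.deg τ)).toLie
      (fun i => freeLie.of k (ChevalleyGen.deg τ) (.e i))
      (fun i => freeLie.of k (ChevalleyGen.deg τ) (.h i))
      (fun i => freeLie.of k (ChevalleyGen.deg τ) (.f i)) u) :
    (kacMoodyIdeal k A τ).carrier.mkQ u = 0 :=
  (Submodule.Quotient.mk_eq_zero _).2 (subset_idealGen _ _ (Or.inr (Or.inl h)))

theorem kacMoody_ef (i j : Fin r) :
    (kacMoody k A τ).br (kacMoodyGen k A τ (.e i)) (kacMoodyGen k A τ (.f j)) =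
      if i = j then kacMoodyGen k A τ (.h i) else 0 := by
  have h := mkQ_eq_zero_of_cartanRel (k := k) (A := A) (τ := τ) (.ef i j)
  rw [map_sub, sub_eq_zero] at h
  refine Eq.trans h ?_
  split_ifs <;> rfl

theorem kacMoody_eh (i j : Fin r) :
    (kacMoody k A τ).br (kacMoodyGen k A τ (.e j)) (kacMoodyGen k A τ (.h i)) =
      -(algebraMap R k (A i j) • kacMoodyGen k A τ (.e j)) := by
  have h := mkQ_eq_zero_of_cartanRel (k := k) (A := A) (τ := τ) (.eh i j)
  rw [map_add, map_smul] at h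
  exact eq_neg_of_add_eq_zero_left h

theorem kacMoody_hf (i j : Fin r) :
    (kacMoody k A τ).br (kacMoodyGen k A τ (.h i)) (kacMoodyGen k A τ (.f j)) =
      -(algebraMap R k (A i j) • kacMoodyGen k A τ (.f j)) := by
  have h := mkQ_eq_zero_of_cartanRel (k := k) (A := A) (τ := τ) (.hf i j)
  rw [map_add, map_smul] at h
  exact eq_neg_of_add_eq_zero_left h

theorem kacMoody_skew_even {a : ZMod 2} {x y : KacMoodySpace k A τ}
    (hx : x ∈ (kacMoody k A τ).grade 0) (hy : y ∈ (kacMoody k A τ).grade a) :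
    (kacMoody k A τ).br x y = -(kacMoody k A τ).br y x := by
  rw [(kacMoody k A τ).skew hx hy, koszulSign_zero_left, one_smul]

/-- The relations are imposed for $i>j$ only. Skew-symmetry gives $i<j$; for $i=j$ it gives
$2[h_i,h_i]=0$, whence the hypothesis on `2`. -/
theorem kacMoody_hh (h2 : (2 : k) ≠ 0) (i j : Fin r) :
    (kacMoody k A τ).br (kacMoodyGen k A τ (.h i)) (kacMoodyGen k A τ (.h j)) = 0 := by
  have lt : ∀ i j : Fin r, j < i →
      (kacMoody k A τ).br (kacMoodyGen k A τ (.h i)) (kacMoodyGen k A τ (.h j)) = 0 :=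
    fun i j hij => mkQ_eq_zero_of_cartanRel (k := k) (A := A) (τ := τ) (.hh i j hij)
  have sk := kacMoody_skew_even (kacMoodyGen_h_mem k A τ i) (kacMoodyGen_h_mem k A τ j)
  rcases lt_trichotomy i j with hij | rfl | hij
  · rw [sk, lt j i hij, neg_zero]
  · have h3 : (2 : k) • (kacMoody k A τ).br (kacMoodyGen k A τ (.h i))
        (kacMoodyGen k A τ (.h i)) = 0 := by
      rw [two_smul]
      nth_rw 1 [sk]
      exact neg_add_cancel _
    exact (smul_eq_zero.1 h3).resolve_left h2
  · exact lt i j hij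

/-- The Serre relations hold in the Kac-Moody superalgebra. -/
theorem kacMoody_serreRel_eq_zero {g : Fin r → ChevalleyGen r}
    (hg : ∀ u, IsSerreRel k A τ (freeLie k (ChevalleyGen.deg τ)).toLie
      (fun i => freeLie.of k (ChevalleyGen.deg τ) (g i)) u → u ∈ (kacMoodyIdeal k A τ).carrier)
    (u : KacMoodySpace k A τ)
    (hu : IsSerreRel k A τ (kacMoody k A τ) (fun i => kacMoodyGen k A τ (g i)) u) : u = 0 := by
  obtain ⟨-, w, hw, rfl⟩ := hu.transport (M := ZMod 2) (d := fun _ => 0)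
    (G' := (freeLie k (ChevalleyGen.deg τ)).toLie)
    (x' := fun i => freeLie.of k (ChevalleyGen.deg τ) (g i))
    (Q := fun _ u w => u = (kacMoodyIdeal k A τ).carrier.mkQ w) (fun i => rfl)
    (by rintro m n u u' v v' rfl rfl; rfl)
  exact (Submodule.Quotient.mk_eq_zero _).2 (hg w hw)

theorem kacMoody_serreGen_e_eq_zero [CharZero R] (u : KacMoodySpace k A τ)
    (hu : IsSerreGen k A τ (kacMoody k A τ) (fun i => kacMoodyGen k A τ (.e i)) u) : u = 0 := by
  refine hu.eq_zero (fun i => kacMoodyGen_e_mem k A τ i)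
    (kacMoody_serreRel_eq_zero fun u hu => subset_idealGen _ _ (Or.inl hu))
    (y := fun i => kacMoodyGen k A τ (.f i)) (fun i => kacMoodyGen_f_mem k A τ i) ?_ ?_
  · intro i j hij
    rw [(kacMoody k A τ).skew (kacMoodyGen_f_mem k A τ j) (kacMoodyGen_e_mem k A τ i),
      kacMoody_ef, if_neg hij, smul_zero, neg_zero]
  · intro i j hij
    refine ⟨_, koszulSign_ne_zero k (indexParity τ j) (indexParity τ j), ?_⟩
    rw [(kacMoody k A τ).skew (kacMoodyGen_f_mem k A τ j) (kacMoodyGen_e_mem k A τ j),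
      kacMoody_ef, if_pos rfl, map_neg, map_smul, kacMoody_eh, smul_neg, neg_neg, smul_smul]

theorem kacMoody_serreGen_f_eq_zero [CharZero R] (u : KacMoodySpace k A τ)
    (hu : IsSerreGen k A τ (kacMoody k A τ) (fun i => kacMoodyGen k A τ (.f i)) u) : u = 0 := by
  refine hu.eq_zero (fun i => kacMoodyGen_f_mem k A τ i)
    (kacMoody_serreRel_eq_zero fun u hu => subset_idealGen _ _ (Or.inr (Or.inr hu)))
    (y := fun i => kacMoodyGen k A τ (.e i)) (fun i => kacMoodyGen_e_mem k A τ i) ?_ ?_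
  · intro i j hij
    rw [kacMoody_ef, if_neg hij.symm]
  · intro i j hij
    refine ⟨1, one_ne_zero, ?_⟩
    rw [kacMoody_ef, if_pos rfl, ← neg_neg ((kacMoody k A τ).br _ _),
      ← kacMoody_skew_even (kacMoodyGen_h_mem k A τ j) (kacMoodyGen_f_mem k A τ i), kacMoody_hf,
      neg_neg, one_mul]

theorem kacMoody_triple (h2 : (2 : k) ≠ 0) :
    IsCartanTriple (fun i j => algebraMap R k (A i j)) τ
      (fun i => (kacMoody k A τ).toEnv (kacMoodyGen k A τ (.e i)))
      (fun i => (kacMoody k A τ).toEnv (kacMoodyGen k A τ (.h i)))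
      (fun i => (kacMoody k A τ).toEnv (kacMoodyGen k A τ (.f i))) where
  hh i j := by
    have h := (kacMoody k A τ).toEnv_br (kacMoodyGen_h_mem k A τ i) (kacMoodyGen_h_mem k A τ j)
    rw [kacMoody_hh h2, map_zero, koszulSign_zero_left, one_smul] at h
    exact sub_eq_zero.1 h
  ef i j := by
    have h := (kacMoody k A τ).toEnv_br (kacMoodyGen_e_mem k A τ i) (kacMoodyGen_f_mem k A τ j)
    rw [kacMoody_ef] at h
    rw [h]
    split_ifs <;> simp
  eh i j := by
    have h := (kacMoody k A τ).toEnv_br (kacMoodyGen_e_mem k A τ j) (kacMoodyGen_h_mem k A τ i)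
    rw [kacMoody_eh, koszulSign_zero_right, one_smul, map_neg, map_smul] at h
    rw [sub_eq_iff_eq_add.1 h]
    abel
  hf i j := by
    have h := (kacMoody k A τ).toEnv_br (kacMoodyGen_h_mem k A τ i) (kacMoodyGen_f_mem k A τ j)
    rw [kacMoody_hf, koszulSign_zero_left, one_smul, map_neg, map_smul] at h
    rw [sub_eq_iff_eq_add.1 h]
    abel

theorem freeLie_br_coe {X : Type*} (deg : X → ZMod 2) {a b : ZMod 2}
    {u v : (freeLie k deg).carrier} (hu : u ∈ (freeLie k deg).toLie.grade a)
    (hv : v ∈ (freeLie k deg).toLie.grade b) :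
    (((freeLie k deg).toLie.br u v : (freeLie k deg).carrier) : FreeAlgebra k X) =
      u * v - koszulSign k a b • ((v : FreeAlgebra k X) * u) :=
  freeAssoc_br deg hu hv

/-- Serre relators in the Chevalley generators come from the ideal $I$ in $r$ letters by
substitution, so a homomorphism kills them as soon as its values on the $e_i$, or on the $f_i$, kill
$I$. -/
theorem freeLie_serreRel {g : Fin r → ChevalleyGen r}
    (hg : ∀ i, ChevalleyGen.deg τ (g i) = indexParity τ i) {u}
    (hu : IsSerreRel k A τ (freeLie k (ChevalleyGen.deg τ)).toLie
      (fun i => freeLie.of k (ChevalleyGen.deg τ) (g i)) u) :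
    (∃ a, u ∈ (freeLie k (ChevalleyGen.deg τ)).toLie.grade a) ∧
      ∃ x ∈ serreSpan k A τ, (u : FreeAlgebra k (ChevalleyGen r)) =
        FreeAlgebra.lift k (fun i => FreeAlgebra.ι k (g i)) x := by
  obtain ⟨a, t, ht, hut, -, e⟩ := hu.transport (M := ZMod 2) (d := indexParity τ)
    (G' := freeAssoc k (indexParity τ)) (x' := FreeAlgebra.ι k)
    (Q := fun a u t => u ∈ (freeLie k (ChevalleyGen.deg τ)).toLie.grade a ∧
      t ∈ wordGrade k (indexParity τ) a ∧ (u : FreeAlgebra k (ChevalleyGen r)) =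
        FreeAlgebra.lift k (fun i => FreeAlgebra.ι k (g i)) t)
    (fun i => ⟨hg i ▸ ι_mem_wordGrade k (ChevalleyGen.deg τ) (g i), ι_mem_wordGrade k _ i,
      by simp [freeLie.of]⟩)
    (by
      rintro m n u u' v v' ⟨h1, h2, h3⟩ ⟨h4, h5, h6⟩
      refine ⟨(freeLie k (ChevalleyGen.deg τ)).toLie.br_mem h1 h4,
        (freeAssoc k (indexParity τ)).br_mem h2 h5, ?_⟩
      rw [freeLie_br_coe _ h1 h4, freeAssoc_br _ h2 h5, h3, h6]
      simp)
  obtain ⟨c, v, hv, rfl⟩ := ht.exists_gen (fun i => ι_mem_wordGrade k _ i)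
  exact ⟨⟨a, hut⟩, _, Submodule.smul_mem _ c hv.mem_serreSpan, e⟩

section Abstract

variable {L : Type*} [AddCommGroup L] [Module k L] {G : LieSuperalgebra k L}

theorem IsCartanRel.map_eq_zero {C : Type*} [Ring C] [Algebra k C] {e h f : Fin r → L}
    (he : ∀ i, e i ∈ G.grade (indexParity τ i)) (hh : ∀ i, h i ∈ G.grade 0)
    (hf : ∀ i, f i ∈ G.grade (indexParity τ i)) (Ψ : L →ₗ[k] C)
    (hΨ : ∀ {a b : ZMod 2} {x y : L}, x ∈ G.grade a → y ∈ G.grade b →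
      Ψ x * Ψ y - koszulSign k a b • (Ψ y * Ψ x) = Ψ (G.br x y))
    (t : IsCartanTriple (fun i j => algebraMap R k (A i j)) τ (fun i => Ψ (e i))
      (fun i => Ψ (h i)) (fun i => Ψ (f i))) {u : L} (hu : IsCartanRel k A G e h f u) :
    Ψ u = 0 ∧ ∃ a, u ∈ G.grade a := by
  cases hu with
  | hh i j hij =>
    refine ⟨?_, _, G.br_mem (hh _) (hh _)⟩
    rw [← hΨ (hh _) (hh _), t.hh i j, koszulSign_zero_left, one_smul, sub_self]
  | ef i j =>
    refine ⟨?_, indexParity τ i + indexParity τ j, sub_mem (G.br_mem (he _) (hf _)) ?_⟩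
    · rw [map_sub, ← hΨ (he _) (hf _), t.ef i j]
      split_ifs <;> simp
    · split_ifs with hij
      · subst hij
        rw [CharTwo.add_self_eq_zero]
        exact hh i
      · exact zero_mem _
  | eh i j =>
    have h0 := G.br_mem (he j) (hh i)
    rw [add_zero] at h0
    refine ⟨?_, indexParity τ j, add_mem h0 (Submodule.smul_mem _ _ (he j))⟩
    rw [map_add, map_smul, ← hΨ (he _) (hh _), t.eh i j, koszulSign_zero_right, one_smul]
    abel
  | hf i j =>
    have h0 := G.br_mem (hh i) (hf j)
    rw [zero_add] at h0
    refine ⟨?_, indexParity τ j, add_mem h0 (Submodule.smul_mem _ _ (hf j))⟩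
    rw [map_add, map_smul, ← hΨ (hh _) (hf _), t.hf i j, koszulSign_zero_left, one_smul]
    abel

/-- If the Serre relations hold for elements of a subalgebra, they hold in its enveloping
algebra. -/
theorem lift_toEnv_eq_zero {x : Fin r → L} (hx : ∀ i, x i ∈ G.grade (indexParity τ i))
    {N : G.Sub} (hN : ∀ i, x i ∈ N.carrier)
    (h0 : ∀ u, IsSerreGen k A τ G x u → u = 0)
    {w : FreeAlgebra k (Fin r)} (hw : w ∈ serreSpan k A τ) :
    FreeAlgebra.lift k (fun i => N.toLie.toEnv ⟨x i, hN i⟩) w = 0 := by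
  set q := FreeAlgebra.lift k (fun i => N.toLie.toEnv ⟨x i, hN i⟩) with hq
  refine serreSpan_le (N := LinearMap.ker q.toLinearMap) (fun θ hθ => ?_) (fun i x hx => ?_)
    (fun i x hx => ?_) hw
  -- The relator is evaluated in the Lie superalgebra first: it vanishes in `G`, hence in `N`, hence
  -- in $U(N)$. Injectivity of $U(N)\to U(G)$ is not available at this point.
  · obtain ⟨-, u, hu, -, hu', -, e⟩ := hθ.transport (M := ZMod 2) (d := indexParity τ)
      (G' := G) (x' := x)
      (Q := fun a t u => t ∈ wordGrade k (indexParity τ) a ∧ ∃ hu : u ∈ N.carrier,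
        u ∈ G.grade a ∧ q t = N.toLie.toEnv ⟨u, hu⟩)
      (fun i => ⟨ι_mem_wordGrade k _ i, hN i, hx i, by rw [hq, FreeAlgebra.lift_ι_apply]⟩)
      (by
        rintro m n u u' v v' ⟨h1, h2, h3, h4⟩ ⟨h5, h6, h7, h8⟩
        refine ⟨(freeAssoc k (indexParity τ)).br_mem h1 h5, N.br_mem _ h2 _ h6,
          G.br_mem h3 h7, ?_⟩
        have h9 := N.toLie.toEnv_br (x := ⟨u', h2⟩) (y := ⟨v', h6⟩) h3 h7
        rw [freeAssoc_br _ h1 h5, map_sub, map_mul, map_smul, map_mul, h4, h8, h9]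
        rfl)
    rw [LinearMap.mem_ker, AlgHom.toLinearMap_apply, e]
    have : (⟨u, hu'⟩ : N.carrier) = 0 := Subtype.ext (h0 u hu)
    rw [this, map_zero]
  · rw [LinearMap.mem_ker, AlgHom.toLinearMap_apply] at hx ⊢
    rw [map_mul, hx, mul_zero]
  · rw [LinearMap.mem_ker, AlgHom.toLinearMap_apply] at hx ⊢
    rw [map_mul, hx, zero_mul]

end Abstract

/-- Elements of an associative algebra that satisfy the defining relations define a homomorphism
from the enveloping algebra of the Kac-Moody superalgebra. -/
theorem exists_kacMoody_env_hom {C : Type*} [Ring C] [Algebra k C] {e h f : Fin r → C}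
    (t : IsCartanTriple (fun i j => algebraMap R k (A i j)) τ e h f)
    (he : ∀ x ∈ serreSpan k A τ, FreeAlgebra.lift k e x = 0)
    (hf : ∀ x ∈ serreSpan k A τ, FreeAlgebra.lift k f x = 0) :
    ∃ φ : (kacMoody k A τ).Env →ₐ[k] C,
      (∀ i, φ ((kacMoody k A τ).toEnv (kacMoodyGen k A τ (.e i))) = e i) ∧
      (∀ i, φ ((kacMoody k A τ).toEnv (kacMoodyGen k A τ (.h i))) = h i) ∧
      (∀ i, φ ((kacMoody k A τ).toEnv (kacMoodyGen k A τ (.f i))) = f i) := by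
  obtain ⟨Φ, Φe, Φh, Φf⟩ : ∃ Φ : FreeAlgebra k (ChevalleyGen r) →ₐ[k] C,
      (∀ i, Φ (FreeAlgebra.ι k (.e i)) = e i) ∧ (∀ i, Φ (FreeAlgebra.ι k (.h i)) = h i) ∧
      (∀ i, Φ (FreeAlgebra.ι k (.f i)) = f i) :=
    ⟨FreeAlgebra.lift k fun
      | .e i => e i
      | .h i => h i
      | .f i => f i, fun i => by simp, fun i => by simp, fun i => by simp⟩
  have lift_comp : ∀ (g : Fin r → ChevalleyGen r) x,
      Φ (FreeAlgebra.lift k (fun i => FreeAlgebra.ι k (g i)) x) =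
        FreeAlgebra.lift k (fun i => Φ (FreeAlgebra.ι k (g i))) x := by
    intro g x
    rw [← AlgHom.comp_apply]
    congr 1
    ext i
    simp
  obtain ⟨Ψ, hΨ'⟩ : ∃ Ψ : (freeLie k (ChevalleyGen.deg τ)).carrier →ₗ[k] C,
      ∀ u, Ψ u = Φ u :=
    ⟨Φ.toLinearMap ∘ₗ (freeLie k (ChevalleyGen.deg τ)).carrier.subtype, fun u => rfl⟩
  have hΨ : ∀ {a b : ZMod 2} {x y : (freeLie k (ChevalleyGen.deg τ)).carrier},
      x ∈ (freeLie k (ChevalleyGen.deg τ)).toLie.grade a →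
      y ∈ (freeLie k (ChevalleyGen.deg τ)).toLie.grade b →
      Ψ x * Ψ y - koszulSign k a b • (Ψ y * Ψ x) =
        Ψ ((freeLie k (ChevalleyGen.deg τ)).toLie.br x y) := by
    intro a b x y hx hy
    rw [hΨ', hΨ', hΨ', freeLie_br_coe _ hx hy, map_sub, map_mul, map_smul, map_mul]
  have hof : ∀ x, freeLie.of k (ChevalleyGen.deg τ) x ∈
      (freeLie k (ChevalleyGen.deg τ)).toLie.grade (ChevalleyGen.deg τ x) :=
    fun x => ι_mem_wordGrade k (ChevalleyGen.deg τ) x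
  have Ψof : ∀ x, Ψ (freeLie.of k (ChevalleyGen.deg τ) x) = Φ (FreeAlgebra.ι k x) :=
    fun x => hΨ' _
  have hI : (kacMoodyIdeal k A τ).carrier ≤ LinearMap.ker Ψ := by
    refine (freeLie k (ChevalleyGen.deg τ)).toLie.idealGen_le ?_ ?_
    · rintro u (hu | hu | hu)
      · obtain ⟨h1, x, hx, h2⟩ := freeLie_serreRel (fun _ => rfl) hu
        exact ⟨by rw [LinearMap.mem_ker, hΨ', h2, lift_comp, funext Φe, he x hx], h1⟩
      · refine hu.map_eq_zero (τ := τ) (fun i => hof (.e i)) (fun i => hof (.h i))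
          (fun i => hof (.f i)) Ψ hΨ ?_
        simpa only [Ψof, Φe, Φh, Φf] using t
      · obtain ⟨h1, x, hx, h2⟩ := freeLie_serreRel (fun _ => rfl) hu
        exact ⟨by rw [LinearMap.mem_ker, hΨ', h2, lift_comp, funext Φf, hf x hx], h1⟩
    · intro a b x y hx hy h
      rw [LinearMap.mem_ker] at h ⊢
      rw [← hΨ hx hy, h]
      simp
  obtain ⟨φ, hφ⟩ := (kacMoody k A τ).exists_env_lift
    ((kacMoodyIdeal k A τ).carrier.liftQ Ψ hI) (by
      rintro a b _ _ ⟨x, hx, rfl⟩ ⟨y, hy, rfl⟩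
      exact hΨ hx hy)
  have hgen : ∀ x, φ ((kacMoody k A τ).toEnv (kacMoodyGen k A τ x)) = Φ (FreeAlgebra.ι k x) := by
    intro x
    rw [hφ, kacMoodyGen, Submodule.mkQ_apply, Submodule.liftQ_apply, Ψof]
  exact ⟨φ, fun i => (hgen _).trans (Φe i), fun i => (hgen _).trans (Φh i),
    fun i => (hgen _).trans (Φf i)⟩

end KacMoody

/-! ### Spanning by triangular products -/

namespace IsCartanTriple

variable {r : ℕ} {k B : Type*} [Field k] [Ring B] [Algebra k B] {a : Fin r → Fin r → k}
  {τ : Finset (Fin r)} {e h f : Fin r → B}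

theorem h_mul_lift_e (t : IsCartanTriple a τ e h f) (i : Fin r) (x : FreeAlgebra k (Fin r)) :
    ∃ y, h i * FreeAlgebra.lift k e x = FreeAlgebra.lift k e x * h i + FreeAlgebra.lift k e y := by
  induction x using FreeAlgebra.induction with
  | grade0 c => exact ⟨0, by rw [AlgHom.commutes, map_zero, add_zero, Algebra.commutes]⟩
  | grade1 j => exact ⟨a i j • FreeAlgebra.ι k j, by simp [t.eh i j]⟩
  | mul x y hx hy =>
    obtain ⟨x', hx⟩ := hx
    obtain ⟨y', hy⟩ := hy
    refine ⟨x * y' + x' * y, ?_⟩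
    rw [map_mul, ← mul_assoc, hx, add_mul, mul_assoc, hy, map_add, map_mul, map_mul]
    noncomm_ring
  | add x y hx hy =>
    obtain ⟨x', hx⟩ := hx
    obtain ⟨y', hy⟩ := hy
    refine ⟨x' + y', ?_⟩
    rw [map_add, mul_add, hx, hy, map_add]
    noncomm_ring

theorem f_mul_lift_e (t : IsCartanTriple a τ e h f) (i : Fin r) (x : FreeAlgebra k (Fin r)) :
    ∃ y z w, f i * FreeAlgebra.lift k e x = FreeAlgebra.lift k e y * f i +
      FreeAlgebra.lift k e z * h i + FreeAlgebra.lift k e w := by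
  induction x using FreeAlgebra.induction with
  | grade0 c =>
    exact ⟨algebraMap k _ c, 0, 0, by
      rw [AlgHom.commutes, map_zero, zero_mul, add_zero, add_zero, Algebra.commutes]⟩
  | grade1 j =>
    by_cases hij : i = j
    · subst hij
      refine ⟨koszulSign k (indexParity τ i) (indexParity τ i) • FreeAlgebra.ι k i,
        algebraMap k _ (-koszulSign k (indexParity τ i) (indexParity τ i)), 0, ?_⟩
      rw [FreeAlgebra.lift_ι_apply, t.fe_self, map_smul, FreeAlgebra.lift_ι_apply, AlgHom.commutes,
        ← Algebra.smul_def, map_zero, smul_mul_assoc]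
      module
    · exact ⟨koszulSign k (indexParity τ i) (indexParity τ j) • FreeAlgebra.ι k j, 0, 0, by
        simp [t.fe_ne (Ne.symm hij)]⟩
  | mul x y hx hy =>
    obtain ⟨x1, x2, x3, hx⟩ := hx
    obtain ⟨y1, y2, y3, hy⟩ := hy
    obtain ⟨y4, hy'⟩ := t.h_mul_lift_e i y
    refine ⟨x1 * y1, x1 * y2 + x2 * y, x1 * y3 + x2 * y4 + x3 * y, ?_⟩
    rw [map_mul, ← mul_assoc, hx, add_mul, add_mul, mul_assoc, mul_assoc, hy, hy']
    simp only [map_add, map_mul]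
    noncomm_ring
  | add x y hx hy =>
    obtain ⟨x1, x2, x3, hx⟩ := hx
    obtain ⟨y1, y2, y3, hy⟩ := hy
    refine ⟨x1 + y1, x2 + y2, x3 + y3, ?_⟩
    rw [map_add, mul_add, hx, hy]
    simp only [map_add]
    noncomm_ring

theorem f_mul_lift_h (t : IsCartanTriple a τ e h f) (i : Fin r) (x : FreeAlgebra k (Fin r)) :
    ∃ y, f i * FreeAlgebra.lift k h x = FreeAlgebra.lift k h y * f i := by
  induction x using FreeAlgebra.induction with
  | grade0 c => exact ⟨algebraMap k _ c, by
      rw [AlgHom.commutes]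
      exact (Algebra.commutes _ _).symm⟩
  | grade1 j =>
    refine ⟨FreeAlgebra.ι k j + algebraMap k _ (a j i), ?_⟩
    rw [map_add, AlgHom.commutes, FreeAlgebra.lift_ι_apply, add_mul, ← Algebra.smul_def, t.hf j i]
    abel
  | mul x y hx hy =>
    obtain ⟨x', hx⟩ := hx
    obtain ⟨y', hy⟩ := hy
    exact ⟨x' * y', by rw [map_mul, ← mul_assoc, hx, mul_assoc, hy, map_mul, mul_assoc]⟩
  | add x y hx hy =>
    obtain ⟨x', hx⟩ := hx
    obtain ⟨y', hy⟩ := hy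
    exact ⟨x' + y', by rw [map_add, mul_add, hx, hy, map_add, add_mul]⟩

/-- An algebra generated by a triple is spanned by triangular products. -/
theorem span_triangular (t : IsCartanTriple a τ e h f)
    (hgen : Algebra.adjoin k (Set.range e ∪ Set.range h ∪ Set.range f) = ⊤)
    {N : Submodule k B} (hN : ∀ x y z, FreeAlgebra.lift k e x * FreeAlgebra.lift k h y *
      FreeAlgebra.lift k f z ∈ N) : N = ⊤ := by
  let S : Submodule k B := Submodule.span k {w | ∃ x y z, w = FreeAlgebra.lift k e x *
    FreeAlgebra.lift k h y * FreeAlgebra.lift k f z}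
  have mem : ∀ x y z, FreeAlgebra.lift k e x * FreeAlgebra.lift k h y *
      FreeAlgebra.lift k f z ∈ S := fun x y z => Submodule.subset_span ⟨x, y, z, rfl⟩
  -- Straightening: a generator multiplied from the left is moved past the $e$-part, and if
  -- necessary the $h$-part, to its place. The span is thus a left ideal, and it contains $1$.
  have stable : ∀ g ∈ Set.range e ∪ Set.range h ∪ Set.range f, ∀ w ∈ S, g * w ∈ S := by
    intro g hg w hw
    induction hw using Submodule.span_induction with
    | mem w hw =>
      obtain ⟨x, y, z, rfl⟩ := hw
      rcases hg with (⟨i, rfl⟩ | ⟨i, rfl⟩) | ⟨i, rfl⟩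
      · convert mem (FreeAlgebra.ι k i * x) y z using 1
        rw [map_mul, FreeAlgebra.lift_ι_apply]
        noncomm_ring
      · obtain ⟨x', hx⟩ := t.h_mul_lift_e i x
        convert add_mem (mem x (FreeAlgebra.ι k i * y) z) (mem x' y z) using 1
        rw [← mul_assoc, ← mul_assoc, hx, map_mul, FreeAlgebra.lift_ι_apply]
        noncomm_ring
      · obtain ⟨x1, x2, x3, hx⟩ := t.f_mul_lift_e i x
        obtain ⟨y', hy⟩ := t.f_mul_lift_h i y
        convert add_mem (add_mem (mem x1 y' (FreeAlgebra.ι k i * z))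
          (mem x2 (FreeAlgebra.ι k i * y) z)) (mem x3 y z) using 1
        have hy2 : FreeAlgebra.lift k e x1 * f i * FreeAlgebra.lift k h y =
            FreeAlgebra.lift k e x1 * (FreeAlgebra.lift k h y' * f i) := by rw [mul_assoc, hy]
        rw [← mul_assoc, ← mul_assoc, hx, add_mul, add_mul, add_mul, hy2, map_mul,
          map_mul, FreeAlgebra.lift_ι_apply, FreeAlgebra.lift_ι_apply]
        noncomm_ring
    | zero => simp
    | add x y _ _ hx hy => rw [mul_add]; exact add_mem hx hy
    | smul c x _ hx => rw [mul_smul_comm]; exact Submodule.smul_mem _ _ hx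
  have top : ∀ b : B, ∀ w ∈ S, b * w ∈ S := by
    intro b
    have hb : b ∈ Algebra.adjoin k (Set.range e ∪ Set.range h ∪ Set.range f) := hgen ▸ trivial
    induction hb using Algebra.adjoin_induction with
    | mem g hg => exact stable g hg
    | algebraMap c => intro w hw; rw [← Algebra.smul_def]; exact S.smul_mem _ hw
    | add x y _ _ hx hy => intro w hw; rw [add_mul]; exact add_mem (hx w hw) (hy w hw)
    | mul x y _ _ hx hy => intro w hw; rw [mul_assoc]; exact hx _ (hy w hw)
  have hSN : S ≤ N := by
    refine Submodule.span_le.2 ?_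
    rintro _ ⟨x, y, z, rfl⟩
    exact hN x y z
  refine eq_top_iff.2 fun b _ => hSN ?_
  have h1 := top b 1 (by simpa using mem 1 1 1)
  rwa [mul_one] at h1

end IsCartanTriple

theorem exists_aeval_of_comm {k C : Type*} [Field k] [Ring C] [Algebra k C] {r : ℕ}
    (hC : ∀ x y : C, x * y = y * x) (g : Fin r → C) :
    ∃ φ : MvPolynomial (Fin r) k →ₐ[k] C, ∀ i, φ (MvPolynomial.X i) = g i := by
  let _ : CommRing C := { (inferInstance : Ring C) with mul_comm := hC }
  exact ⟨MvPolynomial.aeval g, fun i => MvPolynomial.aeval_X g i⟩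

theorem mul_comm_of_adjoin {k C : Type*} [Field k] [Ring C] [Algebra k C] {s : Set C}
    (hs : Algebra.adjoin k s = ⊤) (hc : ∀ x ∈ s, ∀ y ∈ s, x * y = y * x) (x y : C) :
    x * y = y * x :=
  Algebra.commute_of_mem_adjoin_of_forall_mem_commute (R := k) (s := s) (hs ▸ trivial) fun b hb =>
    (Algebra.commute_of_mem_adjoin_of_forall_mem_commute (R := k) (s := s) (hs ▸ trivial)
      fun c hc' => hc b hb c hc').symm

/-! ### Injectivity and surjectivity of the triple multiplication -/

section Assembly

variable {R : Type*} [CommRing R] {r : ℕ} {k : Type*} [Field k] [Algebra R k]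
  {A : Matrix (Fin r) (Fin r) R} {τ : Finset (Fin r)}
  {U₁ U₂ U₃ U : Type*} [Ring U₁] [Ring U₂] [Ring U₃] [Ring U] [Algebra k U₁] [Algebra k U₂]
  [Algebra k U₃] [Algebra k U]

/-- The multiplication map of three algebras mapping to a fourth one. -/
noncomputable def tripleMul (i₁ : U₁ →ₐ[k] U) (i₂ : U₂ →ₐ[k] U) (i₃ : U₃ →ₐ[k] U) :
    U₁ ⊗[k] U₂ ⊗[k] U₃ →ₗ[k] U :=
  LinearMap.mul' k U ∘ₗ TensorProduct.map
    (LinearMap.mul' k U ∘ₗ TensorProduct.map i₁.toLinearMap i₂.toLinearMap) i₃.toLinearMap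

theorem tripleMul_tmul (i₁ : U₁ →ₐ[k] U) (i₂ : U₂ →ₐ[k] U) (i₃ : U₃ →ₐ[k] U) (x : U₁) (y : U₂)
    (z : U₃) : tripleMul i₁ i₂ i₃ (x ⊗ₜ y ⊗ₜ z) = i₁ x * i₂ y * i₃ z := by
  simp [tripleMul]

theorem lift_comp_algHom {C D : Type*} [Semiring C] [Algebra k C] [Semiring D] [Algebra k D]
    (ι : C →ₐ[k] D) (g : Fin r → C) (x : FreeAlgebra k (Fin r)) :
    FreeAlgebra.lift k (fun i => ι (g i)) x = ι (FreeAlgebra.lift k g x) := by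
  rw [← AlgHom.comp_apply]
  congr 1
  ext i
  simp

theorem lift_surjective_of_adjoin {C : Type*} [Ring C] [Algebra k C] {g : Fin r → C}
    (hg : Algebra.adjoin k (Set.range g) = ⊤) :
    Function.Surjective (FreeAlgebra.lift k g) := by
  rw [← AlgHom.range_eq_top, ← hg, Algebra.adjoin_range_eq_range_freeAlgebra_lift]

theorem tripleMul_surjective {a : Fin r → Fin r → k}
    (i₁ : U₁ →ₐ[k] U) (i₂ : U₂ →ₐ[k] U) (i₃ : U₃ →ₐ[k] U)
    {e : Fin r → U₁} {h : Fin r → U₂} {f : Fin r → U₃}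
    (t : IsCartanTriple a τ (fun i => i₁ (e i)) (fun i => i₂ (h i)) (fun i => i₃ (f i)))
    (g : Algebra.adjoin k (Set.range (fun i => i₁ (e i)) ∪ Set.range (fun i => i₂ (h i)) ∪
      Set.range (fun i => i₃ (f i))) = ⊤) :
    Function.Surjective (tripleMul i₁ i₂ i₃) := by
  rw [← LinearMap.range_eq_top]
  refine t.span_triangular g fun x y z => ?_
  rw [lift_comp_algHom, lift_comp_algHom, lift_comp_algHom, ← tripleMul_tmul]
  exact LinearMap.mem_range_self _ _

/-- `D` multiplies, acts through `φ` and evaluates at $v=1\otimes1\otimes1$. `E`, `F` and `q` exist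
because the Serre relations hold in `U₁` and `U₃` and because `U₂` is commutative. On products of
generators `D` returns the chosen representatives and `Θ` sends them back, so $\Theta
D=\mathrm{id}$. No relation in `U` is needed beyond the existence of `φ`. -/
theorem tripleMul_injective [CharZero R] (h2 : (2 : k) ≠ 0) (hA : IsSuperGCM A τ)
    (i₁ : U₁ →ₐ[k] U) (i₂ : U₂ →ₐ[k] U) (i₃ : U₃ →ₐ[k] U)
    {e : Fin r → U₁} {h : Fin r → U₂} {f : Fin r → U₃}
    (ge : Algebra.adjoin k (Set.range e) = ⊤) (gh : Algebra.adjoin k (Set.range h) = ⊤)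
    (gf : Algebra.adjoin k (Set.range f) = ⊤)
    (ch : ∀ i j, h i * h j = h j * h i)
    (he : ∀ x ∈ serreSpan k A τ, FreeAlgebra.lift k e x = 0)
    (hf : ∀ x ∈ serreSpan k A τ, FreeAlgebra.lift k f x = 0)
    (hU : ∀ {e' h' f' : Fin r → Module.End k (SerreQuot k A τ ⊗[k]
        (MvPolynomial (Fin r) k ⊗[k] SerreQuot k A τ))},
      IsCartanTriple (fun i j => algebraMap R k (A i j)) τ e' h' f' →
      (∀ x ∈ serreSpan k A τ, FreeAlgebra.lift k e' x = 0) →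
      (∀ x ∈ serreSpan k A τ, FreeAlgebra.lift k f' x = 0) →
      ∃ φ : U →ₐ[k] Module.End k (SerreQuot k A τ ⊗[k]
        (MvPolynomial (Fin r) k ⊗[k] SerreQuot k A τ)),
        (∀ i, φ (i₁ (e i)) = e' i) ∧ (∀ i, φ (i₂ (h i)) = h' i) ∧
        (∀ i, φ (i₃ (f i)) = f' i)) :
    Function.Injective (tripleMul i₁ i₂ i₃) := by
  obtain ⟨e', h', f', t', he', hf', ae, ah, af⟩ := exists_triangular_rep (k := k) h2 hA
  obtain ⟨φ, φe, φh, φf⟩ := hU t' he' hf'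
  have ce : ∀ x, φ (i₁ (FreeAlgebra.lift k e x)) = FreeAlgebra.lift k e' x := fun x =>
    (lift_comp_algHom (φ.comp i₁) e x).symm.trans
      (congrArg (fun g => FreeAlgebra.lift k g x) (funext φe))
  have cf : ∀ x, φ (i₃ (FreeAlgebra.lift k f x)) = FreeAlgebra.lift k f' x := fun x =>
    (lift_comp_algHom (φ.comp i₃) f x).symm.trans
      (congrArg (fun g => FreeAlgebra.lift k g x) (funext φf))
  have comm : ∀ x y : U₂, x * y = y * x := mul_comm_of_adjoin gh (by
    rintro _ ⟨i, rfl⟩ _ ⟨j, rfl⟩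
    exact ch i j)
  obtain ⟨q, hq⟩ := exists_aeval_of_comm (k := k) comm h
  have qsurj : Function.Surjective q := by
    rw [← AlgHom.range_eq_top, eq_top_iff, ← gh, Algebra.adjoin_le_iff]
    rintro _ ⟨i, rfl⟩
    exact ⟨_, hq i⟩
  have ch' : ∀ p p' y, φ (i₂ (q p)) ((serreSpan k A τ).mkQ 1 ⊗ₜ (p' ⊗ₜ y)) =
      (serreSpan k A τ).mkQ 1 ⊗ₜ ((p * p') ⊗ₜ y) := by
    intro p
    induction p using MvPolynomial.induction_on with
    | C c =>
      intro p' y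
      rw [← MvPolynomial.algebraMap_eq, AlgHom.commutes, AlgHom.commutes, AlgHom.commutes,
        Module.algebraMap_end_apply, ← Algebra.smul_def, ← TensorProduct.smul_tmul',
        TensorProduct.tmul_smul]
    | add x y hx hy =>
      intro p' z
      rw [map_add, map_add, map_add, LinearMap.add_apply, hx, hy, add_mul, TensorProduct.add_tmul,
        TensorProduct.tmul_add]
    | mul_X x i hx =>
      intro p' y
      rw [map_mul, map_mul, map_mul, Module.End.mul_apply, hq, φh, ah, hx, mul_assoc]
  obtain ⟨E, hE⟩ : ∃ E : SerreQuot k A τ →ₗ[k] U₁,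
      ∀ x, E ((serreSpan k A τ).mkQ x) = FreeAlgebra.lift k e x :=
    ⟨(serreSpan k A τ).liftQ (FreeAlgebra.lift k e).toLinearMap he, fun x => rfl⟩
  obtain ⟨F, hF⟩ : ∃ F : SerreQuot k A τ →ₗ[k] U₃,
      ∀ x, F ((serreSpan k A τ).mkQ x) = FreeAlgebra.lift k f x :=
    ⟨(serreSpan k A τ).liftQ (FreeAlgebra.lift k f).toLinearMap hf, fun x => rfl⟩
  let v : SerreQuot k A τ ⊗[k] (MvPolynomial (Fin r) k ⊗[k] SerreQuot k A τ) :=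
    (serreSpan k A τ).mkQ 1 ⊗ₜ (1 ⊗ₜ (serreSpan k A τ).mkQ 1)
  let D : U₁ ⊗[k] U₂ ⊗[k] U₃ →ₗ[k]
      SerreQuot k A τ ⊗[k] (MvPolynomial (Fin r) k ⊗[k] SerreQuot k A τ) :=
    LinearMap.applyₗ v ∘ₗ φ.toLinearMap ∘ₗ tripleMul i₁ i₂ i₃
  let Θ : SerreQuot k A τ ⊗[k] (MvPolynomial (Fin r) k ⊗[k] SerreQuot k A τ) →ₗ[k]
      U₁ ⊗[k] U₂ ⊗[k] U₃ :=
    (TensorProduct.assoc k U₁ U₂ U₃).symm.toLinearMap ∘ₗ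
      TensorProduct.map E (TensorProduct.map q.toLinearMap F)
  have key : Θ ∘ₗ D = LinearMap.id := by
    refine TensorProduct.ext_threefold fun x y z => ?_
    obtain ⟨x, rfl⟩ := lift_surjective_of_adjoin ge x
    obtain ⟨y, rfl⟩ := qsurj y
    obtain ⟨z, rfl⟩ := lift_surjective_of_adjoin gf z
    have hD : D (FreeAlgebra.lift k e x ⊗ₜ q y ⊗ₜ FreeAlgebra.lift k f z) =
        (serreSpan k A τ).mkQ x ⊗ₜ (y ⊗ₜ (serreSpan k A τ).mkQ z) := by
      simp only [D, v, LinearMap.comp_apply, LinearMap.applyₗ_apply_apply, AlgHom.toLinearMap_apply]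
      rw [tripleMul_tmul, map_mul, map_mul, Module.End.mul_apply, Module.End.mul_apply, ce, cf, af,
        ch', mul_one, ae]
    rw [LinearMap.comp_apply, hD]
    simp only [Θ, LinearMap.comp_apply, TensorProduct.map_tmul, hE, hF, AlgHom.toLinearMap_apply,
      LinearEquiv.coe_coe, TensorProduct.assoc_symm_tmul, LinearMap.id_apply]
  intro x y hxy
  have hxy' : D x = D y := congrArg (fun u => φ u v) hxy
  exact (LinearMap.congr_fun key x).symm.trans ((congrArg Θ hxy').trans (LinearMap.congr_fun key y))

end Assembly

/-! ### The decomposition of the enveloping algebra -/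

section KacMoody

variable {R : Type*} [CommRing R] {r : ℕ} {k : Type*} [Field k] [Algebra R k]
  {A : Matrix (Fin r) (Fin r) R} {τ : Finset (Fin r)}

theorem adjoin_toEnv_subGen {L : Type*} [AddCommGroup L] [Module k L] {G : LieSuperalgebra k L}
    {x : Fin r → L} (hx : ∀ i, ∃ a, x i ∈ G.grade a) :
    Algebra.adjoin k (Set.range fun i => (G.subGen (Set.range x)).toLie.toEnv
      ⟨x i, subset_subGen G _ ⟨i, rfl⟩⟩) = ⊤ := by
  refine G.toEnv_mem_of_subGen (by rintro _ ⟨i, rfl⟩; exact hx i) ?_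
  rintro _ ⟨i, rfl⟩
  exact Algebra.subset_adjoin ⟨i, rfl⟩

/-- The Kac-Moody superalgebra is generated by the Chevalley generators. -/
theorem kacMoody_eq_top {N : Submodule k (KacMoodySpace k A τ)}
    (h1 : ∀ x, kacMoodyGen k A τ x ∈ N)
    (h2 : ∀ {a b : ZMod 2} {x y}, x ∈ (kacMoody k A τ).grade a → y ∈ (kacMoody k A τ).grade b →
      x ∈ N → y ∈ N → (kacMoody k A τ).br x y ∈ N) : N = ⊤ := by
  have key : (freeLie k (ChevalleyGen.deg τ)).carrier ≤
      (N.comap (kacMoodyIdeal k A τ).carrier.mkQ).map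
        (freeLie k (ChevalleyGen.deg τ)).carrier.subtype := by
    refine subGen_le _ ?_ ?_
    · rintro _ ⟨x, rfl⟩
      exact ⟨⟨freeLie.of k (ChevalleyGen.deg τ) x, h1 x, rfl⟩, _, ι_mem_wordGrade k _ x⟩
    · rintro a b _ _ hx hy ⟨x, hx', rfl⟩ ⟨y, hy', rfl⟩
      exact ⟨(freeLie k (ChevalleyGen.deg τ)).toLie.br x y,
        h2 ⟨x, hx, rfl⟩ ⟨y, hy, rfl⟩ hx' hy', rfl⟩
  refine eq_top_iff.2 fun u _ => ?_
  obtain ⟨x, rfl⟩ := (kacMoodyIdeal k A τ).carrier.mkQ_surjective u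
  obtain ⟨y, hy, e⟩ := key x.2
  have : y = x := Subtype.ext e
  exact this ▸ hy

theorem adjoin_toEnv_kacMoodyGen :
    Algebra.adjoin k
      (Set.range (fun i => (kacMoody k A τ).toEnv (kacMoodyGen k A τ (.e i))) ∪
        Set.range (fun i => (kacMoody k A τ).toEnv (kacMoodyGen k A τ (.h i))) ∪
        Set.range (fun i => (kacMoody k A τ).toEnv (kacMoodyGen k A τ (.f i)))) = ⊤ := by
  set B := Algebra.adjoin k
      (Set.range (fun i => (kacMoody k A τ).toEnv (kacMoodyGen k A τ (.e i))) ∪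
        Set.range (fun i => (kacMoody k A τ).toEnv (kacMoodyGen k A τ (.h i))) ∪
        Set.range (fun i => (kacMoody k A τ).toEnv (kacMoodyGen k A τ (.f i)))) with hB
  have h : (Subalgebra.toSubmodule B).comap (kacMoody k A τ).toEnv = ⊤ := by
    refine kacMoody_eq_top ?_ ?_
    · rintro (i | i | i)
      · exact Algebra.subset_adjoin (Or.inl (Or.inl ⟨i, rfl⟩))
      · exact Algebra.subset_adjoin (Or.inl (Or.inr ⟨i, rfl⟩))
      · exact Algebra.subset_adjoin (Or.inr ⟨i, rfl⟩)
    · intro a b x y hx hy hx' hy'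
      simp only [Submodule.mem_comap, Subalgebra.mem_toSubmodule] at hx' hy' ⊢
      rw [← (kacMoody k A τ).toEnv_br hx hy]
      exact sub_mem (mul_mem hx' hy') (Subalgebra.smul_mem _ (mul_mem hy' hx') _)
  rw [eq_top_iff, ← adjoin_range_toEnv, Algebra.adjoin_le_iff]
  rintro _ ⟨x, rfl⟩
  exact h.ge (Submodule.mem_top (x := x))

/-- The triangular decomposition of the enveloping algebra. -/
theorem tripleMul_envMap_bijective [CharZero R] (h2 : (2 : k) ≠ 0) (hA : IsSuperGCM A τ) :
    Function.Bijective (tripleMul (kacMoodyPos k A τ).envMap (kacMoodyZero k A τ).envMap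
      (kacMoodyNeg k A τ).envMap) := by
  have me : ∀ i, kacMoodyGen k A τ (.e i) ∈ (kacMoodyPos k A τ).carrier :=
    fun i => subset_subGen _ _ ⟨i, rfl⟩
  have mh : ∀ i, kacMoodyGen k A τ (.h i) ∈ (kacMoodyZero k A τ).carrier :=
    fun i => subset_subGen _ _ ⟨i, rfl⟩
  have mf : ∀ i, kacMoodyGen k A τ (.f i) ∈ (kacMoodyNeg k A τ).carrier :=
    fun i => subset_subGen _ _ ⟨i, rfl⟩
  have ie : ∀ i, (kacMoodyPos k A τ).envMap ((kacMoodyPos k A τ).toLie.toEnv ⟨_, me i⟩) =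
    (kacMoody k A τ).toEnv (kacMoodyGen k A τ (.e i)) := fun i => Sub.envMap_toEnv _ _
  have ih : ∀ i, (kacMoodyZero k A τ).envMap ((kacMoodyZero k A τ).toLie.toEnv ⟨_, mh i⟩) =
    (kacMoody k A τ).toEnv (kacMoodyGen k A τ (.h i)) := fun i => Sub.envMap_toEnv _ _
  have iF : ∀ i, (kacMoodyNeg k A τ).envMap ((kacMoodyNeg k A τ).toLie.toEnv ⟨_, mf i⟩) =
    (kacMoody k A τ).toEnv (kacMoodyGen k A τ (.f i)) := fun i => Sub.envMap_toEnv _ _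
  refine ⟨tripleMul_injective (A := A) (τ := τ) h2 hA _ _ _
    (adjoin_toEnv_subGen fun i => ⟨_, kacMoodyGen_e_mem k A τ i⟩)
    (adjoin_toEnv_subGen fun i => ⟨_, kacMoodyGen_h_mem k A τ i⟩)
    (adjoin_toEnv_subGen fun i => ⟨_, kacMoodyGen_f_mem k A τ i⟩)
    (fun i j => ?_)
    (fun x hx => lift_toEnv_eq_zero (kacMoodyGen_e_mem k A τ) me kacMoody_serreGen_e_eq_zero hx)
    (fun x hx => lift_toEnv_eq_zero (kacMoodyGen_f_mem k A τ) mf kacMoody_serreGen_f_eq_zero hx)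
    (fun t he hf => ?_),
    tripleMul_surjective (a := fun i j => algebraMap R k (A i j)) (τ := τ) _ _ _
      (e := fun i => (kacMoodyPos k A τ).toLie.toEnv ⟨_, me i⟩)
      (h := fun i => (kacMoodyZero k A τ).toLie.toEnv ⟨_, mh i⟩)
      (f := fun i => (kacMoodyNeg k A τ).toLie.toEnv ⟨_, mf i⟩) ?_ ?_⟩
  · have h := (kacMoodyZero k A τ).toLie.toEnv_br (x := ⟨_, mh i⟩) (y := ⟨_, mh j⟩)
      (kacMoodyGen_h_mem k A τ i) (kacMoodyGen_h_mem k A τ j)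
    have h0 : (kacMoodyZero k A τ).toLie.br ⟨_, mh i⟩ ⟨_, mh j⟩ = 0 :=
      Subtype.ext (kacMoody_hh h2 i j)
    rw [h0, map_zero, koszulSign_zero_left, one_smul] at h
    exact sub_eq_zero.1 h
  · obtain ⟨φ, h1, h2, h3⟩ := exists_kacMoody_env_hom t he hf
    exact ⟨φ, fun i => (congrArg φ (ie i)).trans (h1 i), fun i => (congrArg φ (ih i)).trans (h2 i),
      fun i => (congrArg φ (iF i)).trans (h3 i)⟩
  · simp only [ie, ih, iF]
    exact kacMoody_triple h2
  · simp only [ie, ih, iF]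
    exact adjoin_toEnv_kacMoodyGen

end KacMoody

/-! ### The height grading and directness of the sum -/

namespace LieSuperalgebra

theorem map₂_mem_of_mem_iSup {k L L' L'' I J : Type*} [Field k] [AddCommGroup L] [Module k L]
    [AddCommGroup L'] [Module k L'] [AddCommGroup L''] [Module k L'']
    (B : L →ₗ[k] L' →ₗ[k] L'') {S : I → Submodule k L} {T : J → Submodule k L'}
    {N : Submodule k L''} (h : ∀ i j, ∀ x ∈ S i, ∀ y ∈ T j, B x y ∈ N) {x : L} {y : L'}
    (hx : x ∈ ⨆ i, S i) (hy : y ∈ ⨆ j, T j) : B x y ∈ N := by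
  refine Submodule.iSup_induction S (motive := fun x => B x y ∈ N) hx (fun i x hx => ?_)
    (by simp) (fun x x' h h' => by rw [map_add, LinearMap.add_apply]; exact add_mem h h')
  refine Submodule.iSup_induction T (motive := fun y => B x y ∈ N) hy (fun j y hy => h i j x hx y hy)
    (by simp) (fun y y' h h' => by rw [map_add]; exact add_mem h h')

/-- The sub-superalgebra generated by elements with weights in a set closed under addition. -/
theorem subGen_le_iSup {k L M : Type*} [Field k] [AddCommGroup L] [Module k L] [Add M]
    {G : LieSuperalgebra k L} {W : M → Submodule k L}
    (hW : ∀ m n, ∀ x ∈ W m, ∀ y ∈ W n, G.br x y ∈ W (m + n)) {p : M → Prop}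
    (hp : ∀ m n, p m → p n → p (m + n)) {S : Set L}
    (hS : ∀ s ∈ S, (∃ m, p m ∧ s ∈ W m) ∧ ∃ a, s ∈ G.grade a) :
    (G.subGen S).carrier ≤ ⨆ m : {m // p m}, W m := by
  refine G.subGen_le (fun s hs => ?_) (fun _ _ hx hy => map₂_mem_of_mem_iSup G.br ?_ hx hy)
  · obtain ⟨⟨m, hm, h⟩, ha⟩ := hS s hs
    exact ⟨Submodule.mem_iSup_of_mem (⟨m, hm⟩ : {m // p m}) h, ha⟩
  · rintro ⟨m, hm⟩ ⟨n, hn⟩ x hx y hy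
    exact Submodule.mem_iSup_of_mem (⟨m + n, hp m n hm hn⟩ : {m // p m}) (hW m n x hx y hy)

section Weight

variable {k : Type*} [Field k] {X : Type*} (deg : X → ZMod 2) (d : X → ℤ)

/-- The weight spaces of the free Lie superalgebra, for the parity together with a weight
in `ℤ`. -/
noncomputable def freeLieWeight (m : ZMod 2 × ℤ) : Submodule k (freeLie k deg).carrier :=
  (wordSpan k (fun x => (deg x, d x)) m).comap (freeLie k deg).carrier.subtype

variable {deg d}

theorem wordSpan_le_wordGrade (m : ZMod 2 × ℤ) :
    wordSpan k (fun x => (deg x, d x)) m ≤ wordGrade k deg m.1 := by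
  refine Submodule.span_mono ?_
  rintro _ ⟨l, rfl, rfl⟩
  refine ⟨l, ?_, rfl⟩
  induction l with
  | nil => rfl
  | cons x l ih => simp [ih]

theorem freeLieWeight_le_grade {m : ZMod 2 × ℤ} {u} (hu : u ∈ freeLieWeight (k := k) deg d m) :
    u ∈ (freeLie k deg).toLie.grade m.1 :=
  wordSpan_le_wordGrade m hu

theorem of_mem_freeLieWeight (x : X) :
    freeLie.of k deg x ∈ freeLieWeight (k := k) deg d (deg x, d x) :=
  ι_mem_wordSpan k (fun x => (deg x, d x)) x

theorem br_mem_freeLieWeight {m n : ZMod 2 × ℤ} {u v}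
    (hu : u ∈ freeLieWeight (k := k) deg d m) (hv : v ∈ freeLieWeight (k := k) deg d n) :
    (freeLie k deg).toLie.br u v ∈ freeLieWeight (k := k) deg d (m + n) :=
  br_mem_wordSpan deg (wordSpan_le_wordGrade m hu) (wordSpan_le_wordGrade n hv) hu hv

theorem iSup_freeLieWeight : ⨆ m, freeLieWeight (k := k) deg d m = ⊤ := by
  have key : (freeLie k deg).carrier ≤
      (⨆ m, freeLieWeight (k := k) deg d m).map (freeLie k deg).carrier.subtype := by
    refine subGen_le _ ?_ ?_
    · rintro _ ⟨x, rfl⟩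
      exact ⟨⟨freeLie.of k deg x, Submodule.mem_iSup_of_mem _ (of_mem_freeLieWeight x), rfl⟩, _,
        ι_mem_wordGrade k _ x⟩
    · rintro a b _ _ hx hy ⟨x, hx', rfl⟩ ⟨y, hy', rfl⟩
      exact ⟨(freeLie k deg).toLie.br x y, map₂_mem_of_mem_iSup _ (fun m n x hx y hy =>
        Submodule.mem_iSup_of_mem _ (br_mem_freeLieWeight hx hy)) hx' hy', rfl⟩
  refine eq_top_iff.2 fun u _ => ?_
  obtain ⟨y, hy, e⟩ := key u.2
  have : y = u := Subtype.ext e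
  exact this ▸ hy

/-- The projection of the free associative algebra preserves the free Lie superalgebra because the
latter is the sum of its own weight spaces. Weights include the parity so that brackets of weight
vectors are supercommutators and hence weight vectors. -/
theorem exists_freeLie_projection (p : ZMod 2 × ℤ → Prop) :
    ∃ q : (freeLie k deg).carrier →ₗ[k] (freeLie k deg).carrier,
      (∀ m u, p m → u ∈ freeLieWeight (k := k) deg d m → q u = u) ∧
      ∀ m u, ¬ p m → u ∈ freeLieWeight (k := k) deg d m → q u = 0 := by
  classical
  obtain ⟨q, hq⟩ := exists_weight_projection (k := k) (fun x => (deg x, d x)) p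
  have hm : ∀ u : (freeLie k deg).carrier, q u ∈ (freeLie k deg).carrier := by
    intro u
    have hu : u ∈ ⨆ m, freeLieWeight (k := k) deg d m :=
      iSup_freeLieWeight.ge (Submodule.mem_top (x := u))
    refine Submodule.iSup_induction _
      (motive := fun u : (freeLie k deg).carrier => q u ∈ (freeLie k deg).carrier) hu
      (fun m u hu => ?_) (by simp) (fun u v hu hv => ?_)
    · rw [hq m u hu]
      split_ifs
      · exact u.2
      · exact zero_mem _
    · rw [Submodule.coe_add, map_add]
      exact add_mem hu hv
  refine ⟨(q ∘ₗ (freeLie k deg).carrier.subtype).codRestrict _ hm, fun m u hp hu => ?_,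
    fun m u hp hu => ?_⟩
  · exact Subtype.ext ((hq m u hu).trans (if_pos hp))
  · exact Subtype.ext ((hq m u hu).trans (if_neg hp))

end Weight

end LieSuperalgebra

/-- The height of the generators. -/
def ChevalleyGen.height {r : ℕ} : ChevalleyGen r → ℤ
  | .e _ => 1
  | .h _ => 0
  | .f _ => -1

theorem IsSerreRel.mem_freeLieWeight {R k : Type*} [CommRing R] [Field k] {r : ℕ}
    {A : Matrix (Fin r) (Fin r) R} {τ : Finset (Fin r)} {g : Fin r → ChevalleyGen r} {u}
    (hu : IsSerreRel k A τ (freeLie k (ChevalleyGen.deg τ)).toLie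
      (fun i => freeLie.of k (ChevalleyGen.deg τ) (g i)) u) :
    ∃ m, u ∈ freeLieWeight (ChevalleyGen.deg τ) ChevalleyGen.height m := by
  obtain ⟨m, -, -, h⟩ := hu.transport (M := ZMod 2 × ℤ)
    (d := fun i => (ChevalleyGen.deg τ (g i), (g i).height))
    (G' := (freeLie k (ChevalleyGen.deg τ)).toLie)
    (x' := fun i => freeLie.of k (ChevalleyGen.deg τ) (g i))
    (Q := fun m u _ => u ∈ freeLieWeight (ChevalleyGen.deg τ) ChevalleyGen.height m)
    (fun i => of_mem_freeLieWeight (g i))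
    (fun m n u u' v v' h h' => br_mem_freeLieWeight h h')
  exact ⟨m, h⟩

section KacMoody

variable {R : Type*} [CommRing R] {r : ℕ} {k : Type*} [Field k] [Algebra R k]
  {A : Matrix (Fin r) (Fin r) R} {τ : Finset (Fin r)}

variable (k A τ) in
/-- The weight spaces of the Kac-Moody superalgebra, for parity and height. -/
noncomputable def kacMoodyWeight (m : ZMod 2 × ℤ) : Submodule k (KacMoodySpace k A τ) :=
  (freeLieWeight (ChevalleyGen.deg τ) ChevalleyGen.height m).map (kacMoodyIdeal k A τ).carrier.mkQ

theorem kacMoodyGen_mem_weight (x : ChevalleyGen r) :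
    kacMoodyGen k A τ x ∈ kacMoodyWeight k A τ (ChevalleyGen.deg τ x, x.height) :=
  ⟨_, of_mem_freeLieWeight x, rfl⟩

theorem br_mem_kacMoodyWeight (m n : ZMod 2 × ℤ) (x) (hx : x ∈ kacMoodyWeight k A τ m) (y)
    (hy : y ∈ kacMoodyWeight k A τ n) :
    (kacMoody k A τ).br x y ∈ kacMoodyWeight k A τ (m + n) := by
  obtain ⟨x, hx, rfl⟩ := hx
  obtain ⟨y, hy, rfl⟩ := hy
  exact ⟨_, br_mem_freeLieWeight hx hy, rfl⟩

theorem IsCartanRel.mem_freeLieWeight {u}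
    (hu : IsCartanRel k A (freeLie k (ChevalleyGen.deg τ)).toLie
      (fun i => freeLie.of k (ChevalleyGen.deg τ) (.e i))
      (fun i => freeLie.of k (ChevalleyGen.deg τ) (.h i))
      (fun i => freeLie.of k (ChevalleyGen.deg τ) (.f i)) u) :
    ∃ m, u ∈ freeLieWeight (ChevalleyGen.deg τ) ChevalleyGen.height m := by
  have br : ∀ x y : ChevalleyGen r, (freeLie k (ChevalleyGen.deg τ)).toLie.br
      (freeLie.of k (ChevalleyGen.deg τ) x) (freeLie.of k (ChevalleyGen.deg τ) y) ∈
      freeLieWeight (ChevalleyGen.deg τ) ChevalleyGen.height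
        ((ChevalleyGen.deg τ x, x.height) + (ChevalleyGen.deg τ y, y.height)) :=
    fun x y => br_mem_freeLieWeight (of_mem_freeLieWeight x) (of_mem_freeLieWeight y)
  cases hu with
  | hh i j hij =>
    have h := br (.h i) (.h j)
    exact ⟨_, h⟩
  | ef i j =>
    have h := br (.e i) (.f j)
    refine ⟨_, sub_mem h ?_⟩
    split_ifs with hij
    · subst hij
      have h := of_mem_freeLieWeight (k := k) (deg := ChevalleyGen.deg τ)
        (d := ChevalleyGen.height) (ChevalleyGen.h i)
      convert h using 2
      -- $[e_i,f_i]$ and $h_i$ have the same weight: the two equal parities cancel modulo $2$, and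
      -- the heights $1$ and $-1$ add up to $0$.
      exact Prod.ext (CharTwo.add_self_eq_zero _) (add_neg_cancel _)
    · exact zero_mem _
  | eh i j =>
    have h := br (.e j) (.h i)
    refine ⟨_, add_mem h (Submodule.smul_mem _ _ ?_)⟩
    have h := of_mem_freeLieWeight (k := k) (deg := ChevalleyGen.deg τ)
      (d := ChevalleyGen.height) (ChevalleyGen.e j)
    convert h using 2
    exact add_zero _
  | hf i j =>
    have h := br (.h i) (.f j)
    refine ⟨_, add_mem h (Submodule.smul_mem _ _ ?_)⟩
    have h := of_mem_freeLieWeight (k := k) (deg := ChevalleyGen.deg τ)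
      (d := ChevalleyGen.height) (ChevalleyGen.f j)
    convert h using 2
    exact zero_add _

/-- The ideal is generated by weight vectors and hence graded; this lets the weight projections
descend to the quotient. -/
theorem kacMoodyIdeal_le_iSup : (kacMoodyIdeal k A τ).carrier ≤
    ⨆ m, (kacMoodyIdeal k A τ).carrier ⊓
      freeLieWeight (ChevalleyGen.deg τ) ChevalleyGen.height m := by
  refine idealGen_le _ ?_ ?_
  · intro u hu
    obtain ⟨m, hm⟩ : ∃ m, u ∈ freeLieWeight (ChevalleyGen.deg τ) ChevalleyGen.height m := by
      rcases hu with h | h | h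
      · exact h.mem_freeLieWeight
      · exact h.mem_freeLieWeight
      · exact h.mem_freeLieWeight
    exact ⟨Submodule.mem_iSup_of_mem m ⟨subset_idealGen _ _ hu, hm⟩, _, freeLieWeight_le_grade hm⟩
  · intro a b x y _ _ hy
    have hx : x ∈ ⨆ m, freeLieWeight (k := k) (ChevalleyGen.deg τ) ChevalleyGen.height m :=
      iSup_freeLieWeight.ge (Submodule.mem_top (x := x))
    refine map₂_mem_of_mem_iSup (freeLie k (ChevalleyGen.deg τ)).toLie.br ?_ hx hy
    rintro m n x hx y ⟨hy, hy'⟩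
    exact Submodule.mem_iSup_of_mem (m + n)
      ⟨(kacMoodyIdeal k A τ).br_mem_left x y hy, br_mem_freeLieWeight hx hy'⟩

theorem exists_kacMoody_projection (p : ZMod 2 × ℤ → Prop) :
    ∃ q : KacMoodySpace k A τ →ₗ[k] KacMoodySpace k A τ,
      (∀ m u, p m → u ∈ kacMoodyWeight k A τ m → q u = u) ∧
      ∀ m u, ¬ p m → u ∈ kacMoodyWeight k A τ m → q u = 0 := by
  obtain ⟨q, h1, h0⟩ := exists_freeLie_projection (k := k) (deg := ChevalleyGen.deg τ)
    (d := ChevalleyGen.height) p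
  have hI : (kacMoodyIdeal k A τ).carrier ≤ (kacMoodyIdeal k A τ).carrier.comap q := by
    refine kacMoodyIdeal_le_iSup.trans (iSup_le ?_)
    rintro m u ⟨hu, hm⟩
    rw [Submodule.mem_comap]
    by_cases hp : p m
    · rw [h1 m u hp hm]
      exact hu
    · rw [h0 m u hp hm]
      exact zero_mem _
  refine ⟨(kacMoodyIdeal k A τ).carrier.mapQ _ q hI, ?_, ?_⟩
  · rintro m _ hp ⟨u, hu, rfl⟩
    rw [Submodule.mkQ_apply, Submodule.mapQ_apply, h1 m u hp hu]
  · rintro m _ hp ⟨u, hu, rfl⟩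
    rw [Submodule.mkQ_apply, Submodule.mapQ_apply, h0 m u hp hu, Submodule.Quotient.mk_zero]

/-- Subspaces spanned by elements with weights in disjoint sets are independent. -/
theorem exists_kacMoody_projection_iSup (p : ZMod 2 × ℤ → Prop) :
    ∃ q : KacMoodySpace k A τ →ₗ[k] KacMoodySpace k A τ,
      (∀ u ∈ ⨆ m : {m // p m}, kacMoodyWeight k A τ m, q u = u) ∧
      ∀ s : ZMod 2 × ℤ → Prop, (∀ m, s m → ¬ p m) →
        ∀ u ∈ ⨆ m : {m // s m}, kacMoodyWeight k A τ m, q u = 0 := by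
  obtain ⟨q, h1, h0⟩ := exists_kacMoody_projection (k := k) (A := A) (τ := τ) p
  refine ⟨q, fun u hu => ?_, fun s hs u hu => ?_⟩
  · have : ⨆ m : {m // p m}, kacMoodyWeight k A τ m ≤ LinearMap.eqLocus q LinearMap.id :=
      iSup_le fun m u hu => h1 m u m.2 hu
    exact this hu
  · have : ⨆ m : {m // s m}, kacMoodyWeight k A τ m ≤ LinearMap.ker q :=
      iSup_le fun m u hu => h0 m u (hs m m.2) hu
    exact this hu

theorem kacMoodyPos_le : (kacMoodyPos k A τ).carrier ≤
    ⨆ m : {m : ZMod 2 × ℤ // 0 < m.2}, kacMoodyWeight k A τ m := by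
  refine subGen_le_iSup br_mem_kacMoodyWeight (fun m n => Int.add_pos) ?_
  rintro _ ⟨i, rfl⟩
  exact ⟨⟨_, by simp [ChevalleyGen.height], kacMoodyGen_mem_weight (.e i)⟩, _,
    kacMoodyGen_e_mem k A τ i⟩

theorem kacMoodyZero_le : (kacMoodyZero k A τ).carrier ≤
    ⨆ m : {m : ZMod 2 × ℤ // m.2 = 0}, kacMoodyWeight k A τ m := by
  refine subGen_le_iSup br_mem_kacMoodyWeight (fun m n hm hn => ?_) ?_
  · rw [Prod.snd_add, hm, hn, add_zero]
  · rintro _ ⟨i, rfl⟩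
    exact ⟨⟨_, by simp [ChevalleyGen.height], kacMoodyGen_mem_weight (.h i)⟩, _,
      kacMoodyGen_h_mem k A τ i⟩

theorem kacMoodyNeg_le : (kacMoodyNeg k A τ).carrier ≤
    ⨆ m : {m : ZMod 2 × ℤ // m.2 < 0}, kacMoodyWeight k A τ m := by
  refine subGen_le_iSup br_mem_kacMoodyWeight (fun m n => Int.add_neg) ?_
  rintro _ ⟨i, rfl⟩
  exact ⟨⟨_, by simp [ChevalleyGen.height], kacMoodyGen_mem_weight (.f i)⟩, _,
    kacMoodyGen_f_mem k A τ i⟩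

theorem eq_zero_of_triangular_sum_eq_zero {x y z : KacMoodySpace k A τ}
    (hx : x ∈ (kacMoodyPos k A τ).carrier) (hy : y ∈ (kacMoodyZero k A τ).carrier)
    (hz : z ∈ (kacMoodyNeg k A τ).carrier) (h : x + y + z = 0) : x = 0 ∧ y = 0 ∧ z = 0 := by
  have hx' : x = 0 := by
    obtain ⟨q, h1, h0⟩ := exists_kacMoody_projection_iSup (k := k) (A := A) (τ := τ)
      (fun m => 0 < m.2)
    have e := congrArg q h
    rwa [map_add, map_add, h1 _ (kacMoodyPos_le hx),
      h0 _ (fun m hm => by omega) _ (kacMoodyZero_le hy),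
      h0 _ (fun m hm => by omega) _ (kacMoodyNeg_le hz), map_zero, add_zero, add_zero] at e
  have hy' : y = 0 := by
    obtain ⟨q, h1, h0⟩ := exists_kacMoody_projection_iSup (k := k) (A := A) (τ := τ)
      (fun m => m.2 = 0)
    have e := congrArg q h
    rwa [map_add, map_add, hx', map_zero, h1 _ (kacMoodyZero_le hy),
      h0 _ (fun m hm => by omega) _ (kacMoodyNeg_le hz), add_zero, zero_add] at e
  rw [hx', hy', zero_add, zero_add] at h
  exact ⟨hx', hy', h⟩

end KacMoody

/-! ### The three subalgebras span -/

namespace LieSuperalgebra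

variable {k L : Type*} [Field k] [AddCommGroup L] [Module k L] {G : LieSuperalgebra k L}

theorem jacobi_of_mem {a b : ZMod 2} {x y : L} (hx : x ∈ G.grade a) (hy : y ∈ G.grade b) (z : L) :
    G.br x (G.br y z) = G.br (G.br x y) z + koszulSign k a b • G.br y (G.br x z) := by
  obtain ⟨z0, h0, z1, h1, rfl⟩ := G.exists_components z
  simp only [map_add, smul_add, G.jacobi hx hy h0, G.jacobi hx hy h1]
  abel

theorem br_even_right {v : L} (hv : v ∈ G.grade 0) (u : L) : G.br u v = -G.br v u := by
  obtain ⟨u0, h0, u1, h1, rfl⟩ := G.exists_components u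
  simp only [map_add, LinearMap.add_apply]
  rw [G.skew h0 hv, G.skew h1 hv, koszulSign_zero_right, koszulSign_zero_right]
  module

variable {r : ℕ} {x h : Fin r → L} {p : Fin r → ZMod 2}

/-- Each $h_i$ scales the generators $x_j$ and acts as a derivation, so it normalizes the subalgebra
they generate. -/
theorem br_subGen_of_eigen (hx : ∀ i, x i ∈ G.grade (p i)) (hh : ∀ i, h i ∈ G.grade 0)
    (hhx : ∀ i j, ∃ c : k, G.br (h i) (x j) = c • x j) {v u : L}
    (hv : v ∈ Submodule.span k (Set.range h)) (hu : u ∈ (G.subGen (Set.range x)).carrier) :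
    G.br v u ∈ (G.subGen (Set.range x)).carrier ∧ G.br u v ∈ (G.subGen (Set.range x)).carrier := by
  have hP : ∀ i, x i ∈ (G.subGen (Set.range x)).carrier := fun i => subset_subGen _ _ ⟨i, rfl⟩
  have key : ∀ i, (G.subGen (Set.range x)).carrier ≤ (G.subGen (Set.range x)).carrier ⊓
      (G.subGen (Set.range x)).carrier.comap (G.br (h i)) := by
    intro i
    refine G.subGen_le ?_ ?_
    · rintro _ ⟨j, rfl⟩
      obtain ⟨c, hc⟩ := hhx i j
      refine ⟨⟨hP j, ?_⟩, _, hx j⟩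
      rw [SetLike.mem_coe, Submodule.mem_comap, hc]
      exact Submodule.smul_mem _ _ (hP j)
    · rintro a b y z hy hz ⟨h1, h2⟩ ⟨h3, h4⟩
      refine ⟨(G.subGen (Set.range x)).br_mem _ h1 _ h3, ?_⟩
      rw [SetLike.mem_coe, Submodule.mem_comap, G.jacobi_of_mem (hh i) hy]
      exact add_mem ((G.subGen (Set.range x)).br_mem _ h2 _ h3)
        (Submodule.smul_mem _ _ ((G.subGen (Set.range x)).br_mem _ h1 _ h4))
  induction hv using Submodule.span_induction with
  | mem v hv =>
    obtain ⟨i, rfl⟩ := hv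
    refine ⟨(key i hu).2, ?_⟩
    rw [G.br_even_right (hh i)]
    exact neg_mem (key i hu).2
  | zero => simp
  | add v w _ _ hv hw =>
    simp only [map_add, LinearMap.add_apply]
    exact ⟨add_mem hv.1 hw.1, add_mem hv.2 hw.2⟩
  | smul c v _ hv =>
    simp only [map_smul, LinearMap.smul_apply]
    exact ⟨Submodule.smul_mem _ _ hv.1, Submodule.smul_mem _ _ hv.2⟩

/-- Only on a generator can $\operatorname{ad}y$ produce an element of $\sum kh_i$ outside the
subalgebra. In the derivative of a bracket such an element is bracketed once more with the
subalgebra, which it normalizes. -/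
theorem br_subGen_of_lowering (hx : ∀ i, x i ∈ G.grade (p i)) (hh : ∀ i, h i ∈ G.grade 0)
    (hhx : ∀ i j, ∃ c : k, G.br (h i) (x j) = c • x j) {b : ZMod 2} {y u : L} (hy : y ∈ G.grade b)
    (hyx : ∀ j, G.br y (x j) ∈ Submodule.span k (Set.range h))
    (hu : u ∈ (G.subGen (Set.range x)).carrier) :
    G.br y u ∈ (G.subGen (Set.range x)).carrier ⊔ Submodule.span k (Set.range h) := by
  have key : (G.subGen (Set.range x)).carrier ≤ (G.subGen (Set.range x)).carrier ⊓
      ((G.subGen (Set.range x)).carrier ⊔ Submodule.span k (Set.range h)).comap (G.br y) := by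
    refine G.subGen_le ?_ ?_
    · rintro _ ⟨j, rfl⟩
      exact ⟨⟨subset_subGen _ _ ⟨j, rfl⟩, Submodule.mem_sup_right (hyx j)⟩, _, hx j⟩
    · rintro a c u w hu hw ⟨h1, h2⟩ ⟨h3, h4⟩
      refine ⟨(G.subGen (Set.range x)).br_mem _ h1 _ h3, Submodule.mem_sup_left ?_⟩
      obtain ⟨u1, hu1, v1, hv1, e1⟩ := Submodule.mem_sup.1 h2
      obtain ⟨u2, hu2, v2, hv2, e2⟩ := Submodule.mem_sup.1 h4
      rw [G.jacobi_of_mem hy hu, ← e1, ← e2]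
      simp only [map_add, LinearMap.add_apply]
      exact add_mem (add_mem ((G.subGen (Set.range x)).br_mem _ hu1 _ h3)
        (br_subGen_of_eigen hx hh hhx hv1 h3).1)
        (Submodule.smul_mem _ _ (add_mem ((G.subGen (Set.range x)).br_mem _ h1 _ hu2)
          (br_subGen_of_eigen hx hh hhx hv2 h1).2))
  exact (key hu).2

theorem br_span_eq_zero (hhh : ∀ i j, G.br (h i) (h j) = 0) {u v : L}
    (hu : u ∈ Submodule.span k (Set.range h)) (hv : v ∈ Submodule.span k (Set.range h)) :
    G.br u v = 0 := by
  induction hu using Submodule.span_induction with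
  | mem u hu =>
    obtain ⟨i, rfl⟩ := hu
    induction hv using Submodule.span_induction with
    | mem v hv =>
      obtain ⟨j, rfl⟩ := hv
      exact hhh i j
    | zero => simp
    | add v w _ _ hv hw => rw [map_add, hv, hw, add_zero]
    | smul c v _ hv => rw [map_smul, hv, smul_zero]
  | zero => simp
  | add v w _ _ hv hw => rw [map_add, LinearMap.add_apply, hv, hw, add_zero]
  | smul c v _ hv => rw [map_smul, LinearMap.smul_apply, hv, smul_zero]

end LieSuperalgebra

section KacMoody

variable {R : Type*} [CommRing R] {r : ℕ} {k : Type*} [Field k] [Algebra R k]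
  {A : Matrix (Fin r) (Fin r) R} {τ : Finset (Fin r)}

theorem kacMoody_triangular_stable (h2 : (2 : k) ≠ 0) (g : ChevalleyGen r)
    {u : KacMoodySpace k A τ} (hu : u ∈ (kacMoodyPos k A τ).carrier ⊔
      Submodule.span k (Set.range fun i => kacMoodyGen k A τ (.h i)) ⊔
      (kacMoodyNeg k A τ).carrier) :
    (kacMoody k A τ).br (kacMoodyGen k A τ g) u ∈ (kacMoodyPos k A τ).carrier ⊔
      Submodule.span k (Set.range fun i => kacMoodyGen k A τ (.h i)) ⊔
      (kacMoodyNeg k A τ).carrier := by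
  have hhe : ∀ i j, ∃ c : k, (kacMoody k A τ).br (kacMoodyGen k A τ (.h i))
      (kacMoodyGen k A τ (.e j)) = c • kacMoodyGen k A τ (.e j) := fun i j => ⟨_, by
    rw [kacMoody_skew_even (kacMoodyGen_h_mem k A τ i) (kacMoodyGen_e_mem k A τ j), kacMoody_eh,
      neg_neg]⟩
  have hhf : ∀ i j, ∃ c : k, (kacMoody k A τ).br (kacMoodyGen k A τ (.h i))
      (kacMoodyGen k A τ (.f j)) = c • kacMoodyGen k A τ (.f j) := fun i j => ⟨_, by
    rw [kacMoody_hf, ← neg_smul]⟩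
  have mh : ∀ i, kacMoodyGen k A τ (.h i) ∈
      Submodule.span k (Set.range fun i => kacMoodyGen k A τ (.h i)) :=
    fun i => Submodule.subset_span ⟨i, rfl⟩
  have hef : ∀ i j, (kacMoody k A τ).br (kacMoodyGen k A τ (.e i)) (kacMoodyGen k A τ (.f j)) ∈
      Submodule.span k (Set.range fun i => kacMoodyGen k A τ (.h i)) := by
    intro i j
    rw [kacMoody_ef]
    split_ifs
    · exact mh i
    · exact zero_mem _
  have hfe : ∀ i j, (kacMoody k A τ).br (kacMoodyGen k A τ (.f i)) (kacMoodyGen k A τ (.e j)) ∈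
      Submodule.span k (Set.range fun i => kacMoodyGen k A τ (.h i)) := by
    intro i j
    rw [(kacMoody k A τ).skew (kacMoodyGen_f_mem k A τ i) (kacMoodyGen_e_mem k A τ j)]
    exact neg_mem (Submodule.smul_mem _ _ (hef j i))
  have he := kacMoodyGen_e_mem k A τ
  have hf := kacMoodyGen_f_mem k A τ
  have hh := kacMoodyGen_h_mem k A τ
  have me : ∀ i, kacMoodyGen k A τ (.e i) ∈ (kacMoodyPos k A τ).carrier :=
    fun i => subset_subGen _ _ ⟨i, rfl⟩
  have mf : ∀ i, kacMoodyGen k A τ (.f i) ∈ (kacMoodyNeg k A τ).carrier :=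
    fun i => subset_subGen _ _ ⟨i, rfl⟩
  obtain ⟨y, hy, z, hz, rfl⟩ := Submodule.mem_sup.1 hu
  obtain ⟨x, hx, y, hy', rfl⟩ := Submodule.mem_sup.1 hy
  simp only [map_add]
  rcases g with i | i | i
  · refine add_mem (Submodule.mem_sup_left (Submodule.mem_sup_left (add_mem
      ((kacMoodyPos k A τ).br_mem _ (me i) _ hx) (br_subGen_of_eigen he hh hhe hy' (me i)).2))) ?_
    exact SetLike.le_def.1 (sup_le le_sup_right (le_sup_right.trans le_sup_left))
      (br_subGen_of_lowering hf hh hhf (he i) (hef i) hz)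
  · refine add_mem (Submodule.mem_sup_left (Submodule.mem_sup_left (add_mem
      (br_subGen_of_eigen he hh hhe (mh i) hx).1 ?_)))
      (Submodule.mem_sup_right (br_subGen_of_eigen hf hh hhf (mh i) hz).1)
    rw [br_span_eq_zero (kacMoody_hh h2) (mh i) hy']
    exact zero_mem _
  · rw [add_assoc]
    refine add_mem ?_ (Submodule.mem_sup_right (add_mem
      (br_subGen_of_eigen hf hh hhf hy' (mf i)).2 ((kacMoodyNeg k A τ).br_mem _ (mf i) _ hz)))
    exact Submodule.mem_sup_left (br_subGen_of_lowering he hh hhe (hf i) (hfe i) hx)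

theorem kacMoody_triangular_span (h2 : (2 : k) ≠ 0) : (kacMoodyPos k A τ).carrier ⊔
    (kacMoodyZero k A τ).carrier ⊔ (kacMoodyNeg k A τ).carrier = ⊤ := by
  -- The middle summand is replaced by the span of the $h_i$, whose brackets are explicit; it lies
  -- in $\mathcal G_0$, so this is enough.
  set N := (kacMoodyPos k A τ).carrier ⊔
      Submodule.span k (Set.range fun i => kacMoodyGen k A τ (.h i)) ⊔
      (kacMoodyNeg k A τ).carrier with hN
  -- The stabilizer of `N` is closed under brackets by the Jacobi identity and contains the
  -- generators, so it is everything. Then `N` is itself closed under brackets and contains the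
  -- generators.
  let K : Submodule k (KacMoodySpace k A τ) :=
    { carrier := {x | ∀ u ∈ N, (kacMoody k A τ).br x u ∈ N}
      add_mem' := fun hx hy u hu => by
        rw [map_add, LinearMap.add_apply]
        exact add_mem (hx u hu) (hy u hu)
      zero_mem' := fun u _ => by simp
      smul_mem' := fun c x hx u hu => by
        rw [map_smul, LinearMap.smul_apply]
        exact Submodule.smul_mem _ _ (hx u hu) }
  have hK : K = ⊤ := by
    refine kacMoody_eq_top (fun g u hu => kacMoody_triangular_stable h2 g hu) ?_
    intro a b x y hx hy hx' hy' u hu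
    have h := (kacMoody k A τ).jacobi_of_mem hx hy u
    rw [← sub_eq_iff_eq_add] at h
    rw [← h]
    exact sub_mem (hx' _ (hy' u hu)) (Submodule.smul_mem _ _ (hy' _ (hx' u hu)))
  have hN' : N = ⊤ := by
    refine kacMoody_eq_top ?_ (fun {a b x y} _ _ _ hy => hK.ge (Submodule.mem_top (x := x)) y hy)
    rintro (i | i | i)
    · exact Submodule.mem_sup_left (Submodule.mem_sup_left (subset_subGen _ _ ⟨i, rfl⟩))
    · exact Submodule.mem_sup_left (Submodule.mem_sup_right (Submodule.subset_span ⟨i, rfl⟩))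
    · exact Submodule.mem_sup_right (subset_subGen _ _ ⟨i, rfl⟩)
  rw [eq_top_iff, ← hN']
  exact sup_le_sup_right (sup_le_sup_left (Submodule.span_le.2 (subset_subGen _ _)) _) _

/-- The triangular decomposition of the Kac-Moody superalgebra. -/
theorem exists_triangular_equiv (h2 : (2 : k) ≠ 0) :
    ∃ φ : ((kacMoodyPos k A τ).carrier × (kacMoodyZero k A τ).carrier ×
        (kacMoodyNeg k A τ).carrier) ≃ₗ[k] KacMoodySpace k A τ,
      ∀ x y z, φ (x, y, z) = (x : KacMoodySpace k A τ) + y + z := by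
  let s : ((kacMoodyPos k A τ).carrier × (kacMoodyZero k A τ).carrier ×
      (kacMoodyNeg k A τ).carrier) →ₗ[k] KacMoodySpace k A τ :=
    (kacMoodyPos k A τ).carrier.subtype.coprod
      ((kacMoodyZero k A τ).carrier.subtype.coprod (kacMoodyNeg k A τ).carrier.subtype)
  have hs : ∀ x y z, s (x, y, z) = (x : KacMoodySpace k A τ) + y + z := fun x y z => by
    simp [s, add_assoc]
  refine ⟨LinearEquiv.ofBijective s ⟨?_, ?_⟩, hs⟩
  · refine (injective_iff_map_eq_zero s).2 ?_
    rintro ⟨x, y, z⟩ h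
    rw [hs] at h
    obtain ⟨hx, hy, hz⟩ := eq_zero_of_triangular_sum_eq_zero x.2 y.2 z.2 h
    exact Prod.ext (Subtype.ext hx) (Prod.ext (Subtype.ext hy) (Subtype.ext hz))
  · intro u
    obtain ⟨v, hv, z, hz, rfl⟩ := Submodule.mem_sup.1
      ((kacMoody_triangular_span h2).ge (Submodule.mem_top (x := u)))
    obtain ⟨x, hx, y, hy, rfl⟩ := Submodule.mem_sup.1 hv
    exact ⟨(⟨x, hx⟩, ⟨y, hy⟩, ⟨z, hz⟩), hs _ _ _⟩

end KacMoody

theorem mainTheorem6 {R : Type*} [CommRing R] [CharZero R] (k : Type*) [Field k] [Algebra R k]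
    (h2 : (2 : k) ≠ 0) (h3 : (3 : k) ≠ 0) {r : ℕ} (A : Matrix (Fin r) (Fin r) R)
    (τ : Finset (Fin r)) (hA : IsSuperGCM A τ) :
    (∃ φ : ((kacMoodyPos k A τ).carrier × (kacMoodyZero k A τ).carrier ×
          (kacMoodyNeg k A τ).carrier) ≃ₗ[k] KacMoodySpace k A τ,
        ∀ x y z, φ (x, y, z) = (x : KacMoodySpace k A τ) + y + z) ∧
    (∃ ψ : ((kacMoodyPos k A τ).toLie.Env ⊗[k] (kacMoodyZero k A τ).toLie.Env ⊗[k]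
          (kacMoodyNeg k A τ).toLie.Env) ≃ₗ[k] (kacMoody k A τ).Env,
        ∀ u v w, ψ (u ⊗ₜ v ⊗ₜ w) =
          (kacMoodyPos k A τ).envMap u * (kacMoodyZero k A τ).envMap v *
            (kacMoodyNeg k A τ).envMap w) :=
  ⟨exists_triangular_equiv h2,
    LinearEquiv.ofBijective _ (tripleMul_envMap_bijective h2 hA), tripleMul_tmul _ _ _⟩
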